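/- **Conventions.** A finite Markov decision process has states $s$, finite nonempty sets $A_s$ of actions, transition probabilities $p(s'\mid s,a)$ and rewards $r(s,a)$; a sink is absorbing with reward $0$. A policy $\pi$ picks $\pi(s)\in A_s$ for every $s$. Under the *total reward criterion*, $\mathrm{Val}^\pi(s)$ is the limit, as $T\to\infty$, of the expected reward of the first $T$ steps from $s$ (if it exists for every $s$), and $\mathrm{Appeal}^\pi(s,a)=r(s,a)+\sum_{s'}p(s'\mid s,a)\mathrm{Val}^\pi(s')$. Under the *average reward criterion*, $\mathrm{Val}^\pi(s)=(g(s),h(s))$, where $g$ is the gain (the limit of $\frac1T$ times the expected reward of the first $T$ steps) and $h$ the bias (the Cesàro limit of the expected accumulated excess of the reward over the gain), $\mathrm{Appeal}^\pi(s,a)=\bigl(\sum_{s'}p(s'\mid s,a)g(s'),\;r(s,a)-g(s)+\sum_{s'}p(s'\mid s,a)h(s')\bigr)$, and pairs are compared lexicographically. A state is switchable if some $a\in A_s$ has $\mathrm{Appeal}^\pi(s,a)>\mathrm{Val}^\pi(s)$. In each iteration, Greedy PI switches every switchable state to an action of greatest appeal (ties broken arbitrarily) and leaves the other states unchanged; it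 stops when no state is switchable. A policy is optimal if it maximizes the value of every state among all policies that have values. **The full construction.** Let $n\ge1$ and $f(i)=3+6i$. The parameters are reals $r(i)$ and $c(i)$ ($1\le i\le n$) with $c(1)=0$; costs $\epsilon(c_i),\epsilon(d_i)>0$ ($1\le i\le n+1$); and, for $2\le i\le n$ and $1\le j\le f(i)$, reals $\delta^i_j$ and probabilities $p^i_j,\alpha_i\in(0,1]$. The states are a sink, $w_i,c_i,d_i$ ($1\le i\le n+1$), $b_i$ ($1\le i\le n$) and $b_i^-,b_i^+$ ($2\le i\le n$); put $b_1^-:=b_1$. Actions are deterministic with reward $0$ unless stated otherwise. * $w_i$ ($i\le n$) has an action to $b_j^-$ for each $j$ with $i\le j\le n$, and one to the sink; $w_{n+1}$ goes to the sink. * For $i\le n$: $c_i$ has action $0$ to $w_{i+1}$ and action $1$ to $b_i^-$ with reward $-\epsilon(c_i)$; $d_i$ has action $0$ to $w_{i+1}$ and action $1$ to $c_i$ with reward $-\epsilon(d_i)$. * $c_{n+1}$ goes to $d_{n+1}$ with reward $-\epsilon(c_{n+1})$, and $d_{n+1}$ goes to the sink with reward $-\epsilon(d_{n+1})$. * $b_1$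 has action $0$ to $w_2$ and action $1$ to $d_2$ with reward $r(1)$. * For $i\ge2$: $b_i^-$ goes to $b_i$ with reward $-c(i)$, and $b_i^+$ goes to $d_{i+1}$ with reward $r(i)$. The state $b_i$ has action $1$, which goes to $b_i^+$ with probability $\alpha_i$ and stays at $b_i$ otherwise; action $a^i_0$ to $w_1$; and actions $a^i_j$ ($1\le j\le f(i)$), each of which goes to $b_1$, collecting $\delta^i_j$, with probability $p^i_j$, and stays at $b_i$ with reward $0$ otherwise. In the all-zero policy every $w_i$ goes to the sink, $b_1$ and $c_i,d_i$ ($i\le n$) choose $0$, and $b_i$ chooses $a^i_0$ for $i\ge2$. For a policy let $B=\{i: b_i \text{ chooses } 1\}$. The policy satisfies the *weak invariant* if for all $i\le n$: $c_i,d_i$ choose $1$ when $i\in B$ and $0$ when $i\notin B$, and $w_i$ chooses the action to $b_\ell^-$ with $\ell=\min\{k\in B:k\ge i\}$, or to the sink if there is no such $k$. Let $\epsilon_{\max}$ be the largest of the small costs $\epsilon(\cdot)$ and $\delta_{\max}$ the largest $\delta^i_j$ ($0$ if $n=1$). The parameters are *admissible* if, with values and appeals under the total reward criterion: 1. $r(i)-c(i)-2n\epsilon_{\max}-\delta_{\max}>\sum_{j<i}r(j)$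 for all $i$; 2. $c(i)>\delta_{\max}+2n\epsilon_{\max}+\sum_{j<i}r(j)$ for all $i\ge2$; 3. under the weak invariant, $\mathrm{Val}(b_1)\le r(1)+\sum_{i\in B,\,i>1}(r(i)-c(i))$; 4. under the weak invariant, for every $i\in B$, with $u_i=r(i)+\sum_{j\in B,\,j>i}(r(j)-c(j))$, one has $u_i-2(n-i+1)\epsilon_{\max}\le\mathrm{Val}(b_i)\le u_i$; 5. under the weak invariant, if $i\ge2$ and $b_i$ chooses $a^i_j$, then $b_i$ is switchable and its unique action of greatest appeal is $a^i_{j+1}$ if $j\ne f(i)$, and $1$ if $j=f(i)$. **Theorem.** Let $n\ge1$. For all admissible parameters, under the total reward criterion and likewise under the average reward criterion, Greedy PI can be run from the all-zero policy (every policy it reaches has well-defined values), and each of its runs arrives at an optimal policy, where it stops, after some number $T\ge2^n$ of iterations; no earlier policy of the run is optimal, and at each earlier policy some state is switchable. The run simulates a binary counter: there are times $0=\tau_0<\tau_1<\dots<\tau_{2^n-1}=T$ such that at time $\tau_k$ the bits ($b_i$ chooses $1$ or not, $b_1$ being the least significant bit) are the binary digits of $k$. Moreover, the parameters $r(i)=2^{2i+1}$,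 $c(i)=2^{2i}$ for $i\ge2$, $c(1)=0$, $\epsilon(c_i)=\epsilon(d_i)=2^{-100n}$, $\delta^i_j=3j\cdot2^{-100n}$, $p^i_j=2^{-2j}$, $\alpha_i=2^{-1000n}$ are admissible. -/

import Mathlib

open Filter Topology

noncomputable section

/-! ## Markov decision processes, criteria, and Greedy policy iteration -/

/-- A finite Markov decision process. `avail s` is the set `A_s` of actions available at `s`,
`p s a s'` is `p(s' | s, a)` and `r s a` is the (expected) reward of taking `a` at `s`.
A sink is an absorbing state whose only action has reward `0`.
Values of `p` and `r` at unavailable actions are never used. -/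
structure MDP (S Act : Type) [Fintype S] where
  avail : S → Finset Act
  avail_nonempty : ∀ s, (avail s).Nonempty
  p : S → Act → S → ℝ
  r : S → Act → ℝ
  p_nonneg : ∀ s, ∀ a ∈ avail s, ∀ s', 0 ≤ p s a s'
  p_sum : ∀ s, ∀ a ∈ avail s, ∑ s', p s a s' = 1

namespace MDP

variable {S Act : Type} [Fintype S] [DecidableEq S] {L : Type} [LinearOrder L]

/-- Positional policies. -/
def Policy (M : MDP S Act) : Type := {π : S → Act // ∀ s, π s ∈ M.avail s}

/-- Transition matrix of the Markov chain induced by a policy. -/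
def transition (M : MDP S Act) (π : M.Policy) : Matrix S S ℝ := fun s s' => M.p s (π.1 s) s'

/-- One-step reward vector of a policy. -/
def reward (M : MDP S Act) (π : M.Policy) : S → ℝ := fun s => M.r s (π.1 s)

/-- The expectation of `∑_{t < T} x(s_t)` for the chain started at `s`. -/
def partialSum (M : MDP S Act) (π : M.Policy) (x : S → ℝ) (T : ℕ) (s : S) : ℝ :=
  ∑ t ∈ Finset.range T, ((M.transition π ^ t).mulVec x) s

/-- `v` is the total reward value of `π`: at every state the expected reward collected in the
first `T` steps converges to `v` as `T → ∞`. -/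
def HasTotalValue (M : MDP S Act) (π : M.Policy) (v : S → ℝ) : Prop :=
  ∀ s, Tendsto (fun T => M.partialSum π (M.reward π) T s) atTop (𝓝 (v s))

/-- `g` is the gain of `π`: the long-run average of the expected reward. -/
def HasGain (M : MDP S Act) (π : M.Policy) (g : S → ℝ) : Prop :=
  ∀ s, Tendsto (fun T : ℕ => M.partialSum π (M.reward π) T s / T) atTop (𝓝 (g s))

/-- `h` is the bias of a policy `π` with gain `g`: the Cesàro limit of the expected
accumulated excess of the reward over the gain. -/
def HasBias (M : MDP S Act) (π : M.Policy) (g h : S → ℝ) : Prop :=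
  ∀ s, Tendsto (fun N : ℕ =>
    (∑ T ∈ Finset.range N, M.partialSum π (fun s' => M.reward π s' - g s') T s) / N)
    atTop (𝓝 (h s))

/-- A criterion relates a policy to its values and to the appeals of the actions, both of which
lie in some linear order `L`. -/
abbrev Criterion (M : MDP S Act) (L : Type) : Type :=
  M.Policy → (S → L) → (S → Act → L) → Prop

/-- Total reward criterion, with
`Appeal(s, a) = r(s, a) + ∑_{s'} p(s' | s, a) * Val(s')`. -/
def totalReward (M : MDP S Act) : M.Criterion ℝ := fun π val appeal =>
  M.HasTotalValue π val ∧ ∀ s a, appeal s a = M.r s a + ∑ s', M.p s a s' * val s'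

/-- Average reward criterion: actions are compared first by gain and then, among actions of equal
gain, by bias. -/
def averageReward (M : MDP S Act) : M.Criterion (ℝ ×ₗ ℝ) := fun π val appeal =>
  ∃ g h : S → ℝ, M.HasGain π g ∧ M.HasBias π g h ∧
    (∀ s, val s = toLex (g s, h s)) ∧
    ∀ s a, appeal s a =
      toLex (∑ s', M.p s a s' * g s', M.r s a - g s + ∑ s', M.p s a s' * h s')

/-- `s` is switchable: some available action has an appeal above the value of `s`. -/
def Switchable (M : MDP S Act) (val : S → L) (appeal : S → Act → L) (s : S) : Prop :=
  ∃ a ∈ M.avail s, val s < appeal s a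

/-- One iteration of Greedy PI: every switchable state switches to an action of greatest appeal,
the other states keep their action. Part of the claim is that `π` has well-defined values. -/
def GreedyStep (M : MDP S Act) (crit : M.Criterion L) (π π' : M.Policy) : Prop :=
  ∃ val appeal, crit π val appeal ∧ ∀ s,
    (M.Switchable val appeal s → ∀ a ∈ M.avail s, appeal s a ≤ appeal s (π'.1 s)) ∧
    (¬ M.Switchable val appeal s → π'.1 s = π.1 s)

/-- `ρ` is a sequence of policies produced by Greedy PI from `π₀` (`ρ t` is the policy after
`t` iterations; it stays constant once no state is switchable). -/
def IsGreedyRun (M : MDP S Act) (crit : M.Criterion L) (π₀ : M.Policy) (ρ : ℕ → M.Policy) : Prop :=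
  ρ 0 = π₀ ∧ ∀ t, M.GreedyStep crit (ρ t) (ρ (t + 1))

/-- `π` is optimal: it maximizes the value of every state among all policies that have values. -/
def IsOptimal (M : MDP S Act) (crit : M.Criterion L) (π : M.Policy) : Prop :=
  ∃ val appeal, crit π val appeal ∧
    ∀ π' val' appeal', crit π' val' appeal' → ∀ s, val' s ≤ val s

/-- No state is switchable under `π`, that is, policy iteration stops at `π`. -/
def IsTerminal (M : MDP S Act) (crit : M.Criterion L) (π : M.Policy) : Prop :=
  ∃ val appeal, crit π val appeal ∧ ∀ s, ¬ M.Switchable val appeal s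

end MDP

/-! ## The full construction

Bits are indexed by `i : Fin n`; the index `i` stands for bit number `i + 1`, so `b 0` is `b_1`,
`w 0` is `w_1` and `w (Fin.last n)` is `w_{n+1}`. -/

namespace FullConstruction

/-- The states. `bMinus`, `bPlus` exist for `b_2, …, b_n` only; `cTop`, `dTop` are
`c_{n+1}`, `d_{n+1}`. -/
inductive State (n : ℕ) [NeZero n] : Type
  | sink : State n
  | w (i : Fin (n + 1)) : State n
  | b (i : Fin n) : State n
  | bMinus (i : {i : Fin n // i ≠ 0}) : State n
  | bPlus (i : {i : Fin n // i ≠ 0}) : State n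
  | c (i : Fin n) : State n
  | d (i : Fin n) : State n
  | cTop : State n
  | dTop : State n
  deriving DecidableEq, Fintype

/-- The actions. `zero` and `one` are the actions `0` and `1`; `delay j` is `a^i_j` at `b_i`;
`toBit j` and `toSink` are the actions of the `w_i`; `only` is the action of a state that has
just one. -/
inductive Action (n : ℕ) : Type
  | zero : Action n
  | one : Action n
  | delay (j : ℕ) : Action n
  | toBit (j : Fin n) : Action n
  | toSink : Action n
  | only : Action n
  deriving DecidableEq

/-- `f(i) = 3 + 6 i` for the one-based bit number. -/
def f {n : ℕ} (i : Fin n) : ℕ := 3 + 6 * (i.val + 1)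

/-- The parameter values. `p i j` is the probability that `a^i_j` leaves `b_i`, `δ i j` the reward
collected when it does, and `α i` the probability that action `1` of `b_i` leaves `b_i`.
`εc`, `εd` are the small costs at the `c` and `d` states (`Fin.last n` for the top ones).
Only `δ i j`, `p i j` with `i ≠ 0`, `1 ≤ j ≤ f i`, and `α i` with `i ≠ 0`, are used. -/
structure Params (n : ℕ) [NeZero n] where
  r : Fin n → ℝ
  c : Fin n → ℝ
  εc : Fin (n + 1) → ℝ
  εd : Fin (n + 1) → ℝ
  δ : Fin n → ℕ → ℝ
  p : Fin n → ℕ → ℝ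
  α : Fin n → ℝ
  c_first : c 0 = 0
  εc_pos : ∀ i, 0 < εc i
  εd_pos : ∀ i, 0 < εd i
  p_pos : ∀ i j, 0 < p i j
  p_le_one : ∀ i j, p i j ≤ 1
  α_pos : ∀ i, 0 < α i
  α_le_one : ∀ i, α i ≤ 1

variable {n : ℕ} [NeZero n]

/-- The state through which bit `i` is entered: `b_1` itself, and `b_i^-` for the other bits. -/
def entry (i : Fin n) : State n :=
  if h : i = 0 then State.b 0 else State.bMinus ⟨i, h⟩

/-- The state `d_{i+1}` above bit `i`. -/
def dNext (i : Fin n) : State n :=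
  if h : i.val + 1 < n then State.d ⟨i.val + 1, h⟩ else State.dTop

/-- The distribution that goes to `x`. -/
def goto (x : State n) : State n → ℝ := fun s => if s = x then 1 else 0

/-- The distribution that goes to `x` with probability `q` and to `y` otherwise. -/
def lottery (q : ℝ) (x y : State n) : State n → ℝ := fun s => q * goto x s + (1 - q) * goto y s

/-- The available actions. -/
def avail : State n → Finset (Action n)
  | .w i => insert Action.toSink
      ((Finset.univ.filter fun j : Fin n => i ≤ j.castSucc).image Action.toBit)
  | .b i => if i = 0 then {Action.zero, Action.one}
      else insert Action.one ((Finset.range (f i + 1)).image Action.delay)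
  | .c _ => {Action.zero, Action.one}
  | .d _ => {Action.zero, Action.one}
  | _ => {Action.only}

/-- The transition probabilities (the last line only concerns the sink and unavailable actions). -/
def trans (P : Params n) : State n → Action n → State n → ℝ
  | .w _, .toBit j => goto (entry j)
  | .w _, .toSink => goto .sink
  | .b i, .zero => goto (.w i.succ)
  | .b i, .one => if h : i = 0 then goto (dNext i) else lottery (P.α i) (.bPlus ⟨i, h⟩) (.b i)
  | .b _, .delay 0 => goto (.w 0)
  | .b i, .delay (j + 1) => lottery (P.p i (j + 1)) (.b 0) (.b i)
  | .bMinus i, .only => goto (.b i.1)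
  | .bPlus i, .only => goto (dNext i.1)
  | .c i, .zero => goto (.w i.succ)
  | .c i, .one => goto (entry i)
  | .d i, .zero => goto (.w i.succ)
  | .d i, .one => goto (.c i)
  | .cTop, .only => goto .dTop
  | .dTop, .only => goto .sink
  | _, _ => goto .sink

/-- The expected rewards. The reward `δ i j` of `a^i_j` is collected on the transition that leaves
`b_i`, hence the factor `p i j`. -/
def rew (P : Params n) : State n → Action n → ℝ
  | .b i, .one => if i = 0 then P.r i else 0
  | .b i, .delay (j + 1) => P.p i (j + 1) * P.δ i (j + 1)
  | .bMinus i, .only => - P.c i.1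
  | .bPlus i, .only => P.r i.1
  | .c i, .one => - P.εc i.castSucc
  | .d i, .one => - P.εd i.castSucc
  | .cTop, .only => - P.εc (Fin.last n)
  | .dTop, .only => - P.εd (Fin.last n)
  | _, _ => 0

/-- `x` is a probability distribution on the states. -/
def IsDistr (x : State n → ℝ) : Prop := (∀ s, 0 ≤ x s) ∧ ∑ s, x s = 1

theorem isDistr_goto (x : State n) : IsDistr (goto x) := by
  refine ⟨fun s => ?_, ?_⟩
  · unfold goto; split <;> norm_num
  · simp [goto]

theorem isDistr_lottery {q : ℝ} (h0 : 0 < q) (h1 : q ≤ 1) (x y : State n) :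
    IsDistr (lottery q x y) := by
  refine ⟨fun s => ?_, ?_⟩
  · have hx := (isDistr_goto x).1 s
    have hy := (isDistr_goto y).1 s
    have : 0 ≤ 1 - q := by linarith
    unfold lottery
    positivity
  · simp only [lottery, Finset.sum_add_distrib, ← Finset.mul_sum, (isDistr_goto _).2]
    ring

theorem isDistr_trans (P : Params n) (s : State n) (a : Action n) : IsDistr (trans P s a) := by
  unfold trans
  split <;> first
    | exact isDistr_goto _
    | exact isDistr_lottery (P.p_pos _ _) (P.p_le_one _ _) _ _
    | (split
       · exact isDistr_goto _
       · exact isDistr_lottery (P.α_pos _) (P.α_le_one _) _ _)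

theorem avail_nonempty (s : State n) : (avail s).Nonempty := by
  cases s <;> simp only [avail] <;> first
    | exact Finset.insert_nonempty _ _
    | exact Finset.singleton_nonempty _
    | (split <;> exact Finset.insert_nonempty _ _)

/-- The Markov decision process of the full construction. -/
def mdp (P : Params n) : MDP (State n) (Action n) where
  avail := avail
  avail_nonempty := avail_nonempty
  p := trans P
  r := rew P
  p_nonneg := fun s a _ => (isDistr_trans P s a).1
  p_sum := fun s a _ => (isDistr_trans P s a).2

/-- Underlying function of the all-zero policy. -/
def zeroAction : State n → Action n
  | .w _ => .toSink
  | .b i => if i = 0 then .zero else .delay 0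
  | .c _ => .zero
  | .d _ => .zero
  | _ => .only

theorem zeroAction_mem (s : State n) : zeroAction s ∈ avail s := by
  cases s <;> simp only [avail, zeroAction] <;> first
    | simp
    | (split <;> simp)

/-- The all-zero policy: every `w_i` goes to the sink, `b_1` and all `c_i`, `d_i` choose `0`, and
`b_i` chooses `a^i_0` for `i > 1`. -/
def zeroPolicy (P : Params n) : (mdp P).Policy := ⟨zeroAction, zeroAction_mem⟩

/-- The set `B` of bits that are set to `1`. -/
def setBits {P : Params n} (π : (mdp P).Policy) : Finset (Fin n) :=
  Finset.univ.filter fun i => π.1 (.b i) = .one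

/-- The weak invariant. `c_i` and `d_i` agree with bit `i`, and `w_i` goes to the least set bit
`ℓ ≥ i`, or to the sink if there is none. (A bit outside `B` has any action other than `1`.) -/
def WeakInvariant {P : Params n} (π : (mdp P).Policy) : Prop :=
  (∀ i ∈ setBits π, π.1 (.c i) = .one ∧ π.1 (.d i) = .one) ∧
  (∀ i ∉ setBits π, π.1 (.c i) = .zero ∧ π.1 (.d i) = .zero) ∧
  (∀ i ℓ : Fin n, ℓ ∈ setBits π → i ≤ ℓ → (∀ k ∈ setBits π, i ≤ k → ℓ ≤ k) →
    π.1 (.w i.castSucc) = .toBit ℓ) ∧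
  (∀ i : Fin n, (∀ k ∈ setBits π, ¬ i ≤ k) → π.1 (.w i.castSucc) = .toSink)

namespace Params

/-- The largest small cost. -/
def εmax (P : Params n) : ℝ :=
  Finset.univ.sup' Finset.univ_nonempty fun i : Fin (n + 1) => max (P.εc i) (P.εd i)

/-- The largest small reward (`0` if `n = 1`, where no such reward occurs). -/
def δmax (P : Params n) : ℝ :=
  sSup {x : ℝ | ∃ i : Fin n, i ≠ 0 ∧ ∃ j : ℕ, 1 ≤ j ∧ j ≤ f i ∧ x = P.δ i j}

/-- `r(i) - c(i) - 2 n ε_max - δ_max > ∑_{j < i} r(j)` for all `i`. -/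
def RewardGap (P : Params n) : Prop :=
  ∀ i : Fin n, ∑ j ∈ Finset.Iio i, P.r j < P.r i - P.c i - 2 * n * P.εmax - P.δmax

/-- `c(i) > δ_max + 2 n ε_max + ∑_{j < i} r(j)` for all `i > 1`
(there is no cost at `b_1`, where `c(1) = 0` by convention). -/
def CostGap (P : Params n) : Prop :=
  ∀ i : Fin n, i ≠ 0 → P.δmax + 2 * n * P.εmax + ∑ j ∈ Finset.Iio i, P.r j < P.c i

/-- Under the weak invariant, `Val(b_1) ≤ r(1) + ∑_{i ∈ B, i > 1} (r(i) - c(i))`. -/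
def FirstBitBound (P : Params n) : Prop :=
  ∀ (π : (mdp P).Policy) (v : State n → ℝ), WeakInvariant π → (mdp P).HasTotalValue π v →
    v (.b 0) ≤ P.r 0 + ∑ i ∈ setBits π with i ≠ 0, (P.r i - P.c i)

/-- Under the weak invariant, for every `i ∈ B`, the value of `b_i` is at most
`u = r(i) + ∑_{j > i, j ∈ B} (r(j) - c(j))` and at least `u - 2 (n - i + 1) ε_max` (for the
one-based `i`, so that `n - i + 1` is `n - i` for the zero-based index). -/
def SetBitBounds (P : Params n) : Prop :=
  ∀ (π : (mdp P).Policy) (v : State n → ℝ), WeakInvariant π → (mdp P).HasTotalValue π v →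
    ∀ i ∈ setBits π,
      P.r i + ∑ j ∈ setBits π with i < j, (P.r j - P.c j)
          - 2 * ((n : ℝ) - (i.val : ℝ)) * P.εmax ≤ v (.b i) ∧
      v (.b i) ≤ P.r i + ∑ j ∈ setBits π with i < j, (P.r j - P.c j)

/-- Under the weak invariant, if `b_i` (`i > 1`) selects `a^i_j`, then `b_i` is switchable and its
(unique) action of greatest appeal is `a^i_{j+1}` if `j ≠ f(i)` and `1` if `j = f(i)`. -/
def GadgetOrder (P : Params n) : Prop :=
  ∀ (π : (mdp P).Policy) (val : State n → ℝ) (appeal : State n → Action n → ℝ),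
    WeakInvariant π → (mdp P).totalReward π val appeal →
    ∀ (i : Fin n) (j : ℕ), i ≠ 0 → π.1 (.b i) = .delay j →
      (mdp P).Switchable val appeal (.b i) ∧
      ∀ a ∈ avail (State.b i), a ≠ (if j = f i then .one else .delay (j + 1)) →
        appeal (.b i) a < appeal (.b i) (if j = f i then .one else .delay (j + 1))

/-- The five propositions about the parameter values. -/
structure Admissible (P : Params n) : Prop where
  rewardGap : P.RewardGap
  costGap : P.CostGap
  firstBitBound : P.FirstBitBound
  setBitBounds : P.SetBitBounds
  gadgetOrder : P.GadgetOrder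

/-- The standard parameter values, for the one-based `i`: `r(i) = 2^(2i+1)`,
`c(i) = 2^(2i)` for `i > 1`, `c(1) = 0`, all small costs are `ε = 2^(-100n)`, `δ_j = 3 j δ` with
`δ = 2^(-100n)`, `p_j = 2^(-2j)`, and action `1` leaves `b_i` with probability `2^(-1000n)`. -/
def standard (n : ℕ) [NeZero n] : Params n where
  r i := 2 ^ (2 * (i.val + 1) + 1)
  c i := if i = 0 then 0 else 2 ^ (2 * (i.val + 1))
  εc _ := (1 / 2) ^ (100 * n)
  εd _ := (1 / 2) ^ (100 * n)
  δ _ j := 3 * j * (1 / 2) ^ (100 * n)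
  p _ j := (1 / 2) ^ (2 * j)
  α _ := (1 / 2) ^ (1000 * n)
  c_first := by simp
  εc_pos := fun _ => by positivity
  εd_pos := fun _ => by positivity
  p_pos := fun _ _ => by positivity
  p_le_one := fun _ _ => pow_le_one₀ (by norm_num) (by norm_num)
  α_pos := fun _ => by positivity
  α_le_one := fun _ => pow_le_one₀ (by norm_num) (by norm_num)

end Params

/-- Greedy PI from the all-zero policy under the criterion `crit` counts in binary and needs at
least `2^n` iterations: runs exist, and every run `ρ` arrives at an optimal policy, at which it
stops, after exactly `T ≥ 2^n` iterations, no earlier policy being optimal or a stopping point;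
and at increasing times `τ 0 = 0, τ 1, …, τ (2^n - 1) = T` the bits spell the numbers
`0, 1, …, 2^n - 1` in binary. -/
def CountsInBinary {L : Type} [LinearOrder L] (P : Params n)
    (crit : (mdp P).Criterion L) : Prop :=
  (∃ ρ, (mdp P).IsGreedyRun crit (zeroPolicy P) ρ) ∧
  ∀ ρ, (mdp P).IsGreedyRun crit (zeroPolicy P) ρ →
    ∃ T : ℕ, 2 ^ n ≤ T ∧
      (mdp P).IsOptimal crit (ρ T) ∧ (mdp P).IsTerminal crit (ρ T) ∧
      (∀ t < T, ¬ (mdp P).IsOptimal crit (ρ t) ∧ ¬ (mdp P).IsTerminal crit (ρ t)) ∧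
      ∃ τ : ℕ → ℕ, StrictMonoOn τ (Set.Iio (2 ^ n)) ∧ τ 0 = 0 ∧ τ (2 ^ n - 1) = T ∧
        ∀ k < 2 ^ n, ∀ i : Fin n, i ∈ setBits (ρ (τ k)) ↔ k.testBit i.val = true

end FullConstruction

end

/-!
Under the weak invariant the values of the `w_k` and `d_k` form a ladder: going down from the top,
each set bit `i` adds a profit of about `r(i) - c(i)`, and the other bits leave them unchanged.
The gap conditions say that entering a set bit pays whatever happens at the lower bits, while an
unset bit `i > 1` does not repay the cost `c(i)` of its entrance. So nothing changes except that all
unset bits advance through their delay actions in lockstep, until the least unset bit `l`, which has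
the fewest of them, switches to `1`; the first bit has none and switches at once. In the next
iteration the `w_i` and `c_i` react to the new bit, and in the one after it the `d_i`. During that
last iteration the path through the `d_i` with `i < l` still bypasses bit `l`, whereas `w_1` already
leads to it. Hence all bits below `l` reset, and the result is a binary increment. Since `f` grows
by `6` per bit, no higher bit runs out of delay actions in the meantime.

When no action is better than the current one, the values are superharmonic for every action. They
bound the values of all other policies as soon as their negative parts become negligible along every
trajectory. Only `c_{n+1}` and `d_{n+1}` have negative values, and they are left within two steps,
so a bounded potential compensates for them. All values in a run exist as total values, hence the
gain is `0`, the bias is the total value, and both criteria lead to the same greedy steps.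
-/

noncomputable section

/-! ### Total and average reward -/

namespace MDP

section Expectation

variable {S Act : Type} [Fintype S] {M : MDP S Act} {x y : S → ℝ} {s : S} {a : Act}

/-- The expectation of `x` at the next state when the action `a` is taken at `s`. -/
def expectation (M : MDP S Act) (x : S → ℝ) (s : S) (a : Act) : ℝ := ∑ s', M.p s a s' * x s'

/-- The appeals that the total reward criterion derives from the values `v`. -/
def totalAppeal (M : MDP S Act) (v : S → ℝ) (s : S) (a : Act) : ℝ :=
  M.r s a + M.expectation v s a

theorem expectation_add (x y : S → ℝ) (s : S) (a : Act) :
    M.expectation (fun s' => x s' + y s') s a = M.expectation x s a + M.expectation y s a := by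
  simp only [expectation, mul_add, Finset.sum_add_distrib]

theorem expectation_neg (x : S → ℝ) (s : S) (a : Act) :
    M.expectation (fun s' => -x s') s a = -M.expectation x s a := by
  simp only [expectation, mul_neg, Finset.sum_neg_distrib]

theorem expectation_le (ha : a ∈ M.avail s) (h : ∀ s', x s' ≤ y s') :
    M.expectation x s a ≤ M.expectation y s a :=
  Finset.sum_le_sum fun s' _ => mul_le_mul_of_nonneg_left (h s') (M.p_nonneg s a ha s')

theorem expectation_nonneg (ha : a ∈ M.avail s) (h : ∀ s', 0 ≤ x s') : 0 ≤ M.expectation x s a :=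
  Finset.sum_nonneg fun s' _ => mul_nonneg (M.p_nonneg s a ha s') (h s')

theorem tendsto_expectation {u : ℕ → S → ℝ} (h : ∀ s', Tendsto (u · s') atTop (𝓝 (x s'))) :
    Tendsto (fun T => M.expectation (u T) s a) atTop (𝓝 (M.expectation x s a)) :=
  tendsto_finsetSum _ fun s' _ => (h s').const_mul _

end Expectation

section GreedyStep

variable {S Act : Type} [Fintype S] {L : Type} [LinearOrder L] {M : MDP S Act} {π : M.Policy}
  {crit : M.Criterion L} {val : S → L} {appeal : S → Act → L}

theorem exists_greedyStep (h : crit π val appeal) : ∃ π', M.GreedyStep crit π π' := by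
  classical
  have hmax : ∀ s, ∃ a ∈ M.avail s, ∀ b ∈ M.avail s, appeal s b ≤ appeal s a := fun s =>
    Finset.exists_max_image _ _ (M.avail_nonempty s)
  choose best best_mem le_best using hmax
  refine ⟨⟨fun s => if M.Switchable val appeal s then best s else π.1 s, fun s => ?_⟩,
    val, appeal, h, fun s => ⟨fun hs => ?_, fun hs => ?_⟩⟩
  · dsimp only
    split
    · exact best_mem s
    · exact π.2 s
  · simpa [hs] using le_best s
  · simp [hs]

theorem GreedyStep.of_not_switchable (h : crit π val appeal)
    (hs : ∀ s, ¬ M.Switchable val appeal s) : M.GreedyStep crit π π :=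
  ⟨val, appeal, h, fun s => ⟨fun h' => absurd h' (hs s), fun _ => rfl⟩⟩

theorem not_switchable_iff {s : S} :
    ¬ M.Switchable val appeal s ↔ ∀ a ∈ M.avail s, appeal s a ≤ val s := by
  simp only [Switchable, not_exists, not_and, not_lt]

theorem switchable_toLex_iff {v : S → ℝ} {w : S → Act → ℝ} {val : S → ℝ ×ₗ ℝ}
    {appeal : S → Act → ℝ ×ₗ ℝ} (hval : ∀ s, val s = toLex (0, v s))
    (happeal : ∀ s a, appeal s a = toLex (0, w s a)) (s : S) :
    M.Switchable val appeal s ↔ M.Switchable v w s := by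
  simp [Switchable, hval, happeal, Prod.Lex.toLex_lt_toLex]

/-- The appeals that a criterion assigns to a policy depend on its values only. -/
def AppealDetermined (crit : M.Criterion L) : Prop :=
  ∀ π π' val appeal appeal', crit π val appeal → crit π' val appeal' → appeal = appeal'

/-- Policy iteration stops at `π`, and the values at which it stops dominate those of all
policies. -/
def IsTerminalOptimal (M : MDP S Act) (crit : M.Criterion L) (π : M.Policy) : Prop :=
  ∃ val appeal, crit π val appeal ∧ (∀ s, ¬ M.Switchable val appeal s) ∧
    ∀ π' val' appeal', crit π' val' appeal' → ∀ s, val' s ≤ val s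

theorem IsTerminalOptimal.isTerminal_of_isOptimal
    (hd : AppealDetermined crit) (h : M.IsTerminalOptimal crit π) {π' : M.Policy}
    (h' : M.IsOptimal crit π') : M.IsTerminal crit π' := by
  obtain ⟨val, appeal, hcrit, hs, hdom⟩ := h
  obtain ⟨val', appeal', hcrit', hdom'⟩ := h'
  obtain rfl : val = val' :=
    funext fun s => le_antisymm (hdom' _ _ _ hcrit s) (hdom _ _ _ hcrit' s)
  obtain rfl := hd _ _ _ _ _ hcrit hcrit'
  exact ⟨val, appeal, hcrit', hs⟩

end GreedyStep

variable {S Act : Type} [Fintype S] [DecidableEq S] {L : Type} [LinearOrder L]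
  {M : MDP S Act} {π : M.Policy} {g v u : S → ℝ}

section Values

theorem mulVec_pow_succ (x : S → ℝ) (t : ℕ) (s : S) :
    ((M.transition π ^ (t + 1)).mulVec x) s =
      M.expectation ((M.transition π ^ t).mulVec x) s (π.1 s) := by
  rw [pow_succ', ← Matrix.mulVec_mulVec]
  rfl

theorem partialSum_zero (x : S → ℝ) (s : S) : M.partialSum π x 0 s = 0 := by
  simp [partialSum]

theorem partialSum_succ (x : S → ℝ) (T : ℕ) (s : S) :
    M.partialSum π x (T + 1) s = x s + M.expectation (M.partialSum π x T) s (π.1 s) := by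
  simp only [partialSum, Finset.sum_range_succ', mulVec_pow_succ, pow_zero, Matrix.one_mulVec,
    expectation, Finset.mul_sum]
  rw [Finset.sum_comm, add_comm]

theorem HasTotalValue.bellman (h : M.HasTotalValue π v) (s : S) :
    v s = M.totalAppeal v s (π.1 s) := by
  refine tendsto_nhds_unique ((h s).comp (tendsto_add_atTop_nat 1)) ?_
  simp only [Function.comp_def, partialSum_succ]
  exact tendsto_const_nhds.add (tendsto_expectation h)

theorem HasTotalValue.unique {v' : S → ℝ} (h : M.HasTotalValue π v)
    (h' : M.HasTotalValue π v') : v = v' :=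
  funext fun s => tendsto_nhds_unique (h s) (h' s)

/-- The expected total reward from the state `s` converges; `HasTotalValue` asks for this at all
states, while convergence is established state by state. -/
def HasValueAt (M : MDP S Act) (π : M.Policy) (s : S) : Prop :=
  ∃ x, Tendsto (fun T => M.partialSum π (M.reward π) T s) atTop (𝓝 x)

theorem exists_hasTotalValue (h : ∀ s, M.HasValueAt π s) : ∃ v, M.HasTotalValue π v :=
  ⟨fun s => (h s).choose, fun s => (h s).choose_spec⟩

theorem abs_le_of_contracting {q ε : ℝ} (h0 : 0 ≤ q) {e : ℕ → ℝ}
    (he : ∀ k, |e (k + 1)| ≤ q * |e k| + (1 - q) * ε) (k : ℕ) :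
    |e k| - ε ≤ q ^ k * (|e 0| - ε) := by
  induction k with
  | zero => simp
  | succ k ih =>
    calc |e (k + 1)| - ε ≤ q * (|e k| - ε) := by linarith [he k]
      _ ≤ q * (q ^ k * (|e 0| - ε)) := mul_le_mul_of_nonneg_left ih h0
      _ = q ^ (k + 1) * (|e 0| - ε) := by ring

theorem tendsto_zero_of_contracting {q : ℝ} (h0 : 0 ≤ q) (h1 : q < 1) {e η : ℕ → ℝ}
    (hη : Tendsto η atTop (𝓝 0)) (he : ∀ T, e (T + 1) = q * e T + η T) :
    Tendsto e atTop (𝓝 0) := by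
  refine Metric.tendsto_atTop.2 fun ε hε => ?_
  have hq : 0 < (1 - q) * (ε / 2) := mul_pos (by linarith) (by linarith)
  obtain ⟨N, hN⟩ := Metric.tendsto_atTop.1 hη _ hq
  have hstep : ∀ k, |e (N + (k + 1))| ≤ q * |e (N + k)| + (1 - q) * (ε / 2) := fun k => by
    have hηk : |η (N + k)| < (1 - q) * (ε / 2) := by simpa using hN (N + k) (by lia)
    calc |e (N + (k + 1))| ≤ |q * e (N + k)| + |η (N + k)| := by
          rw [← add_assoc, he]; exact abs_add_le _ _
      _ ≤ _ := by rw [abs_mul, abs_of_nonneg h0]; gcongr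
  have hpow : Tendsto (fun k => q ^ k * (|e N| - ε / 2)) atTop (𝓝 0) := by
    simpa using (tendsto_pow_atTop_nhds_zero_of_lt_one h0 h1).mul_const (|e N| - ε / 2)
  obtain ⟨K, hK⟩ := eventually_atTop.1 (hpow.eventually_lt_const (half_pos hε))
  refine ⟨N + K, fun T hT => ?_⟩
  obtain ⟨k, rfl⟩ : ∃ k, T = N + k := ⟨T - N, by lia⟩
  have hbound := abs_le_of_contracting (e := fun k => e (N + k)) h0 hstep k
  rw [add_zero] at hbound
  rw [Real.dist_eq, sub_zero]
  linarith [hK k (by lia)]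

theorem hasValueAt_of_lottery {s t : S} {q : ℝ} (h0 : 0 < q) (h1 : q ≤ 1)
    (hp : ∀ x : S → ℝ, M.expectation x s (π.1 s) = q * x t + (1 - q) * x s)
    (ht : M.HasValueAt π t) : M.HasValueAt π s := by
  obtain ⟨x, hx⟩ := ht
  refine ⟨x + M.reward π s / q, tendsto_sub_nhds_zero_iff.1 ?_⟩
  refine tendsto_zero_of_contracting (q := 1 - q)
    (η := fun T => q * (M.partialSum π (M.reward π) T t - x)) (by linarith) (by linarith) ?_ ?_
  · simpa using (hx.sub_const x).const_mul q
  · intro T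
    rw [partialSum_succ, hp]
    field_simp
    ring

theorem hasTotalValue_at_absorbing {s : S} (hr : M.r s (π.1 s) = 0)
    (hp : ∀ x : S → ℝ, M.expectation x s (π.1 s) = x s) :
    Tendsto (fun T => M.partialSum π (M.reward π) T s) atTop (𝓝 0) := by
  have hzero : ∀ T, M.partialSum π (M.reward π) T s = 0 := fun T => by
    induction T with
    | zero => exact partialSum_zero _ s
    | succ T ih => rw [partialSum_succ, hp, ih, reward, hr, add_zero]
  simp [hzero]

end Values

section AverageReward

theorem HasTotalValue.hasGain (h : M.HasTotalValue π v) : M.HasGain π (fun _ => 0) := fun s => by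
  simpa using (h s).div_atTop tendsto_natCast_atTop_atTop

theorem tendsto_cesaro {z : ℕ → ℝ} {l : ℝ} (h : Tendsto z atTop (𝓝 l)) :
    Tendsto (fun N : ℕ => (∑ T ∈ Finset.range N, z T) / N) atTop (𝓝 l) := by
  simpa [div_eq_inv_mul] using h.cesaro

theorem HasTotalValue.hasBias (h : M.HasTotalValue π v) :
    M.HasBias π (fun _ => 0) v := fun s => by
  simpa only [sub_zero] using tendsto_cesaro (h s)

theorem HasTotalValue.averageReward_iff (h : M.HasTotalValue π v)
    {val : S → ℝ ×ₗ ℝ} {appeal : S → Act → ℝ ×ₗ ℝ} :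
    M.averageReward π val appeal ↔ (∀ s, val s = toLex (0, v s)) ∧
      ∀ s a, appeal s a = toLex (0, M.totalAppeal v s a) := by
  constructor
  · rintro ⟨g, b, hg, hb, hval, happeal⟩
    obtain rfl : g = fun _ => 0 := funext fun s => tendsto_nhds_unique (hg s) (h.hasGain s)
    obtain rfl : b = v := funext fun s => tendsto_nhds_unique (hb s) (h.hasBias s)
    exact ⟨hval, fun s a => by simpa [totalAppeal, expectation] using happeal s a⟩
  · rintro ⟨hval, happeal⟩
    exact ⟨fun _ => 0, v, h.hasGain, h.hasBias, hval, fun s a => by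
      simpa [totalAppeal, expectation] using happeal s a⟩

theorem HasTotalValue.totalReward (h : M.HasTotalValue π v) :
    M.totalReward π v (M.totalAppeal v) := ⟨h, fun _ _ => rfl⟩

theorem HasTotalValue.averageReward (h : M.HasTotalValue π v) :
    M.averageReward π (fun s => toLex (0, v s)) (fun s a => toLex (0, M.totalAppeal v s a)) :=
  h.averageReward_iff.2 ⟨fun _ => rfl, fun _ _ => rfl⟩

theorem HasTotalValue.greedyStep_totalReward_iff (h : M.HasTotalValue π v) {π' : M.Policy} :
    M.GreedyStep M.totalReward π π' ↔ ∀ s,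
      (M.Switchable v (M.totalAppeal v) s →
        ∀ a ∈ M.avail s, M.totalAppeal v s a ≤ M.totalAppeal v s (π'.1 s)) ∧
      (¬ M.Switchable v (M.totalAppeal v) s → π'.1 s = π.1 s) := by
  refine ⟨?_, fun hs => ⟨v, _, h.totalReward, hs⟩⟩
  rintro ⟨val, appeal, ⟨hval, happeal⟩, hs⟩
  obtain rfl := h.unique hval
  obtain rfl : appeal = M.totalAppeal v := funext fun s => funext (happeal s)
  exact hs

/-- `π'` is obtained from the policy `π` with values `v` by an iteration of Greedy PI under the
total reward criterion, with the iteration described by what it does at a state where no action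
improves and at a state where one action beats all others. -/
structure GreedyImproves (M : MDP S Act) (v : S → ℝ) (π π' : M.Policy) : Prop where
  hasTotalValue : M.HasTotalValue π v
  keep : ∀ s, (∀ a ∈ M.avail s, M.totalAppeal v s a ≤ v s) → π'.1 s = π.1 s
  choose : ∀ s, ∀ a ∈ M.avail s,
    (∀ b ∈ M.avail s, b ≠ a → M.totalAppeal v s b < M.totalAppeal v s a) → π'.1 s = a

theorem HasTotalValue.greedyImproves (h : M.HasTotalValue π v) {π' : M.Policy}
    (hstep : M.GreedyStep M.totalReward π π') : M.GreedyImproves v π π' where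
  hasTotalValue := h
  keep s hs := (h.greedyStep_totalReward_iff.1 hstep s).2 (not_switchable_iff.2 hs)
  choose s a ha hmax := by
    obtain ⟨hswitch, hkeep⟩ := h.greedyStep_totalReward_iff.1 hstep s
    by_contra hne
    by_cases hs : M.Switchable v (M.totalAppeal v) s
    · exact (hswitch hs a ha).not_gt (hmax _ (π'.2 s) hne)
    · refine hs ⟨a, ha, ?_⟩
      rw [h.bellman s]
      exact hmax _ (π.2 s) (hkeep hs ▸ hne)

theorem GreedyImproves.choose_of_forall_eq_or {π' : M.Policy} (h : M.GreedyImproves v π π')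
    {s : S} {a b : Act} (ha : a ∈ M.avail s) (hs : ∀ c ∈ M.avail s, c = a ∨ c = b)
    (hlt : M.totalAppeal v s b < M.totalAppeal v s a) : π'.1 s = a :=
  h.choose s a ha fun c hc hne => (hs c hc).resolve_left hne ▸ hlt

theorem HasTotalValue.greedyStep_averageReward_iff (h : M.HasTotalValue π v) {π' : M.Policy} :
    M.GreedyStep M.averageReward π π' ↔ M.GreedyStep M.totalReward π π' := by
  rw [h.greedyStep_totalReward_iff]
  constructor
  · rintro ⟨val, appeal, hcrit, hs⟩ s
    obtain ⟨hval, happeal⟩ := h.averageReward_iff.1 hcrit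
    simpa [switchable_toLex_iff hval happeal, happeal, Prod.Lex.toLex_le_toLex] using hs s
  · refine fun hs => ⟨_, _, h.averageReward, fun s => ?_⟩
    simpa [switchable_toLex_iff (fun _ => rfl) (fun _ _ => rfl), Prod.Lex.toLex_le_toLex]
      using hs s

theorem HasGain.harmonic (h : M.HasGain π g) (s : S) : g s = M.expectation g s (π.1 s) := by
  have hratio := tendsto_natCast_div_add_atTop (1 : ℝ)
  have hlim : Tendsto (fun T : ℕ => M.reward π s / ((T + 1 : ℕ) : ℝ) +
      M.expectation (fun s' => M.partialSum π (M.reward π) T s' / T) s (π.1 s) * (T / (T + 1)))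
      atTop (𝓝 (0 + M.expectation g s (π.1 s) * 1)) :=
    ((tendsto_const_nhds.div_atTop tendsto_natCast_atTop_atTop).comp
      (tendsto_add_atTop_nat 1)).add ((tendsto_expectation h).mul hratio)
  rw [zero_add, mul_one] at hlim
  refine tendsto_nhds_unique ((h s).comp (tendsto_add_atTop_nat 1)) (hlim.congr fun T => ?_)
  have hscale : ∀ s', M.partialSum π (M.reward π) T s' / T * (T / (T + 1)) =
      M.partialSum π (M.reward π) T s' / (T + 1) := fun s' => by
    rcases T.eq_zero_or_pos with rfl | hT
    · simp [partialSum_zero]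
    · have : (T : ℝ) ≠ 0 := by exact_mod_cast hT.ne'
      field_simp
  simp only [Function.comp_apply, partialSum_succ, expectation, Finset.sum_mul, mul_assoc, hscale,
    add_div, Finset.sum_div, mul_div_assoc, Nat.cast_add, Nat.cast_one]

theorem HasGain.mulVec_pow (h : M.HasGain π g) (t : ℕ) :
    (M.transition π ^ t).mulVec g = g := by
  induction t with
  | zero => simp
  | succ t ih => funext s; rw [mulVec_pow_succ, ih, ← h.harmonic s]

theorem HasGain.partialSum_sub (h : M.HasGain π g) {s : S} (hs : g s = 0) (T : ℕ) :
    M.partialSum π (fun s' => M.reward π s' - g s') T s = M.partialSum π (M.reward π) T s := by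
  refine Finset.sum_congr rfl fun t _ => ?_
  change ((M.transition π ^ t).mulVec (M.reward π - g)) s = _
  rw [Matrix.mulVec_sub, Pi.sub_apply, h.mulVec_pow, hs, sub_zero]

end AverageReward

section Optimality

theorem appealDetermined_totalReward : AppealDetermined M.totalReward := by
  rintro π π' val appeal appeal' ⟨-, h⟩ ⟨-, h'⟩
  funext s a
  rw [h, h']

theorem appealDetermined_averageReward : AppealDetermined M.averageReward := by
  rintro π π' val appeal appeal' ⟨g, b, -, -, hval, h⟩ ⟨g', b', -, -, hval', h'⟩
  have hpair : ∀ s, (g s, b s) = (g' s, b' s) := fun s =>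
    toLex.injective ((hval s).symm.trans (hval' s))
  obtain rfl : g = g' := funext fun s => congrArg Prod.fst (hpair s)
  obtain rfl : b = b' := funext fun s => congrArg Prod.snd (hpair s)
  funext s a
  rw [h, h']

/-- `v` is superharmonic for the Bellman operator: no action is more appealing than staying
with `v`. -/
def BellmanSuperharmonic (M : MDP S Act) (v : S → ℝ) : Prop :=
  ∀ s, ∀ a ∈ M.avail s, M.totalAppeal v s a ≤ v s

/-- A nonnegative potential `u` that, along every action, drops in expectation by at least the
negative part of `v` at the current state. It bounds the total expected negative part of `v` met
under an arbitrary policy. -/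
structure Compensates (M : MDP S Act) (u v : S → ℝ) : Prop where
  nonneg : ∀ s, 0 ≤ u s
  expectation_le : ∀ s, ∀ a ∈ M.avail s, M.expectation u s a ≤ u s + min (v s) 0

theorem BellmanSuperharmonic.partialSum_add_le (hv : M.BellmanSuperharmonic v) (π : M.Policy)
    (T : ℕ) (s : S) :
    M.partialSum π (M.reward π) T s + ((M.transition π ^ T).mulVec v) s ≤ v s := by
  induction T generalizing s with
  | zero => simp [partialSum]
  | succ T ih =>
    rw [partialSum_succ, mulVec_pow_succ, add_assoc, ← expectation_add]
    exact (add_le_add_right (expectation_le (π.2 s) ih) _).trans (hv s _ (π.2 s))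

theorem Compensates.neg_le_partialSum (hu : M.Compensates u v) (π : M.Policy) (N : ℕ) (s : S) :
    -u s ≤ M.partialSum π v N s := by
  induction N generalizing s with
  | zero => simpa [partialSum] using hu.nonneg s
  | succ N ih =>
    rw [partialSum_succ]
    have hnext := MDP.expectation_le (π.2 s) ih
    rw [expectation_neg] at hnext
    linarith [hu.expectation_le s _ (π.2 s), min_le_left (v s) 0]

theorem Compensates.neg_le_mulVec_pow (hu : M.Compensates u v) (π : M.Policy) (T : ℕ) (s : S) :
    -u s ≤ ((M.transition π ^ T).mulVec v) s := by
  induction T generalizing s with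
  | zero =>
    rw [pow_zero, Matrix.one_mulVec]
    linarith [hu.expectation_le s _ (π.2 s), min_le_left (v s) 0,
      expectation_nonneg (π.2 s) hu.nonneg]
  | succ T ih =>
    rw [mulVec_pow_succ]
    have hnext := MDP.expectation_le (π.2 s) ih
    rw [expectation_neg] at hnext
    linarith [hu.expectation_le s _ (π.2 s), min_le_right (v s) 0]

theorem BellmanSuperharmonic.sum_partialSum_le (hv : M.BellmanSuperharmonic v)
    (hu : M.Compensates u v) (π : M.Policy) (N : ℕ) (s : S) :
    ∑ T ∈ Finset.range N, M.partialSum π (M.reward π) T s ≤ N * v s + u s := by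
  have hsum := Finset.sum_le_sum fun T (_ : T ∈ Finset.range N) => hv.partialSum_add_le π T s
  rw [Finset.sum_add_distrib, Finset.sum_const, Finset.card_range, nsmul_eq_mul] at hsum
  have hneg : -u s ≤ ∑ T ∈ Finset.range N, ((M.transition π ^ T).mulVec v) s :=
    hu.neg_le_partialSum π N s
  linarith

theorem BellmanSuperharmonic.cesaro_le (hv : M.BellmanSuperharmonic v) (hu : M.Compensates u v)
    {s : S} {x : ℝ}
    (h : Tendsto (fun N : ℕ => (∑ T ∈ Finset.range N, M.partialSum π (M.reward π) T s) / N)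
      atTop (𝓝 x)) : x ≤ v s := by
  have hbound : Tendsto (fun N : ℕ => v s + u s / N) atTop (𝓝 (v s)) := by
    simpa using tendsto_const_nhds.add
      (tendsto_const_nhds (x := u s).div_atTop tendsto_natCast_atTop_atTop)
  refine le_of_tendsto_of_tendsto h hbound ?_
  filter_upwards [eventually_gt_atTop 0] with N hN
  have hN' : (0 : ℝ) < N := by exact_mod_cast hN
  rw [div_le_iff₀ hN', add_mul, div_mul_cancel₀ _ hN'.ne', mul_comm]
  exact hv.sum_partialSum_le hu π N s

theorem HasGain.nonpos (h : M.HasGain π g) (hv : M.BellmanSuperharmonic v)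
    (hu : M.Compensates u v) (s : S) : g s ≤ 0 := by
  have hbound : Tendsto (fun N : ℕ => (v s + u s) / (N : ℝ)) atTop (𝓝 0) :=
    tendsto_const_nhds.div_atTop tendsto_natCast_atTop_atTop
  refine le_of_tendsto_of_tendsto' (h s) hbound fun T => ?_
  refine div_le_div_of_nonneg_right ?_ (Nat.cast_nonneg _)
  linarith [hv.partialSum_add_le π T s, hu.neg_le_mulVec_pow π T s]

theorem HasTotalValue.isTerminalOptimal_totalReward (h : M.HasTotalValue π v)
    (hv : M.BellmanSuperharmonic v) (hu : M.Compensates u v) :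
    M.IsTerminalOptimal M.totalReward π := by
  refine ⟨v, _, h.totalReward, fun s => not_switchable_iff.2 (hv s), ?_⟩
  rintro π' v' - ⟨h', -⟩ s
  exact hv.cesaro_le hu (tendsto_cesaro (h' s))

theorem HasTotalValue.isTerminalOptimal_averageReward (h : M.HasTotalValue π v)
    (hv : M.BellmanSuperharmonic v) (hu : M.Compensates u v) :
    M.IsTerminalOptimal M.averageReward π := by
  refine ⟨_, _, h.averageReward, fun s => ?_, ?_⟩
  · rw [switchable_toLex_iff (fun _ => rfl) (fun _ _ => rfl)]
    exact not_switchable_iff.2 (hv s)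
  rintro π' val' - ⟨g, b, hg, hb, hval, -⟩ s
  rw [hval, Prod.Lex.toLex_le_toLex]
  rcases (hg.nonpos hv hu s).lt_or_eq with hlt | heq
  · exact Or.inl hlt
  · have hbias := hb s
    simp only [hg.partialSum_sub heq] at hbias
    exact Or.inr ⟨heq, hv.cesaro_le hu hbias⟩

end Optimality

end MDP

/-! ### Bellman equations and the ladder -/

namespace FullConstruction

theorem succ_eq_last_of_eq_one {n : ℕ} (hn : n = 1) (i : Fin n) : i.succ = Fin.last n := by
  ext
  rw [Fin.val_succ, Fin.val_last]
  lia

variable {n : ℕ} [NeZero n]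

/-- The states `d_1, …, d_n, d_{n+1}`. -/
def dAt (k : Fin (n + 1)) : State n :=
  if h : k.val < n then .d ⟨k.val, h⟩ else .dTop

theorem dNext_eq (i : Fin n) : dNext i = dAt i.succ := by
  simp [dNext, dAt]

@[simp] theorem dAt_castSucc (i : Fin n) : dAt i.castSucc = .d i := by
  simp [dAt]

@[simp] theorem dAt_last : dAt (Fin.last n) = (.dTop : State n) := by
  simp [dAt]

theorem sum_goto (x : State n) (v : State n → ℝ) : ∑ s', goto x s' * v s' = v x := by
  simp [goto]

theorem sum_lottery (q : ℝ) (x y : State n) (v : State n → ℝ) :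
    ∑ s', lottery q x y s' * v s' = q * v x + (1 - q) * v y := by
  simp only [lottery, add_mul, Finset.sum_add_distrib, mul_assoc, ← Finset.mul_sum, sum_goto]

section Appeals

variable (P : Params n) (v : State n → ℝ)

theorem totalAppeal_eq (s : State n) (a : Action n) :
    (mdp P).totalAppeal v s a = rew P s a + ∑ s', trans P s a s' * v s' := rfl

theorem totalAppeal_w_toBit (k : Fin (n + 1)) (l : Fin n) :
    (mdp P).totalAppeal v (.w k) (.toBit l) = v (entry l) := by
  simp [totalAppeal_eq, trans, rew, sum_goto]

theorem totalAppeal_w_toSink (k : Fin (n + 1)) :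
    (mdp P).totalAppeal v (.w k) .toSink = v .sink := by
  simp [totalAppeal_eq, trans, rew, sum_goto]

theorem totalAppeal_b_zero (i : Fin n) :
    (mdp P).totalAppeal v (.b i) .zero = v (.w i.succ) := by
  simp [totalAppeal_eq, trans, rew, sum_goto]

theorem totalAppeal_b_first_one :
    (mdp P).totalAppeal v (.b 0) .one = P.r 0 + v (dAt (Fin.succ 0)) := by
  simp [totalAppeal_eq, trans, rew, sum_goto, dNext_eq]

theorem totalAppeal_b_one (i : Fin n) (h : i ≠ 0) :
    (mdp P).totalAppeal v (.b i) .one =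
      P.α i * v (.bPlus ⟨i, h⟩) + (1 - P.α i) * v (.b i) := by
  simp [totalAppeal_eq, trans, rew, sum_lottery, h]

theorem totalAppeal_b_delay_zero (i : Fin n) :
    (mdp P).totalAppeal v (.b i) (.delay 0) = v (.w 0) := by
  simp [totalAppeal_eq, trans, rew, sum_goto]

theorem totalAppeal_b_delay (i : Fin n) {j : ℕ} (hj : 1 ≤ j) :
    (mdp P).totalAppeal v (.b i) (.delay j) =
      v (.b i) + P.p i j * (P.δ i j + v (.b 0) - v (.b i)) := by
  obtain ⟨j, rfl⟩ := Nat.exists_eq_add_of_le' hj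
  simp only [totalAppeal_eq, trans, rew, sum_lottery]
  ring

theorem totalAppeal_bMinus (i : {i : Fin n // i ≠ 0}) :
    (mdp P).totalAppeal v (.bMinus i) .only = -P.c i + v (.b i) := by
  simp [totalAppeal_eq, trans, rew, sum_goto]

theorem totalAppeal_bPlus (i : {i : Fin n // i ≠ 0}) :
    (mdp P).totalAppeal v (.bPlus i) .only = P.r i + v (dAt i.1.succ) := by
  simp [totalAppeal_eq, trans, rew, sum_goto, dNext_eq]

theorem totalAppeal_c_zero (i : Fin n) :
    (mdp P).totalAppeal v (.c i) .zero = v (.w i.succ) := by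
  simp [totalAppeal_eq, trans, rew, sum_goto]

theorem totalAppeal_c_one (i : Fin n) :
    (mdp P).totalAppeal v (.c i) .one = -P.εc i.castSucc + v (entry i) := by
  simp [totalAppeal_eq, trans, rew, sum_goto]

theorem totalAppeal_d_zero (i : Fin n) :
    (mdp P).totalAppeal v (.d i) .zero = v (.w i.succ) := by
  simp [totalAppeal_eq, trans, rew, sum_goto]

theorem totalAppeal_d_one (i : Fin n) :
    (mdp P).totalAppeal v (.d i) .one = -P.εd i.castSucc + v (.c i) := by
  simp [totalAppeal_eq, trans, rew, sum_goto]

theorem totalAppeal_cTop :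
    (mdp P).totalAppeal v .cTop .only = -P.εc (Fin.last n) + v .dTop := by
  simp [totalAppeal_eq, trans, rew, sum_goto]

theorem totalAppeal_dTop :
    (mdp P).totalAppeal v .dTop .only = -P.εd (Fin.last n) + v .sink := by
  simp [totalAppeal_eq, trans, rew, sum_goto]

end Appeals

/-- `v` solves the Bellman equations of the policy `π` and vanishes at the sink, as the values
of `π` under the total reward criterion do. -/
structure Evaluates (P : Params n) (π : (mdp P).Policy) (v : State n → ℝ) : Prop where
  sink : v .sink = 0
  bellman : ∀ s, v s = (mdp P).totalAppeal v s (π.1 s)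

variable {P : Params n} {π : (mdp P).Policy} {v : State n → ℝ}

theorem evaluates_of_hasTotalValue (h : (mdp P).HasTotalValue π v) : Evaluates P π v :=
  ⟨tendsto_nhds_unique (h .sink) (MDP.hasTotalValue_at_absorbing rfl fun x => sum_goto _ x),
    h.bellman⟩

theorem eq_only {s : State n} (h : avail s = {.only}) : π.1 s = .only :=
  Finset.mem_singleton.1 (h ▸ π.2 s)

namespace Evaluates

theorem dTop (h : Evaluates P π v) : v .dTop = -P.εd (Fin.last n) := by
  rw [h.bellman, eq_only rfl, totalAppeal_dTop, h.sink, add_zero]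

theorem cTop (h : Evaluates P π v) : v .cTop = -P.εc (Fin.last n) - P.εd (Fin.last n) := by
  rw [h.bellman, eq_only rfl, totalAppeal_cTop, h.dTop, sub_eq_add_neg]

theorem entry (h : Evaluates P π v) (i : Fin n) : v (entry i) = -P.c i + v (.b i) := by
  unfold FullConstruction.entry
  split_ifs with h0
  · rw [h0, P.c_first, neg_zero, zero_add]
  · rw [h.bellman, eq_only rfl, totalAppeal_bMinus]

theorem bPlus (h : Evaluates P π v) (i : {i : Fin n // i ≠ 0}) :
    v (.bPlus i) = P.r i + v (dAt i.1.succ) := by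
  rw [h.bellman, eq_only rfl, totalAppeal_bPlus]

theorem b_one (h : Evaluates P π v) {i : Fin n} (hi : π.1 (.b i) = .one) :
    v (.b i) = P.r i + v (dAt i.succ) := by
  by_cases h0 : i = 0
  · subst h0
    rw [h.bellman, hi, totalAppeal_b_first_one]
  · have hb := h.bellman (.b i)
    rw [hi, totalAppeal_b_one P v i h0, h.bPlus] at hb
    exact mul_left_cancel₀ (P.α_pos i).ne' (by linarith)

theorem b_zero (h : Evaluates P π v) {i : Fin n} (hi : π.1 (.b i) = .zero) :
    v (.b i) = v (.w i.succ) := by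
  rw [h.bellman, hi, totalAppeal_b_zero]

theorem b_delay_zero (h : Evaluates P π v) {i : Fin n} (hi : π.1 (.b i) = .delay 0) :
    v (.b i) = v (.w 0) := by
  rw [h.bellman, hi, totalAppeal_b_delay_zero]

theorem b_delay (h : Evaluates P π v) {i : Fin n} {j : ℕ} (hj : 1 ≤ j)
    (hi : π.1 (.b i) = .delay j) : v (.b i) = v (.b 0) + P.δ i j := by
  have hb := h.bellman (.b i)
  rw [hi, totalAppeal_b_delay P v i hj] at hb
  have hzero : P.δ i j + v (.b 0) - v (.b i) = 0 :=
    (mul_eq_zero.1 (by linarith : P.p i j * _ = 0)).resolve_left (P.p_pos i j).ne'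
  linarith

theorem entry_one (h : Evaluates P π v) {i : Fin n} (hi : π.1 (.b i) = .one) :
    v (FullConstruction.entry i) = P.r i - P.c i + v (dAt i.succ) := by
  rw [h.entry, h.b_one hi]
  ring

end Evaluates

namespace Params

section CostBounds

variable (P : Params n)

theorem εc_le (i : Fin (n + 1)) : P.εc i ≤ P.εmax :=
  (le_max_left _ _).trans (Finset.le_sup' (fun i => max (P.εc i) (P.εd i)) (Finset.mem_univ i))

theorem εd_le (i : Fin (n + 1)) : P.εd i ≤ P.εmax :=
  (le_max_right _ _).trans (Finset.le_sup' (fun i => max (P.εc i) (P.εd i)) (Finset.mem_univ i))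

theorem εmax_pos : 0 < P.εmax := (P.εc_pos 0).trans_le (P.εc_le 0)

theorem εmax_le_mul : P.εmax ≤ n * P.εmax :=
  le_mul_of_one_le_left P.εmax_pos.le
    (by exact_mod_cast Nat.one_le_iff_ne_zero.2 (NeZero.ne n))

theorem four_mul_εmax_le (hn : n ≠ 1) : 4 * P.εmax ≤ 2 * n * P.εmax := by
  have htwo : (2 : ℝ) ≤ n := by
    have := NeZero.ne n
    exact_mod_cast (show 2 ≤ n by lia)
  linarith [mul_le_mul_of_nonneg_right htwo P.εmax_pos.le]

theorem bddAbove_δ :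
    BddAbove {x : ℝ | ∃ i : Fin n, i ≠ 0 ∧ ∃ j : ℕ, 1 ≤ j ∧ j ≤ f i ∧ x = P.δ i j} := by
  refine ((Finset.univ.biUnion fun i : Fin n =>
    (Finset.range (f i + 1)).image (P.δ i)).finite_toSet.subset ?_).bddAbove
  rintro x ⟨i, -, j, -, hj, rfl⟩
  simp only [Finset.coe_biUnion, Set.mem_iUnion, Finset.mem_coe, Finset.mem_image,
    Finset.mem_range, Finset.mem_univ]
  exact ⟨i, trivial, j, by lia, rfl⟩

theorem δ_le {i : Fin n} (hi : i ≠ 0) {j : ℕ} (h1 : 1 ≤ j) (hj : j ≤ f i) : P.δ i j ≤ P.δmax :=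
  le_csSup P.bddAbove_δ ⟨i, hi, j, h1, hj, rfl⟩

/-- The total reward of the bits below level `k`. -/
def rewardBelow (k : Fin (n + 1)) : ℝ := ∑ i : Fin n with i.castSucc < k, P.r i

theorem rewardBelow_castSucc (i : Fin n) :
    P.rewardBelow i.castSucc = ∑ j ∈ Finset.Iio i, P.r j := by
  refine Finset.sum_congr ?_ fun _ _ => rfl
  ext j
  simp

theorem rewardBelow_succ (i : Fin n) :
    P.rewardBelow i.succ = P.rewardBelow i.castSucc + P.r i := by
  have hIic : (Finset.univ.filter fun j : Fin n => j.castSucc < i.succ) =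
      insert i (Finset.Iio i) := by
    ext j
    simp [le_iff_eq_or_lt]
  rw [rewardBelow_castSucc, rewardBelow, hIic, Finset.sum_insert (by simp), add_comm]

/-- The reward and cost gaps, together with the nonnegativity of `δ_max`, which the order of the
delaying actions entails. -/
structure Gaps : Prop where
  rewardGap : P.RewardGap
  costGap : P.CostGap
  δmax_nonneg : 0 ≤ P.δmax

/-- The degenerate case of a single bit whose reward does not make up for the three small costs on
the way `d_1, c_1, b_1, d_2, sink`: then `d_1` never switches to action `1`. -/
def Stuck : Prop :=
  n = 1 ∧ P.r 0 ≤ P.εc (Fin.castSucc 0) + P.εd (Fin.castSucc 0) + P.εd (Fin.last n)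

end CostBounds

theorem not_stuck_of_ne {i i' : Fin n} (h : i ≠ i') : ¬ P.Stuck := by
  rintro ⟨hn, -⟩
  exact h (Fin.ext (by lia))

namespace Gaps

theorem c_nonneg_and_r_pos (h : P.Gaps) (i : Fin n) : 0 ≤ P.c i ∧ 0 < P.r i := by
  induction i using WellFoundedLT.induction with
  | ind i ih =>
    have hsum : 0 ≤ ∑ j ∈ Finset.Iio i, P.r j :=
      Finset.sum_nonneg fun j hj => (ih j (Finset.mem_Iio.1 hj)).2.le
    have hc : 0 ≤ P.c i := by
      by_cases h0 : i = 0
      · rw [h0, P.c_first]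
      · linarith [h.costGap i h0, P.εmax_le_mul, P.εmax_pos, h.δmax_nonneg]
    exact ⟨hc, by linarith [h.rewardGap i, P.εmax_le_mul, P.εmax_pos, h.δmax_nonneg]⟩

theorem c_nonneg (h : P.Gaps) (i : Fin n) : 0 ≤ P.c i := (h.c_nonneg_and_r_pos i).1

theorem r_pos (h : P.Gaps) (i : Fin n) : 0 < P.r i := (h.c_nonneg_and_r_pos i).2

theorem rewardBelow_nonneg (h : P.Gaps) (k : Fin (n + 1)) : 0 ≤ P.rewardBelow k :=
  Finset.sum_nonneg fun i _ => (h.r_pos i).le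

theorem lt_c (h : P.Gaps) {i : Fin n} (hi : i ≠ 0) :
    P.rewardBelow i.castSucc + P.δmax < P.c i := by
  rw [rewardBelow_castSucc]
  linarith [h.costGap i hi, P.εmax_le_mul, P.εmax_pos]

theorem lt_sub (h : P.Gaps) (i : Fin n) :
    P.rewardBelow i.castSucc + P.δmax + 2 * n * P.εmax < P.r i - P.c i := by
  rw [rewardBelow_castSucc]
  linarith [h.rewardGap i]

end Gaps

end Params

/-- The equations for the values `w k` of `w_k` and `d k` of `d_k`, at the levels from `lo` on,
when `B` is the set of bits that are set. Reading `w` and `d` off a policy, `lo = 0` is the weak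
invariant; a carry disturbs the equations below the bit that it sets. -/
structure Ladder (P : Params n) (B : Finset (Fin n)) (lo : Fin (n + 1))
    (w d : Fin (n + 1) → ℝ) : Prop where
  w_last : w (Fin.last n) = 0
  d_last : d (Fin.last n) = -P.εd (Fin.last n)
  w_mem : ∀ i ∈ B, lo ≤ i.castSucc → w i.castSucc = P.r i - P.c i + d i.succ
  d_mem : ∀ i ∈ B, lo ≤ i.castSucc →
    d i.castSucc = w i.castSucc - P.εc i.castSucc - P.εd i.castSucc
  w_notMem : ∀ i ∉ B, lo ≤ i.castSucc → w i.castSucc = w i.succ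
  d_notMem : ∀ i ∉ B, lo ≤ i.castSucc → d i.castSucc = w i.succ

namespace Ladder

variable {B : Finset (Fin n)} {lo : Fin (n + 1)} {w d : Fin (n + 1) → ℝ} {i : Fin n}

theorem d_le_w (h : Ladder P B lo w d) {k : Fin (n + 1)} (hk : lo ≤ k) : d k ≤ w k := by
  cases k using Fin.lastCases with
  | last => rw [h.w_last, h.d_last]; linarith [P.εd_pos (Fin.last n)]
  | cast i =>
    by_cases hi : i ∈ B
    · rw [h.d_mem i hi hk]
      linarith [P.εd_pos i.castSucc, P.εc_pos i.castSucc]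
    · rw [h.d_notMem i hi hk, h.w_notMem i hi hk]

theorem w_le_d_last (h : Ladder P B lo w d) :
    w (Fin.last n) ≤ d (Fin.last n) + P.εmax := by
  rw [h.w_last, h.d_last]; linarith [P.εd_le (Fin.last n)]

theorem w_le_d (h : Ladder P B lo w d) {k : Fin (n + 1)} (hk : lo ≤ k) :
    w k ≤ d k + 2 * P.εmax := by
  cases k using Fin.lastCases with
  | last => linarith [h.w_le_d_last, P.εmax_pos]
  | cast i =>
    by_cases hi : i ∈ B
    · rw [h.d_mem i hi hk]
      linarith [P.εd_le i.castSucc, P.εc_le i.castSucc]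
    · rw [h.d_notMem i hi hk, h.w_notMem i hi hk]
      linarith [P.εmax_pos]

theorem w_succ_lt_enter (h : Ladder P B lo w d) (hg : P.Gaps) (hi : lo ≤ i.succ) :
    P.rewardBelow i.castSucc + P.δmax + P.εmax + w i.succ < P.r i - P.c i + d i.succ := by
  by_cases hn : n = 1
  · have hlast := h.w_le_d_last
    rw [← succ_eq_last_of_eq_one hn i] at hlast
    linarith [hg.lt_sub i, P.εmax_le_mul]
  · linarith [hg.lt_sub i, P.four_mul_εmax_le hn, h.w_le_d hi, P.εmax_pos]

theorem w_succ_lt_enter_from_d (h : Ladder P B lo w d) (hg : P.Gaps) (hs : ¬ P.Stuck)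
    (hi : lo ≤ i.succ) :
    w i.succ < P.r i - P.c i + d i.succ - P.εc i.castSucc - P.εd i.castSucc := by
  by_cases hn : n = 1
  · obtain rfl : i = 0 := Fin.ext (by simp; lia)
    simp only [Params.Stuck, hn, true_and, not_le] at hs
    rw [succ_eq_last_of_eq_one hn 0, h.w_last, h.d_last, P.c_first]
    linarith
  · linarith [hg.lt_sub i, P.four_mul_εmax_le hn, h.w_le_d hi, P.εd_le i.castSucc,
      P.εc_le i.castSucc, hg.rewardBelow_nonneg i.castSucc, hg.δmax_nonneg]

theorem w_succ_lt (h : Ladder P B lo w d) (hg : P.Gaps) (hB : i ∈ B)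
    (hi : lo ≤ i.castSucc) : P.εmax + w i.succ < w i.castSucc := by
  rw [h.w_mem i hB hi]
  linarith [h.w_succ_lt_enter hg (hi.trans i.castSucc_lt_succ.le),
    hg.rewardBelow_nonneg i.castSucc, hg.δmax_nonneg]

theorem w_succ_le (h : Ladder P B lo w d) (hg : P.Gaps) (hi : lo ≤ i.castSucc) :
    w i.succ ≤ w i.castSucc := by
  by_cases hB : i ∈ B
  · linarith [h.w_succ_lt hg hB hi, P.εmax_pos]
  · exact (h.w_notMem i hB hi).ge

theorem w_castSucc_le (h : Ladder P B lo w d) (hg : P.Gaps) (hi : lo ≤ i.castSucc) :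
    w i.castSucc ≤ w i.succ + P.r i := by
  by_cases hB : i ∈ B
  · rw [h.w_mem i hB hi]
    linarith [h.d_le_w (hi.trans i.castSucc_lt_succ.le), hg.c_nonneg i]
  · rw [h.w_notMem i hB hi]
    linarith [hg.r_pos i]

theorem w_antitone (h : Ladder P B lo w d) (hg : P.Gaps) {j k : Fin (n + 1)} (hj : lo ≤ j)
    (hjk : j ≤ k) : w k ≤ w j := by
  induction k using Fin.induction with
  | zero => rw [le_antisymm hjk (Fin.zero_le _)]
  | succ i ih =>
    rcases hjk.eq_or_lt with rfl | hlt
    · rfl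
    · have hji : j ≤ i.castSucc := Fin.le_castSucc_iff.2 hlt
      exact (h.w_succ_le hg (hj.trans hji)).trans (ih hji)

theorem w_add_rewardBelow_mono (h : Ladder P B lo w d) (hg : P.Gaps) {j k : Fin (n + 1)}
    (hj : lo ≤ j) (hjk : j ≤ k) : w j + P.rewardBelow j ≤ w k + P.rewardBelow k := by
  induction k using Fin.induction with
  | zero => rw [le_antisymm hjk (Fin.zero_le _)]
  | succ i ih =>
    rcases hjk.eq_or_lt with rfl | hlt
    · rfl
    · have hji : j ≤ i.castSucc := Fin.le_castSucc_iff.2 hlt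
      rw [P.rewardBelow_succ]
      linarith [h.w_castSucc_le hg (hj.trans hji), ih hji]

theorem w_nonneg (h : Ladder P B lo w d) (hg : P.Gaps) {k : Fin (n + 1)} (hk : lo ≤ k) :
    0 ≤ w k :=
  h.w_last ▸ h.w_antitone hg hk (Fin.le_last k)

end Ladder

end FullConstruction

/-! ### Policies of the counter -/

namespace FullConstruction

section Target

variable {n : ℕ} {B B' : Finset (Fin n)}

/-- The action of `w_k` prescribed by the bits of `B`: it goes to the least bit of `B` from level
`k` on, or to the sink if there is none. -/
def target (B : Finset (Fin n)) (k : Fin (n + 1)) : Action n :=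
  if h : (B.filter (k ≤ ·.castSucc)).Nonempty then
    .toBit ((B.filter (k ≤ ·.castSucc)).min' h) else .toSink

theorem target_congr {k k' : Fin (n + 1)}
    (h : ∀ i : Fin n, i ∈ B ∧ k ≤ i.castSucc ↔ i ∈ B' ∧ k' ≤ i.castSucc) :
    target B k = target B' k' := by
  have hfilter : B.filter (k ≤ ·.castSucc) = B'.filter (k' ≤ ·.castSucc) := by
    ext i
    simpa only [Finset.mem_filter] using h i
  simp only [target, hfilter]

theorem target_eq_toBit_iff {k : Fin (n + 1)} {l : Fin n} :
    target B k = .toBit l ↔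
      l ∈ B ∧ k ≤ l.castSucc ∧ ∀ m ∈ B, k ≤ m.castSucc → l ≤ m := by
  unfold target
  split_ifs with hne
  · have hmem := Finset.mem_filter.1 (Finset.min'_mem _ hne)
    have hle : ∀ m ∈ B, k ≤ m.castSucc → (B.filter (k ≤ ·.castSucc)).min' hne ≤ m :=
      fun m hm hk => Finset.min'_le _ _ (Finset.mem_filter.2 ⟨hm, hk⟩)
    rw [Action.toBit.injEq]
    constructor
    · rintro rfl
      exact ⟨hmem.1, hmem.2, hle⟩
    · rintro ⟨hl, hk, hmin⟩
      exact le_antisymm (hle l hl hk) (hmin _ hmem.1 hmem.2)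
  · rw [false_iff]
    exact fun ⟨hl, hk, _⟩ => hne ⟨l, Finset.mem_filter.2 ⟨hl, hk⟩⟩

theorem target_eq_toSink_iff {k : Fin (n + 1)} :
    target B k = .toSink ↔ ∀ m ∈ B, ¬ k ≤ m.castSucc := by
  unfold target
  split_ifs with hne
  · simpa [Finset.Nonempty] using hne
  · simpa [Finset.Nonempty] using hne

theorem target_mem {i : Fin n} (hi : i ∈ B) : target B i.castSucc = .toBit i :=
  target_eq_toBit_iff.2 ⟨hi, le_rfl, fun _ _ h => by simpa using h⟩

theorem target_notMem {i : Fin n} (hi : i ∉ B) : target B i.castSucc = target B i.succ := by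
  refine target_congr fun m => and_congr_right fun hm => ?_
  have hne : i ≠ m := fun h => hi (h ▸ hm)
  simp [le_iff_eq_or_lt (a := i), hne, Fin.succ_le_castSucc_iff]

theorem target_eq_toSink_or_exists_toBit (B : Finset (Fin n)) (k : Fin (n + 1)) :
    target B k = .toSink ∨ ∃ l, target B k = .toBit l := by
  unfold target
  split_ifs <;> simp

end Target

variable {n : ℕ} [NeZero n] {P : Params n} {π : (mdp P).Policy} {v : State n → ℝ}

theorem avail_w {k : Fin (n + 1)} {a : Action n} :
    a ∈ avail (.w k) ↔ a = .toSink ∨ ∃ l, k ≤ l.castSucc ∧ a = .toBit l := by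
  simp [avail, eq_comm]

theorem avail_b_first {a : Action n} : a ∈ avail (State.b 0) ↔ a = .zero ∨ a = .one := by
  simp [avail]

theorem avail_b {i : Fin n} (hi : i ≠ 0) {a : Action n} :
    a ∈ avail (State.b i) ↔ a = .one ∨ ∃ j ≤ f i, a = .delay j := by
  simp only [avail, hi, if_false, Finset.mem_insert, Finset.mem_image, Finset.mem_range,
    Nat.lt_succ_iff, eq_comm]

theorem avail_c (i : Fin n) {a : Action n} : a ∈ avail (State.c i) ↔ a = .zero ∨ a = .one := by
  simp [avail]

theorem avail_d (i : Fin n) {a : Action n} : a ∈ avail (State.d i) ↔ a = .zero ∨ a = .one := by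
  simp [avail]

theorem target_mem_avail (B : Finset (Fin n)) (k : Fin (n + 1)) :
    target B k ∈ avail (State.w k) := by
  rcases target_eq_toSink_or_exists_toBit B k with h | ⟨l, h⟩
  · exact avail_w.2 (.inl h)
  · exact avail_w.2 (.inr ⟨l, (target_eq_toBit_iff.1 h).2.1, h⟩)

theorem mem_setBits {i : Fin n} : i ∈ setBits π ↔ π.1 (.b i) = .one := by
  simp [setBits]

theorem policy_w_last (π : (mdp P).Policy) : π.1 (.w (Fin.last n)) = .toSink := by
  rcases avail_w.1 (π.2 (.w (Fin.last n))) with h | ⟨l, hl, -⟩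
  · exact h
  · exact absurd hl (not_le.2 l.castSucc_lt_last)

theorem policy_b_first_eq_zero (h : π.1 (.b 0) ≠ .one) : π.1 (.b 0) = .zero :=
  (avail_b_first.1 (π.2 (.b 0))).resolve_right h

theorem WeakInvariant.policy_w (h : WeakInvariant π) (k : Fin (n + 1)) :
    π.1 (.w k) = target (setBits π) k := by
  obtain ⟨-, -, hbit, hsink⟩ := h
  cases k using Fin.lastCases with
  | last =>
    rw [policy_w_last, target_eq_toSink_iff.2 fun m _ => not_le.2 m.castSucc_lt_last]
  | cast i =>
    rcases target_eq_toSink_or_exists_toBit (setBits π) i.castSucc with ht | ⟨l, ht⟩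
    · rw [ht, hsink i fun m hm hle => target_eq_toSink_iff.1 ht m hm (by simpa using hle)]
    · obtain ⟨hl, hle, hmin⟩ := target_eq_toBit_iff.1 ht
      rw [ht, hbit i l hl (by simpa using hle) fun m hm him => hmin m hm (by simpa using him)]

namespace Evaluates

theorem ladder (h : Evaluates P π v) {B : Finset (Fin n)} {lo : Fin (n + 1)}
    (hw : ∀ k, lo ≤ k → π.1 (.w k) = target B k)
    (hb : ∀ i ∈ B, lo ≤ i.castSucc → π.1 (.b i) = .one ∧ π.1 (.c i) = .one)
    (hd : ∀ i, lo ≤ i.castSucc → π.1 (.d i) = if i ∈ B then .one else .zero) :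
    Ladder P B lo (fun k => v (.w k)) (fun k => v (dAt k)) where
  w_last := by rw [h.bellman, policy_w_last, totalAppeal_w_toSink, h.sink]
  d_last := by rw [dAt_last, h.dTop]
  w_mem i hi hlo := by
    rw [h.bellman, hw _ hlo, target_mem hi, totalAppeal_w_toBit, h.entry_one (hb i hi hlo).1]
  d_mem i hi hlo := by
    rw [dAt_castSucc, h.bellman (.d i), hd i hlo, if_pos hi, totalAppeal_d_one, h.bellman (.c i),
      (hb i hi hlo).2, totalAppeal_c_one, h.bellman (.w _), hw _ hlo, target_mem hi,
      totalAppeal_w_toBit]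
    ring
  w_notMem i hi hlo := by
    rw [h.bellman (.w _), h.bellman (.w i.succ), hw _ hlo,
      hw _ (hlo.trans i.castSucc_lt_succ.le), target_notMem hi]
    cases target B i.succ <;> rfl
  d_notMem i hi hlo := by
    rw [dAt_castSucc, h.bellman (.d i), hd i hlo, if_neg hi, totalAppeal_d_zero]

theorem ladder_of_weakInvariant (h : Evaluates P π v) (hπ : WeakInvariant π) :
    Ladder P (setBits π) 0 (fun k => v (.w k)) (fun k => v (dAt k)) := by
  refine h.ladder (fun k _ => hπ.policy_w k)
    (fun i hi _ => ⟨mem_setBits.1 hi, (hπ.1 i hi).1⟩) fun i _ => ?_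
  split_ifs with hi
  · exact (hπ.1 i hi).2
  · exact (hπ.2.1 i hi).2

theorem b_first_of_weakInvariant (h : Evaluates P π v) (hπ : WeakInvariant π) :
    v (.b 0) = v (.w 0) := by
  have hL := h.ladder_of_weakInvariant hπ
  by_cases hmem : (0 : Fin n) ∈ setBits π
  · have hw := hL.w_mem 0 hmem (Fin.zero_le _)
    rw [P.c_first, sub_zero] at hw
    rw [h.b_one (mem_setBits.1 hmem)]
    exact hw.symm
  · rw [h.b_zero (policy_b_first_eq_zero fun hone => hmem (mem_setBits.2 hone))]
    exact (hL.w_notMem 0 hmem (Fin.zero_le _)).symm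

end Evaluates

section ValuesExist

theorem hasValueAt_of_goto {s t : State n} (h : trans P s (π.1 s) = goto t)
    (ht : (mdp P).HasValueAt π t) : (mdp P).HasValueAt π s := by
  refine MDP.hasValueAt_of_lottery one_pos le_rfl (fun x => ?_) ht
  change ∑ s', trans P s (π.1 s) s' * x s' = _
  rw [h, sum_goto]
  ring

theorem hasValueAt_of_lottery {s t : State n} {q : ℝ} (h0 : 0 < q) (h1 : q ≤ 1)
    (h : trans P s (π.1 s) = lottery q t s) (ht : (mdp P).HasValueAt π t) :
    (mdp P).HasValueAt π s := by
  refine MDP.hasValueAt_of_lottery h0 h1 (fun x => ?_) ht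
  change ∑ s', trans P s (π.1 s) s' * x s' = _
  rw [h, sum_lottery]

theorem hasValueAt_sink (π : (mdp P).Policy) : (mdp P).HasValueAt π .sink :=
  ⟨0, MDP.hasTotalValue_at_absorbing rfl fun x => sum_goto _ x⟩

theorem hasValueAt_dTop (π : (mdp P).Policy) : (mdp P).HasValueAt π .dTop :=
  hasValueAt_of_goto (by rw [eq_only rfl]; rfl) (hasValueAt_sink π)

theorem hasValueAt_bPlus {i : {i : Fin n // i ≠ 0}}
    (h : (mdp P).HasValueAt π (dAt i.1.succ)) : (mdp P).HasValueAt π (.bPlus i) :=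
  hasValueAt_of_goto (by rw [eq_only rfl, ← dNext_eq]; rfl) h

theorem hasValueAt_b_one {i : Fin n} (hi : π.1 (.b i) = .one)
    (h : (mdp P).HasValueAt π (dAt i.succ)) : (mdp P).HasValueAt π (.b i) := by
  by_cases h0 : i = 0
  · subst h0
    refine hasValueAt_of_goto ?_ h
    rw [hi, ← dNext_eq]
    simp [trans]
  · refine hasValueAt_of_lottery (P.α_pos i) (P.α_le_one i) ?_
      (hasValueAt_bPlus (i := ⟨i, h0⟩) h)
    rw [hi]
    simp [trans, h0]

theorem hasValueAt_entry {i : Fin n} (h : (mdp P).HasValueAt π (.b i)) :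
    (mdp P).HasValueAt π (entry i) := by
  unfold entry
  split_ifs with h0
  · rwa [← h0]
  · exact hasValueAt_of_goto (by rw [eq_only rfl]; rfl) h

theorem hasValueAt_w {k : Fin (n + 1)}
    (h : ∀ l, k ≤ l.castSucc → π.1 (.w k) = .toBit l → (mdp P).HasValueAt π (.b l)) :
    (mdp P).HasValueAt π (.w k) := by
  rcases avail_w.1 (π.2 (.w k)) with hsink | ⟨l, hl, hbit⟩
  · exact hasValueAt_of_goto (by rw [hsink]; rfl) (hasValueAt_sink π)
  · exact hasValueAt_of_goto (by rw [hbit]; rfl) (hasValueAt_entry (h l hl hbit))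

theorem hasValueAt_c {i : Fin n} (hw : (mdp P).HasValueAt π (.w i.succ))
    (hb : π.1 (.c i) = .one → (mdp P).HasValueAt π (.b i)) : (mdp P).HasValueAt π (.c i) := by
  rcases (avail_c i).1 (π.2 _) with h | h
  · exact hasValueAt_of_goto (by rw [h]; rfl) hw
  · exact hasValueAt_of_goto (by rw [h]; rfl) (hasValueAt_entry (hb h))

theorem hasValueAt_d {i : Fin n} (hw : (mdp P).HasValueAt π (.w i.succ))
    (hc : (mdp P).HasValueAt π (.c i)) : (mdp P).HasValueAt π (.d i) := by
  rcases (avail_d i).1 (π.2 _) with h | h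
  · exact hasValueAt_of_goto (by rw [h]; rfl) hw
  · exact hasValueAt_of_goto (by rw [h]; rfl) hc

theorem hasValueAt_b {i : Fin n} (hone : π.1 (.b i) = .one → (mdp P).HasValueAt π (.b i))
    (hfirst : (mdp P).HasValueAt π (.b 0)) (hw : (mdp P).HasValueAt π (.w 0)) :
    (mdp P).HasValueAt π (.b i) := by
  by_cases h0 : i = 0
  · rwa [h0]
  rcases (avail_b h0).1 (π.2 (.b i)) with h | ⟨_ | j, -, h⟩
  · exact hone h
  · exact hasValueAt_of_goto (by rw [h]; rfl) hw
  · exact hasValueAt_of_lottery (P.p_pos i (j + 1)) (P.p_le_one i (j + 1)) (by rw [h]; rfl) hfirst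

variable (hw : ∀ k l, π.1 (.w k) = .toBit l → π.1 (.b l) = .one)
  (hc : ∀ i, π.1 (.c i) = .one → π.1 (.b i) = .one)
include hw hc

theorem hasValueAt_setBits_and_dAt (k : Fin (n + 1)) :
    (∀ i, k ≤ i.castSucc → π.1 (.b i) = .one → (mdp P).HasValueAt π (.b i)) ∧
      (mdp P).HasValueAt π (dAt k) := by
  induction k using Fin.reverseInduction with
  | last =>
    refine ⟨fun i hi => absurd hi (not_le.2 i.castSucc_lt_last), ?_⟩
    rw [dAt_last]
    exact hasValueAt_dTop π
  | cast i ih =>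
    obtain ⟨hset, hd⟩ := ih
    have hone : π.1 (.b i) = .one → (mdp P).HasValueAt π (.b i) := fun h => hasValueAt_b_one h hd
    have hsucc : (mdp P).HasValueAt π (.w i.succ) :=
      hasValueAt_w fun l hl hbit => hset l hl (hw _ l hbit)
    refine ⟨fun j hj h => ?_, ?_⟩
    · rcases (Fin.castSucc_le_castSucc_iff.1 hj).eq_or_lt with rfl | hlt
      · exact hone h
      · exact hset j (Fin.succ_le_castSucc_iff.2 hlt) h
    · rw [dAt_castSucc]
      exact hasValueAt_d hsucc (hasValueAt_c hsucc fun h => hone (hc i h))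

theorem exists_hasTotalValue : ∃ v, (mdp P).HasTotalValue π v := by
  have hset : ∀ i, π.1 (.b i) = .one → (mdp P).HasValueAt π (.b i) := fun i =>
    (hasValueAt_setBits_and_dAt hw hc 0).1 i (Fin.zero_le _)
  have hd k : (mdp P).HasValueAt π (dAt k) := (hasValueAt_setBits_and_dAt hw hc k).2
  have hw' k : (mdp P).HasValueAt π (.w k) := hasValueAt_w fun l _ hbit => hset l (hw k l hbit)
  have hfirst : (mdp P).HasValueAt π (.b 0) := by
    rcases avail_b_first.1 (π.2 (.b 0)) with h | h
    · exact hasValueAt_of_goto (by rw [h]; rfl) (hw' (Fin.succ 0))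
    · exact hset 0 h
  have hb i : (mdp P).HasValueAt π (.b i) := hasValueAt_b (hset i) hfirst (hw' 0)
  refine MDP.exists_hasTotalValue fun s => ?_
  cases s with
  | sink => exact hasValueAt_sink π
  | w k => exact hw' k
  | b i => exact hb i
  | bMinus i => exact hasValueAt_of_goto (by rw [eq_only rfl]; rfl) (hb i)
  | bPlus i => exact hasValueAt_bPlus (hd _)
  | c i => exact hasValueAt_c (hw' _) fun _ => hb i
  | d i => simpa using hd i.castSucc
  | cTop => exact hasValueAt_of_goto (by rw [eq_only rfl]; rfl) (hasValueAt_dTop π)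
  | dTop => exact hasValueAt_dTop π

end ValuesExist

/-- The action function in which `A` is the set of bits that are set, `w_k` goes to the least bit
of `W` from level `k` on, `C` and `D` are the sets of the `c_i` and `d_i` that choose `1`, and
every unset bit other than the first one chooses its delay action number `min j (f i)`. -/
def counterAction (A W C D : Finset (Fin n)) (j : ℕ) : State n → Action n
  | .w k => target W k
  | .b i => if i ∈ A then .one else if i = 0 then .zero else .delay (min j (f i))
  | .c i => if i ∈ C then .one else .zero
  | .d i => if i ∈ D then .one else .zero
  | _ => .only

theorem counterAction_mem (A W C D : Finset (Fin n)) (j : ℕ) (s : State n) :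
    counterAction A W C D j s ∈ avail s := by
  cases s with
  | w k => exact target_mem_avail _ _
  | b i | c i | d i => simp only [counterAction, avail]; split_ifs <;> simp
  | _ => simp [counterAction, avail]

/-- The policy with action function `counterAction`. All policies in a run of Greedy PI from the
all-zero policy have this form. -/
def counterPolicy (P : Params n) (A W C D : Finset (Fin n)) (j : ℕ) : (mdp P).Policy :=
  ⟨counterAction A W C D j, counterAction_mem A W C D j⟩

section CounterPolicy

variable {A W C D : Finset (Fin n)} {j : ℕ}

theorem counterPolicy_w (k : Fin (n + 1)) :
    (counterPolicy P A W C D j).1 (.w k) = target W k := rfl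

theorem counterPolicy_b_eq_one_iff {i : Fin n} :
    (counterPolicy P A W C D j).1 (.b i) = .one ↔ i ∈ A := by
  simp only [counterPolicy, counterAction]
  split_ifs <;> simp_all

theorem counterPolicy_b_mem {i : Fin n} (hi : i ∈ A) :
    (counterPolicy P A W C D j).1 (.b i) = .one :=
  counterPolicy_b_eq_one_iff.2 hi

theorem counterPolicy_b_first (h : (0 : Fin n) ∉ A) :
    (counterPolicy P A W C D j).1 (.b 0) = .zero := by
  simp [counterPolicy, counterAction, h]

theorem counterPolicy_b_notMem {i : Fin n} (hi : i ∉ A) (h0 : i ≠ 0) (hj : j ≤ f i) :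
    (counterPolicy P A W C D j).1 (.b i) = .delay j := by
  simp [counterPolicy, counterAction, hi, h0, hj]

theorem counterPolicy_c (i : Fin n) :
    (counterPolicy P A W C D j).1 (.c i) = if i ∈ C then .one else .zero := rfl

theorem counterPolicy_d (i : Fin n) :
    (counterPolicy P A W C D j).1 (.d i) = if i ∈ D then .one else .zero := rfl

theorem setBits_counterPolicy : setBits (counterPolicy P A W C D j) = A := by
  ext i
  rw [mem_setBits, counterPolicy_b_eq_one_iff]

theorem weakInvariant_counterPolicy (B : Finset (Fin n)) :
    WeakInvariant (counterPolicy P B B B B j) := by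
  unfold WeakInvariant
  rw [setBits_counterPolicy]
  refine ⟨fun i hi => ?_, fun i hi => ?_, fun i l hl hi hmin => ?_, fun i hi => ?_⟩
  · simp [counterPolicy_c, counterPolicy_d, hi]
  · simp [counterPolicy_c, counterPolicy_d, hi]
  · exact target_eq_toBit_iff.2
      ⟨hl, by simpa using hi, fun m hm hle => hmin m hm (by simpa using hle)⟩
  · exact target_eq_toSink_iff.2 fun m hm hle => hi m hm (by simpa using hle)

theorem exists_hasTotalValue_counterPolicy (hW : W ⊆ A) (hC : C ⊆ A) :
    ∃ v, (mdp P).HasTotalValue (counterPolicy P A W C D j) v := by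
  refine exists_hasTotalValue (fun k l h => ?_) fun i h => ?_
  · exact counterPolicy_b_mem (hW (target_eq_toBit_iff.1 h).1)
  · rw [counterPolicy_c] at h
    exact counterPolicy_b_mem (hC (by_contra fun hi => by simp [hi] at h))

end CounterPolicy

end FullConstruction

/-! ### Greedy steps -/

namespace FullConstruction

variable {n : ℕ} [NeZero n] {P : Params n} {π π' : (mdp P).Policy} {v : State n → ℝ}

/-- The value of `d_{i+1}` if no bit is set. -/
def topCost (P : Params n) (i : Fin n) : ℝ :=
  if i.succ = Fin.last n then -P.εd (Fin.last n) else 0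

theorem Ladder.d_succ_le {B : Finset (Fin n)} {lo : Fin (n + 1)} {w d : Fin (n + 1) → ℝ}
    (hL : Ladder P B lo w d) {i : Fin n} (hi : lo ≤ i.succ) :
    d i.succ ≤ w i.succ + topCost P i := by
  unfold topCost
  split_ifs with h
  · rw [h, hL.w_last, hL.d_last, zero_add]
  · simpa using hL.d_le_w hi

theorem exists_hasTotalValue_noBits {i : Fin n} (hi : i ≠ 0) {j : ℕ} (hj : j ≤ f i) :
    ∃ v : State n → ℝ, (mdp P).HasTotalValue (counterPolicy P ∅ ∅ ∅ ∅ j) v ∧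
      v (.w 0) = 0 ∧ v (.b 0) = 0 ∧ v (.b i) = (if j = 0 then 0 else P.δ i j) ∧
      v (.bPlus ⟨i, hi⟩) = P.r i + topCost P i := by
  obtain ⟨v, hv⟩ := exists_hasTotalValue_counterPolicy (P := P) (A := ∅) (W := ∅) (C := ∅)
    (D := ∅) (j := j) subset_rfl subset_rfl
  have hE := evaluates_of_hasTotalValue hv
  have hw k : v (.w k) = 0 := by
    rw [hE.bellman, counterPolicy_w, target_eq_toSink_iff.2 (by simp), totalAppeal_w_toSink,
      hE.sink]
  have hfirst : v (.b 0) = 0 := by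
    rw [hE.b_zero (counterPolicy_b_first (by simp)), hw]
  have hdelay := counterPolicy_b_notMem (P := P) (W := ∅) (C := ∅) (D := ∅)
    (Finset.notMem_empty i) hi hj
  refine ⟨v, hv, hw 0, hfirst, ?_, ?_⟩
  · split_ifs with h0
    · rw [hE.b_delay_zero (h0 ▸ hdelay), hw]
    · rw [hE.b_delay (Nat.one_le_iff_ne_zero.2 h0) hdelay, hfirst, zero_add]
  · rw [hE.bPlus, topCost]
    split_ifs with h
    · rw [h, dAt_last, hE.dTop]
    · obtain ⟨k, hk⟩ := Fin.exists_castSucc_eq.2 h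
      rw [← hk, dAt_castSucc, hE.bellman, counterPolicy_d, if_neg (by simp), totalAppeal_d_zero, hw]

namespace Params.GadgetOrder

variable {i : Fin n}

theorem totalAppeal_lt_next (h : P.GadgetOrder) (hπ : WeakInvariant π)
    (hv : (mdp P).HasTotalValue π v) (hi : i ≠ 0) {j : ℕ} (hjf : j < f i)
    (hj : π.1 (.b i) = .delay j) {a : Action n} (ha : a ∈ avail (State.b i))
    (hne : a ≠ .delay (j + 1)) :
    (mdp P).totalAppeal v (.b i) a < (mdp P).totalAppeal v (.b i) (.delay (j + 1)) := by
  have hmax := (h π v _ hπ hv.totalReward i j hi hj).2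
  rw [if_neg hjf.ne] at hmax
  exact hmax a ha hne

theorem lt_totalAppeal_next (h : P.GadgetOrder) (hπ : WeakInvariant π)
    (hv : (mdp P).HasTotalValue π v) (hi : i ≠ 0) {j : ℕ} (hjf : j < f i)
    (hj : π.1 (.b i) = .delay j) :
    v (.b i) < (mdp P).totalAppeal v (.b i) (.delay (j + 1)) := by
  rw [hv.bellman, hj]
  exact h.totalAppeal_lt_next hπ hv hi hjf hj ((avail_b hi).2 (.inr ⟨j, hjf.le, rfl⟩)) (by simp)

theorem δ_one_pos (h : P.GadgetOrder) (hi : i ≠ 0) : 0 < P.δ i 1 := by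
  obtain ⟨v, hv, -, hfirst, hb, -⟩ := exists_hasTotalValue_noBits (P := P) hi (Nat.zero_le _)
  have hlt := h.lt_totalAppeal_next (weakInvariant_counterPolicy ∅) hv hi (by unfold f; lia)
    (counterPolicy_b_notMem (by simp) hi (Nat.zero_le _))
  rw [if_pos rfl] at hb
  rw [zero_add, totalAppeal_b_delay P v i le_rfl, hb, hfirst] at hlt
  exact pos_of_mul_pos_right (by linarith : 0 < P.p i 1 * P.δ i 1) (P.p_pos i 1).le

section Gain

variable {j : ℕ} (h : P.GadgetOrder) (hi : i ≠ 0) (hj : 1 ≤ j) (hjf : j < f i)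
include h hi hj hjf

theorem gain_pos : 0 < P.p i (j + 1) * (P.δ i (j + 1) - P.δ i j) := by
  obtain ⟨v, hv, -, hfirst, hb, -⟩ := exists_hasTotalValue_noBits (P := P) hi hjf.le
  have hlt := h.lt_totalAppeal_next (weakInvariant_counterPolicy ∅) hv hi hjf
    (counterPolicy_b_notMem (by simp) hi hjf.le)
  rw [if_neg (by lia)] at hb
  rw [totalAppeal_b_delay P v i (by lia), hb, hfirst] at hlt
  simpa using hlt

theorem gain_max {j' : ℕ} (hj' : 1 ≤ j') (hjf' : j' ≤ f i) (hne : j' ≠ j + 1) :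
    P.p i j' * (P.δ i j' - P.δ i j) < P.p i (j + 1) * (P.δ i (j + 1) - P.δ i j) := by
  obtain ⟨v, hv, -, hfirst, hb, -⟩ := exists_hasTotalValue_noBits (P := P) hi hjf.le
  have hlt := h.totalAppeal_lt_next (weakInvariant_counterPolicy ∅) hv hi hjf
    (counterPolicy_b_notMem (by simp) hi hjf.le) ((avail_b hi).2 (.inr ⟨j', hjf', rfl⟩))
    (by simpa using hne)
  rw [if_neg (by lia)] at hb
  rw [totalAppeal_b_delay P v i hj', totalAppeal_b_delay P v i (by lia), hb, hfirst] at hlt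
  simpa using hlt

theorem gain_one :
    P.α i * (P.r i + topCost P i - P.δ i j) < P.p i (j + 1) * (P.δ i (j + 1) - P.δ i j) := by
  obtain ⟨v, hv, -, hfirst, hb, hbPlus⟩ := exists_hasTotalValue_noBits (P := P) hi hjf.le
  have hlt := h.totalAppeal_lt_next (weakInvariant_counterPolicy ∅) hv hi hjf
    (counterPolicy_b_notMem (by simp) hi hjf.le) ((avail_b hi).2 (.inl rfl)) (by simp)
  rw [if_neg (by lia)] at hb
  rw [totalAppeal_b_one P v i hi, totalAppeal_b_delay P v i (by lia), hb, hfirst, hbPlus] at hlt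
  linarith

theorem δ_lt_succ : P.δ i j < P.δ i (j + 1) :=
  sub_pos.1 (pos_of_mul_pos_right (h.gain_pos hi hj hjf) (P.p_pos i (j + 1)).le)

end Gain

theorem δ_pos (h : P.GadgetOrder) (hi : i ≠ 0) {j : ℕ} (hj : 1 ≤ j) (hjf : j ≤ f i) :
    0 < P.δ i j := by
  induction j, hj using Nat.le_induction with
  | base => exact h.δ_one_pos hi
  | succ j hj ih => exact (ih (by lia)).trans (h.δ_lt_succ hi hj hjf)

theorem δmax_nonneg (h : P.GadgetOrder) : 0 ≤ P.δmax := by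
  by_cases hn : ∃ i : Fin n, i ≠ 0
  · obtain ⟨i, hi⟩ := hn
    exact (h.δ_one_pos hi).le.trans (P.δ_le hi le_rfl (by unfold f; lia))
  · refine Real.sSup_nonneg ?_
    rintro x ⟨i, hi, -⟩
    exact absurd ⟨i, hi⟩ hn

end Params.GadgetOrder

theorem Params.Admissible.gaps (h : P.Admissible) : P.Gaps :=
  ⟨h.rewardGap, h.costGap, h.gadgetOrder.δmax_nonneg⟩

theorem eq_counterPolicy {A W C D : Finset (Fin n)} {j : ℕ}
    (hw : ∀ k, π.1 (.w k) = target W k) (hone : ∀ i ∈ A, π.1 (.b i) = .one)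
    (hfirst : (0 : Fin n) ∉ A → π.1 (.b 0) = .zero)
    (hdelay : ∀ i ∉ A, i ≠ 0 → j ≤ f i ∧ π.1 (.b i) = .delay j)
    (hc : ∀ i, π.1 (.c i) = if i ∈ C then .one else .zero)
    (hd : ∀ i, π.1 (.d i) = if i ∈ D then .one else .zero) :
    π = counterPolicy P A W C D j := by
  refine Subtype.ext (funext fun s => ?_)
  cases s with
  | w k => exact hw k
  | b i =>
    by_cases hi : i ∈ A
    · rw [hone i hi, counterPolicy_b_mem hi]
    by_cases h0 : i = 0
    · subst h0
      rw [hfirst hi, counterPolicy_b_first hi]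
    · rw [(hdelay i hi h0).2, counterPolicy_b_notMem hi h0 (hdelay i hi h0).1]
  | c i => exact hc i
  | d i => exact hd i
  | _ => rw [eq_only rfl]; rfl

theorem totalAppeal_b_delay_le {i : Fin n} {j : ℕ} {x : ℝ} (hj : 1 ≤ j) (hb : v (.b i) ≤ x)
    (hfirst : P.δ i j + v (.b 0) ≤ x) : (mdp P).totalAppeal v (.b i) (.delay j) ≤ x := by
  rw [totalAppeal_b_delay P v i hj]
  linarith [mul_le_mul_of_nonneg_left hfirst (P.p_pos i j).le,
    mul_le_mul_of_nonneg_left hb (sub_nonneg.2 (P.p_le_one i j))]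

theorem Evaluates.totalAppeal_b_one_lt (hE : Evaluates P π v) (hG : P.GadgetOrder) {i : Fin n}
    (hi : i ≠ 0) {j : ℕ} (hj : 1 ≤ j) (hjf : j < f i) (hπ : π.1 (.b i) = .delay j)
    (hd : v (dAt i.succ) ≤ v (.b 0) + topCost P i) :
    (mdp P).totalAppeal v (.b i) .one <
      v (.b i) + P.p i (j + 1) * (P.δ i (j + 1) - P.δ i j) := by
  have hle : P.α i * (P.r i + v (dAt i.succ) - v (.b i)) ≤
      P.α i * (P.r i + topCost P i - P.δ i j) := by
    refine mul_le_mul_of_nonneg_left ?_ (P.α_pos i).le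
    rw [hE.b_delay hj hπ]
    linarith
  rw [totalAppeal_b_one P v i hi, hE.bPlus]
  linarith [hG.gain_one hi hj hjf]

theorem Evaluates.b_le (hE : Evaluates P π v) (hg : P.Gaps) {i : Fin n} (hi : i ≠ 0) {j : ℕ}
    (hjf : j ≤ f i) (hj : 1 ≤ j ∨ v (.w 0) = v (.b 0)) (hπ : π.1 (.b i) = .delay j) :
    v (.b i) ≤ v (.b 0) + P.δmax := by
  rcases j.eq_zero_or_pos with rfl | hpos
  · rw [hE.b_delay_zero hπ, hj.resolve_left (by lia)]
    linarith [hg.δmax_nonneg]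
  · rw [hE.b_delay hpos hπ]
    linarith [P.δ_le hi hpos hjf]

theorem Evaluates.entry_lt (hE : Evaluates P π v) (hg : P.Gaps) {i : Fin n} (hi : i ≠ 0)
    (hb : v (.b i) ≤ v (.b 0) + P.δmax)
    (hfirst : v (.b 0) ≤ v (.w i.castSucc) + P.rewardBelow i.castSucc) :
    v (FullConstruction.entry i) < v (.w i.castSucc) := by
  rw [hE.entry]
  linarith [hg.lt_c hi]

section Greedy

variable (h : (mdp P).GreedyImproves v π π')
include h

theorem greedy_w_keep {k : Fin (n + 1)} (hsink : 0 ≤ v (.w k))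
    (hentry : ∀ m : Fin n, k ≤ m.castSucc → v (entry m) ≤ v (.w k)) :
    π'.1 (.w k) = π.1 (.w k) := by
  refine h.keep _ fun a ha => ?_
  rcases avail_w.1 ha with rfl | ⟨m, hm, rfl⟩
  · rwa [totalAppeal_w_toSink, (evaluates_of_hasTotalValue h.hasTotalValue).sink]
  · rw [totalAppeal_w_toBit]
    exact hentry m hm

theorem greedy_w_switch {k : Fin (n + 1)} {l : Fin n} (hl : k ≤ l.castSucc)
    (hsink : 0 < v (entry l))
    (hentry : ∀ m : Fin n, k ≤ m.castSucc → m ≠ l → v (entry m) < v (entry l)) :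
    π'.1 (.w k) = .toBit l := by
  refine h.choose _ _ (avail_w.2 (.inr ⟨l, hl, rfl⟩)) fun a ha hne => ?_
  rw [totalAppeal_w_toBit]
  rcases avail_w.1 ha with rfl | ⟨m, hm, rfl⟩
  · rwa [totalAppeal_w_toSink, (evaluates_of_hasTotalValue h.hasTotalValue).sink]
  · rw [totalAppeal_w_toBit]
    exact hentry m hm fun hml => hne (by rw [hml])

theorem greedy_c_one {i : Fin n} (hi : v (.w i.succ) + P.εc i.castSucc < v (entry i)) :
    π'.1 (.c i) = .one := by
  refine h.choose_of_forall_eq_or ((avail_c i).2 (.inr rfl))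
    (fun a ha => ((avail_c i).1 ha).symm) ?_
  rw [totalAppeal_c_zero, totalAppeal_c_one]
  linarith

theorem greedy_c_zero {i : Fin n} (hi : v (entry i) < v (.w i.succ) + P.εc i.castSucc) :
    π'.1 (.c i) = .zero := by
  refine h.choose_of_forall_eq_or ((avail_c i).2 (.inl rfl))
    (fun a ha => (avail_c i).1 ha) ?_
  rw [totalAppeal_c_zero, totalAppeal_c_one]
  linarith

theorem greedy_d_one {i : Fin n} (hi : v (.w i.succ) + P.εd i.castSucc < v (.c i)) :
    π'.1 (.d i) = .one := by
  refine h.choose_of_forall_eq_or ((avail_d i).2 (.inr rfl))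
    (fun a ha => ((avail_d i).1 ha).symm) ?_
  rw [totalAppeal_d_zero, totalAppeal_d_one]
  linarith

theorem greedy_d_zero {i : Fin n} (hi : v (.c i) < v (.w i.succ) + P.εd i.castSucc) :
    π'.1 (.d i) = .zero := by
  refine h.choose_of_forall_eq_or ((avail_d i).2 (.inl rfl))
    (fun a ha => (avail_d i).1 ha) ?_
  rw [totalAppeal_d_zero, totalAppeal_d_one]
  linarith

theorem greedy_d_keep_zero {i : Fin n} (hπ : π.1 (.d i) = .zero)
    (hi : v (.c i) ≤ v (.w i.succ) + P.εd i.castSucc) : π'.1 (.d i) = .zero := by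
  have hd := h.hasTotalValue.bellman (.d i)
  rw [hπ, totalAppeal_d_zero] at hd
  rw [← hπ]
  refine h.keep _ fun a ha => ?_
  rcases (avail_d i).1 ha with rfl | rfl
  · rw [totalAppeal_d_zero, hd]
  · rw [totalAppeal_d_one, hd]
    linarith

theorem greedy_b_first_one (hi : v (.w (Fin.succ 0)) < P.r 0 + v (dAt (Fin.succ 0))) :
    π'.1 (.b 0) = .one := by
  refine h.choose_of_forall_eq_or (avail_b_first.2 (.inr rfl))
    (fun a ha => (avail_b_first.1 ha).symm) ?_
  rwa [totalAppeal_b_zero, totalAppeal_b_first_one]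

theorem greedy_b_first_zero (hi : P.r 0 + v (dAt (Fin.succ 0)) < v (.w (Fin.succ 0))) :
    π'.1 (.b 0) = .zero := by
  refine h.choose_of_forall_eq_or (avail_b_first.2 (.inl rfl))
    (fun a ha => avail_b_first.1 ha) ?_
  rwa [totalAppeal_b_zero, totalAppeal_b_first_one]

theorem greedy_b_keep_one {i : Fin n} (hi : i ≠ 0) (hπ : π.1 (.b i) = .one)
    (hw : v (.w 0) ≤ v (.b i)) (hfirst : v (.b 0) + P.δmax ≤ v (.b i)) :
    π'.1 (.b i) = .one := by
  rw [← hπ]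
  refine h.keep _ fun a ha => ?_
  rcases (avail_b hi).1 ha with rfl | ⟨j, hj, rfl⟩
  · rw [h.hasTotalValue.bellman (.b i), hπ]
  · rcases j.eq_zero_or_pos with rfl | hpos
    · rwa [totalAppeal_b_delay_zero]
    · exact totalAppeal_b_delay_le hpos le_rfl (by linarith [P.δ_le hi hpos hj])

theorem greedy_b_reset {i : Fin n} (hi : i ≠ 0) (hb : v (.b i) < v (.w 0))
    (hfirst : v (.b 0) + P.δmax < v (.w 0))
    (hone : (mdp P).totalAppeal v (.b i) .one < v (.w 0)) : π'.1 (.b i) = .delay 0 := by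
  refine h.choose _ _ ((avail_b hi).2 (.inr ⟨0, Nat.zero_le _, rfl⟩)) fun a ha hne => ?_
  rw [totalAppeal_b_delay_zero]
  rcases (avail_b hi).1 ha with rfl | ⟨j, hj, rfl⟩
  · exact hone
  · have hpos : 1 ≤ j := Nat.one_le_iff_ne_zero.2 fun h0 => hne (by rw [h0])
    exact (totalAppeal_b_delay_le hpos (le_max_left _ (v (.b 0) + P.δmax))
      (by linarith [P.δ_le hi hpos hj, le_max_right (v (.b i)) (v (.b 0) + P.δmax)])).trans_lt
      (max_lt hb hfirst)

theorem greedy_b_next (hG : P.GadgetOrder) {i : Fin n} (hi : i ≠ 0) {j : ℕ} (hj : 1 ≤ j)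
    (hjf : j < f i) (hπ : π.1 (.b i) = .delay j) (hw : v (.w 0) ≤ v (.b 0))
    (hd : v (dAt i.succ) ≤ v (.b 0) + topCost P i) : π'.1 (.b i) = .delay (j + 1) := by
  have hE := evaluates_of_hasTotalValue h.hasTotalValue
  have hb := hE.b_delay hj hπ
  have hdelay : ∀ j', 1 ≤ j' → (mdp P).totalAppeal v (.b i) (.delay j') =
      v (.b i) + P.p i j' * (P.δ i j' - P.δ i j) := fun j' hj' => by
    rw [totalAppeal_b_delay P v i hj', hb]
    ring
  refine h.choose _ _ ((avail_b hi).2 (.inr ⟨_, hjf, rfl⟩)) fun a ha hne => ?_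
  rw [hdelay _ (by lia)]
  rcases (avail_b hi).1 ha with rfl | ⟨j', hj', rfl⟩
  · exact hE.totalAppeal_b_one_lt hG hi hj hjf hπ hd
  · rcases j'.eq_zero_or_pos with rfl | hpos
    · rw [totalAppeal_b_delay_zero]
      linarith [hG.gain_pos hi hj hjf, hG.δ_pos hi hj hjf.le]
    · rw [hdelay _ hpos]
      linarith [hG.gain_max hi hj hjf hpos hj' fun heq => hne (by rw [heq])]

end Greedy

end FullConstruction

/-! ### Iterations under the weak invariant -/

namespace FullConstruction

variable {n : ℕ} [NeZero n] {P : Params n} {π π' : (mdp P).Policy} {v : State n → ℝ}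
  {B : Finset (Fin n)} {lo : Fin (n + 1)} {i l : Fin n} {j : ℕ}

section OnLadder

variable (hL : Ladder P B lo (fun k => v (.w k)) (fun k => v (dAt k)))
include hL

theorem Evaluates.entry_eq_w (hE : Evaluates P π v) (hπ : π.1 (.b i) = .one) (hi : i ∈ B)
    (hlo : lo ≤ i.castSucc) : v (FullConstruction.entry i) = v (.w i.castSucc) := by
  rw [hE.entry_one hπ, hL.w_mem i hi hlo]

theorem greedy_c_zero_of_notMem (h : (mdp P).GreedyImproves v π π') (hi : i ∉ B)
    (hlo : lo ≤ i.castSucc) (hentry : v (entry i) ≤ v (.w i.castSucc)) :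
    π'.1 (.c i) = .zero := by
  have hw : v (.w i.castSucc) = v (.w i.succ) := hL.w_notMem i hi hlo
  exact greedy_c_zero h (by linarith [P.εc_pos i.castSucc])

variable (hg : P.Gaps)
include hg

theorem Evaluates.w_succ_lt_entry (hE : Evaluates P π v) (hπ : π.1 (.b i) = .one)
    (hlo : lo ≤ i.succ) :
    P.rewardBelow i.castSucc + P.δmax + P.εmax + v (.w i.succ) < v (FullConstruction.entry i) := by
  rw [hE.entry_one hπ]
  exact hL.w_succ_lt_enter hg hlo

theorem w_succ_lt_b_first (hlo : lo ≤ Fin.succ 0) :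
    v (.w (Fin.succ 0)) < P.r 0 + v (dAt (Fin.succ 0)) := by
  have henter := hL.w_succ_lt_enter hg hlo
  rw [P.c_first] at henter
  linarith [P.εmax_pos, hg.δmax_nonneg, hg.rewardBelow_nonneg (Fin.castSucc 0)]

variable (h : (mdp P).GreedyImproves v π π')
include h

theorem greedy_w_keep_of_entry_le {k : Fin (n + 1)} (hk : lo ≤ k)
    (hentry : ∀ m : Fin n, k ≤ m.castSucc → v (entry m) ≤ v (.w m.castSucc)) :
    π'.1 (.w k) = π.1 (.w k) :=
  greedy_w_keep h (hL.w_nonneg hg hk) fun m hm =>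
    (hentry m hm).trans (hL.w_antitone hg hk hm)

theorem greedy_c_one_of_mem (hi : i ∈ B) (hlo : lo ≤ i.castSucc) (hπ : π.1 (.b i) = .one) :
    π'.1 (.c i) = .one := by
  refine greedy_c_one h ?_
  rw [(evaluates_of_hasTotalValue h.hasTotalValue).entry_eq_w hL hπ hi hlo]
  linarith [hL.w_succ_lt hg hi hlo, P.εc_le i.castSucc]

theorem greedy_d_one_of_c_one (hs : ¬ P.Stuck) (hlo : lo ≤ i.succ) (hb : π.1 (.b i) = .one)
    (hc : π.1 (.c i) = .one) : π'.1 (.d i) = .one := by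
  have hE := evaluates_of_hasTotalValue h.hasTotalValue
  refine greedy_d_one h ?_
  rw [hE.bellman (.c i), hc, totalAppeal_c_one, hE.entry_one hb]
  linarith [hL.w_succ_lt_enter_from_d hg hs hlo]

omit hL in
theorem greedy_b_keep_one_of_le (hi : i ≠ 0) (hπ : π.1 (.b i) = .one)
    (hw : v (.w 0) ≤ v (entry i) + P.rewardBelow i.castSucc)
    (hfirst : v (.b 0) ≤ v (entry i) + P.rewardBelow i.castSucc) : π'.1 (.b i) = .one := by
  have hentry := (evaluates_of_hasTotalValue h.hasTotalValue).entry i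
  exact greedy_b_keep_one h hi hπ (by linarith [hg.lt_c hi, hg.δmax_nonneg])
    (by linarith [hg.lt_c hi])

end OnLadder

theorem greedy_d_zero_of_c_zero (h : (mdp P).GreedyImproves v π π') (hc : π.1 (.c i) = .zero) :
    π'.1 (.d i) = .zero := by
  have hbellman := h.hasTotalValue.bellman (.c i)
  rw [hc, totalAppeal_c_zero] at hbellman
  exact greedy_d_zero h (by linarith [P.εd_pos i.castSucc])

section WholeLadder

variable (hL : Ladder P B 0 (fun k => v (.w k)) (fun k => v (dAt k))) (hg : P.Gaps)
include hL hg

theorem w_zero_le (k : Fin (n + 1)) : v (.w 0) ≤ v (.w k) + P.rewardBelow k := by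
  linarith [hL.w_add_rewardBelow_mono hg le_rfl (Fin.zero_le k), hg.rewardBelow_nonneg 0]

variable (hE : Evaluates P π v) (hπ : π.1 (.b 0) = .one)
include hE hπ

theorem Evaluates.w_zero_le_b_first : v (.w 0) ≤ v (.b 0) := by
  rw [hE.b_one hπ]
  by_cases hmem : (0 : Fin n) ∈ B
  · have hw := hL.w_mem 0 hmem (Fin.zero_le _)
    rw [P.c_first, sub_zero] at hw
    exact hw.le
  · exact (hL.w_notMem 0 hmem (Fin.zero_le _)).trans_le
      (w_succ_lt_b_first hL hg (Fin.zero_le _)).le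

theorem Evaluates.b_first_le (hi : i ≠ 0) :
    v (.b 0) ≤ v (.w i.castSucc) + P.rewardBelow i.castSucc := by
  have hmono := hL.w_add_rewardBelow_mono hg (Fin.zero_le _)
    (Fin.succ_le_castSucc_iff.2 (Fin.pos_iff_ne_zero.2 hi))
  rw [P.rewardBelow_succ] at hmono
  rw [hE.b_one hπ]
  linarith [hL.d_le_w (Fin.zero_le (Fin.succ 0)), hg.rewardBelow_nonneg (Fin.castSucc 0)]

end WholeLadder

section Steady

variable (h : (mdp P).GreedyImproves v (counterPolicy P B B B B j) π')
include h

theorem steady_ladder : Ladder P B 0 (fun k => v (.w k)) (fun k => v (dAt k)) := by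
  simpa only [setBits_counterPolicy] using
    (evaluates_of_hasTotalValue h.hasTotalValue).ladder_of_weakInvariant
      (weakInvariant_counterPolicy B)

theorem steady_entry_lt (hg : P.Gaps) (hi : i ∉ B) (h0 : i ≠ 0) (hj : j ≤ f i) :
    v (entry i) < v (.w i.castSucc) := by
  have hE := evaluates_of_hasTotalValue h.hasTotalValue
  have hW := weakInvariant_counterPolicy (P := P) (j := j) B
  have hfirst := hE.b_first_of_weakInvariant hW
  exact hE.entry_lt hg h0
    (hE.b_le hg h0 hj (.inr hfirst.symm) (counterPolicy_b_notMem hi h0 hj))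
    (hfirst.trans_le (w_zero_le (steady_ladder h) hg _))

theorem steady_entry_le (hg : P.Gaps) (hj : i ∉ B → i ≠ 0 → j ≤ f i) :
    v (entry i) ≤ v (.w i.castSucc) := by
  have hE := evaluates_of_hasTotalValue h.hasTotalValue
  have hW := weakInvariant_counterPolicy (P := P) (j := j) B
  by_cases hi : i ∈ B
  · exact (hE.entry_eq_w (steady_ladder h) (counterPolicy_b_mem hi) hi (Fin.zero_le _)).le
  by_cases h0 : i = 0
  · subst h0
    rw [hE.entry, P.c_first, hE.b_first_of_weakInvariant hW]
    simp
  · exact (steady_entry_lt h hg hi h0 (hj hi h0)).le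

theorem steady_b_one (hg : P.Gaps) (hi : i ∈ B ∨ i = 0) : π'.1 (.b i) = .one := by
  have hE := evaluates_of_hasTotalValue h.hasTotalValue
  have hW := weakInvariant_counterPolicy (P := P) (j := j) B
  have hL := steady_ladder h
  rcases eq_or_ne i 0 with rfl | h0
  · exact greedy_b_first_one h (w_succ_lt_b_first hL hg (Fin.zero_le _))
  · have hmem := hi.resolve_right h0
    have hone := counterPolicy_b_mem (P := P) (W := B) (C := B) (D := B) (j := j) hmem
    have hw := w_zero_le hL hg i.castSucc
    rw [← hE.entry_eq_w hL hone hmem (Fin.zero_le _)] at hw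
    exact greedy_b_keep_one_of_le hg h h0 hone hw
      ((hE.b_first_of_weakInvariant hW).trans_le hw)

theorem steady_b_notMem (hG : P.GadgetOrder) (hi : i ∉ B) (h0 : i ≠ 0) (hj : j ≤ f i) :
    π'.1 (.b i) = if j = f i then .one else .delay (j + 1) := by
  have hmax := (hG _ v _ (weakInvariant_counterPolicy B) h.hasTotalValue.totalReward
    i j h0 (counterPolicy_b_notMem hi h0 hj)).2
  refine h.choose _ _ ((avail_b h0).2 ?_) hmax
  split_ifs with hjf
  · exact .inl rfl
  · exact .inr ⟨j + 1, by lia, rfl⟩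

theorem steady_w (hg : P.Gaps) (hj : ∀ i ∉ B, i ≠ 0 → j ≤ f i) (k : Fin (n + 1)) :
    π'.1 (.w k) = target B k := by
  rw [greedy_w_keep_of_entry_le (steady_ladder h) hg h (Fin.zero_le _) fun m _ =>
    steady_entry_le h hg (hj m), counterPolicy_w]

theorem steady_c (hg : P.Gaps) (hj : i ∉ B → i ≠ 0 → j ≤ f i) :
    π'.1 (.c i) = if i ∈ B then .one else .zero := by
  split_ifs with hi
  · exact greedy_c_one_of_mem (steady_ladder h) hg h hi (Fin.zero_le _) (counterPolicy_b_mem hi)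
  · exact greedy_c_zero_of_notMem (steady_ladder h) h hi (Fin.zero_le _) (steady_entry_le h hg hj)

theorem steady_d (hg : P.Gaps) (hs : P.Stuck → B = ∅) :
    π'.1 (.d i) = if i ∈ B then .one else .zero := by
  split_ifs with hi
  · exact greedy_d_one_of_c_one (steady_ladder h) hg h (fun hst => by simp [hs hst] at hi)
      (Fin.zero_le _) (counterPolicy_b_mem hi) (by rw [counterPolicy_c, if_pos hi])
  · exact greedy_d_zero_of_c_zero h (by rw [counterPolicy_c, if_neg hi])

theorem steady_eq_counterPolicy {A : Finset (Fin n)} (hP : P.Admissible) (hs : P.Stuck → B = ∅)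
    (hBA : B ⊆ A) (hfirst : 0 ∈ A) (hA : ∀ i ∈ A, i ∉ B → i = 0 ∨ j = f i)
    (hj : ∀ i ∉ A, j < f i) :
    π' = counterPolicy P A B B B (j + 1) := by
  have hle : ∀ i ∉ B, i ≠ 0 → j ≤ f i := fun i hi h0 => by
    by_cases hiA : i ∈ A
    · exact ((hA i hiA hi).resolve_left h0).le
    · exact (hj i hiA).le
  refine eq_counterPolicy (steady_w h hP.gaps hle) (fun i hi => ?_) (absurd hfirst)
    (fun i hi h0 => ?_) (fun i => steady_c h hP.gaps (hle i)) fun i => steady_d h hP.gaps hs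
  · by_cases hiB : i ∈ B ∨ i = 0
    · exact steady_b_one h hP.gaps hiB
    · obtain ⟨hiB, h0⟩ := not_or.1 hiB
      have hjf := (hA i hi hiB).resolve_left h0
      rw [steady_b_notMem h hP.gadgetOrder hiB h0 hjf.le, if_pos hjf]
  · rw [steady_b_notMem h hP.gadgetOrder (fun hiB => hi (hBA hiB)) h0 (hj i hi).le,
      if_neg (hj i hi).ne]
    exact ⟨hj i hi, rfl⟩

end Steady

end FullConstruction

/-! ### The reaction to a new bit -/

namespace FullConstruction

variable {n : ℕ} {B : Finset (Fin n)} {i l : Fin n} {j : ℕ}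

/-- `l` is the least bit that is not in `B`, the bit that the next increment of the counter
sets. -/
structure IsLeastUnset (B : Finset (Fin n)) (l : Fin n) : Prop where
  notMem : l ∉ B
  mem_of_lt : ∀ i < l, i ∈ B

namespace IsLeastUnset

theorem lt_of_notMem (h : IsLeastUnset B l) (hi : i ∉ B) (hil : i ≠ l) : l < i :=
  lt_of_le_of_ne (not_lt.1 fun hlt => hi (h.mem_of_lt i hlt)) hil.symm

theorem zero_mem_insert [NeZero n] (h : IsLeastUnset B l) : (0 : Fin n) ∈ insert l B := by
  rcases eq_or_ne l 0 with rfl | h0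
  · exact Finset.mem_insert_self _ _
  · exact Finset.mem_insert_of_mem (h.mem_of_lt 0 (Fin.pos_iff_ne_zero.2 h0))

theorem ne_zero_of_notMem_insert [NeZero n] (h : IsLeastUnset B l)
    (hi : i ∉ insert l B) : i ≠ 0 := by
  rintro rfl
  exact hi h.zero_mem_insert

end IsLeastUnset

theorem ne_zero_of_gt [NeZero n] (h : l < i) : i ≠ 0 := ((Fin.zero_le l).trans_lt h).ne'

/-- The set bits after an increment that sets the bit `l`, all lower bits being set before. -/
def increment (B : Finset (Fin n)) (l : Fin n) : Finset (Fin n) := insert l (B.filter (l < ·))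

theorem mem_increment : i ∈ increment B l ↔ i = l ∨ i ∈ B ∧ l < i := by
  simp [increment]

theorem increment_subset (B : Finset (Fin n)) (l : Fin n) : increment B l ⊆ insert l B :=
  Finset.insert_subset_insert _ (Finset.filter_subset _ _)

theorem notMem_increment_of_lt (h : i < l) : i ∉ increment B l := fun hi =>
  (mem_increment.1 hi).elim h.ne fun hmem => h.asymm hmem.2

theorem mem_increment_iff_of_lt (h : l < i) : i ∈ increment B l ↔ i ∈ B := by
  simp [mem_increment, h, h.ne']

theorem target_increment_of_le {k : Fin (n + 1)} (hk : k ≤ l.castSucc) :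
    target (increment B l) k = .toBit l :=
  target_eq_toBit_iff.2 ⟨mem_increment.2 (.inl rfl), hk, fun _ hm _ =>
    (mem_increment.1 hm).elim (fun h => h.ge) fun h => h.2.le⟩

theorem target_increment_of_succ_le {k : Fin (n + 1)} (hk : l.succ ≤ k) :
    target (increment B l) k = target B k :=
  target_congr fun _ => and_congr_left fun hi =>
    mem_increment_iff_of_lt (Fin.succ_le_castSucc_iff.1 (hk.trans hi))

theorem succ_le_of_not_le_castSucc {k : Fin (n + 1)} (hk : ¬ k ≤ l.castSucc) : l.succ ≤ k :=
  Fin.castSucc_lt_iff_succ_le.1 (not_le.1 hk)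

section Setting

variable [NeZero n] {P : Params n} {π' : (mdp P).Policy} {v : State n → ℝ}
  (h : (mdp P).GreedyImproves v (counterPolicy P (insert l B) B B B j) π')
include h

theorem setting_ladder : Ladder P B 0 (fun k => v (.w k)) (fun k => v (dAt k)) :=
  (evaluates_of_hasTotalValue h.hasTotalValue).ladder (fun k _ => counterPolicy_w k)
    (fun i hi _ => ⟨counterPolicy_b_mem (Finset.mem_insert_of_mem hi), by
      rw [counterPolicy_c, if_pos hi]⟩) fun i _ => counterPolicy_d i

theorem setting_entry_eq (hi : i ∈ B) : v (entry i) = v (.w i.castSucc) :=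
  (evaluates_of_hasTotalValue h.hasTotalValue).entry_eq_w (setting_ladder h)
    (counterPolicy_b_mem (Finset.mem_insert_of_mem hi)) hi (Fin.zero_le _)

variable (hg : P.Gaps)
include hg

theorem setting_w_succ_lt_entry :
    P.rewardBelow l.castSucc + P.δmax + P.εmax + v (.w l.succ) < v (entry l) :=
  (evaluates_of_hasTotalValue h.hasTotalValue).w_succ_lt_entry (setting_ladder h) hg
    (counterPolicy_b_mem (Finset.mem_insert_self l B)) (Fin.zero_le _)

theorem setting_w_lt_entry {k : Fin (n + 1)} (hl : l ∉ B) (hk : k ≤ l.castSucc) :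
    v (.w k) < v (entry l) := by
  have hw : v (.w l.castSucc) = v (.w l.succ) := (setting_ladder h).w_notMem l hl (Fin.zero_le _)
  linarith [(setting_ladder h).w_add_rewardBelow_mono hg (Fin.zero_le _) hk,
    setting_w_succ_lt_entry h hg, P.εmax_pos, hg.δmax_nonneg, hg.rewardBelow_nonneg k]

theorem setting_w_le_entry (hl : l ∉ B) (hi : i ∈ insert l B) :
    v (.w i.castSucc) ≤ v (entry i) := by
  rcases Finset.mem_insert.1 hi with rfl | hi
  · exact (setting_w_lt_entry h hg hl le_rfl).le
  · exact (setting_entry_eq h hi).ge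

variable (hl : IsLeastUnset B l)
include hl

theorem setting_entry_lt (hi : i ∉ insert l B) (h1 : 1 ≤ j) (hj : j ≤ f i) :
    v (entry i) < v (.w i.castSucc) := by
  have hE := evaluates_of_hasTotalValue h.hasTotalValue
  have h0 := hl.ne_zero_of_notMem_insert hi
  exact hE.entry_lt hg h0 (hE.b_le hg h0 hj (.inl h1) (counterPolicy_b_notMem hi h0 hj))
    (hE.b_first_le (setting_ladder h) hg (counterPolicy_b_mem hl.zero_mem_insert) h0)

theorem setting_w (h1 : 1 ≤ j) (hj : ∀ i ∉ insert l B, j ≤ f i) (k : Fin (n + 1)) :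
    π'.1 (.w k) = target (increment B l) k := by
  have hL := setting_ladder h
  have hle : ∀ m, m ≠ l → v (entry m) ≤ v (.w m.castSucc) := fun m hml => by
    by_cases hm : m ∈ B
    · exact (setting_entry_eq h hm).le
    · have hm' : m ∉ insert l B := by simp [hml, hm]
      exact (setting_entry_lt h hg hl hm' h1 (hj m hm')).le
  by_cases hk : k ≤ l.castSucc
  · have hlt := setting_w_lt_entry h hg hl.notMem hk
    rw [target_increment_of_le hk]
    exact greedy_w_switch h hk ((hL.w_nonneg hg (Fin.zero_le k)).trans_lt hlt) fun m hm hml =>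
      ((hle m hml).trans (hL.w_antitone hg (Fin.zero_le _) hm)).trans_lt hlt
  · rw [target_increment_of_succ_le (succ_le_of_not_le_castSucc hk),
      greedy_w_keep_of_entry_le hL hg h (Fin.zero_le _) fun m hm => hle m ?_, counterPolicy_w]
    rintro rfl
    exact hk hm

theorem setting_b_one (hi : i ∈ insert l B) : π'.1 (.b i) = .one := by
  have hE := evaluates_of_hasTotalValue h.hasTotalValue
  have hL := setting_ladder h
  rcases eq_or_ne i 0 with rfl | h0
  · exact greedy_b_first_one h (w_succ_lt_b_first hL hg (Fin.zero_le _))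
  · have hle := setting_w_le_entry h hg hl.notMem hi
    exact greedy_b_keep_one_of_le hg h h0 (counterPolicy_b_mem hi)
      (by linarith [w_zero_le hL hg i.castSucc])
      (by linarith [hE.b_first_le hL hg (counterPolicy_b_mem hl.zero_mem_insert) h0])

theorem setting_b_next (hG : P.GadgetOrder) (hi : i ∉ insert l B) (h1 : 1 ≤ j) (hj : j < f i) :
    π'.1 (.b i) = .delay (j + 1) := by
  have hL := setting_ladder h
  have h0 := hl.ne_zero_of_notMem_insert hi
  have hw := (evaluates_of_hasTotalValue h.hasTotalValue).w_zero_le_b_first hL hg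
    (counterPolicy_b_mem hl.zero_mem_insert)
  refine greedy_b_next h hG h0 h1 hj (counterPolicy_b_notMem hi h0 hj.le) hw ?_
  linarith [hL.d_succ_le (Fin.zero_le i.succ), hL.w_antitone hg le_rfl (Fin.zero_le i.succ)]

theorem setting_c (h1 : 1 ≤ j) (hj : i ∉ insert l B → j ≤ f i) :
    π'.1 (.c i) = if i ∈ insert l B then .one else .zero := by
  have hL := setting_ladder h
  split_ifs with hi
  · rcases Finset.mem_insert.1 hi with rfl | hmem
    · refine greedy_c_one h ?_
      linarith [setting_w_succ_lt_entry h hg, P.εc_le i.castSucc, hg.δmax_nonneg,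
        hg.rewardBelow_nonneg i.castSucc]
    · exact greedy_c_one_of_mem hL hg h hmem (Fin.zero_le _) (counterPolicy_b_mem hi)
  · exact greedy_c_zero_of_notMem hL h (fun hmem => hi (Finset.mem_insert_of_mem hmem))
      (Fin.zero_le _) (setting_entry_lt h hg hl hi h1 (hj hi)).le

omit hl in
theorem setting_d (hl : l ∉ B) : π'.1 (.d i) = if i ∈ B then .one else .zero := by
  split_ifs with hi
  · exact greedy_d_one_of_c_one (setting_ladder h) hg h
      (Params.not_stuck_of_ne (ne_of_mem_of_not_mem hi hl)) (Fin.zero_le _)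
      (counterPolicy_b_mem (Finset.mem_insert_of_mem hi)) (by rw [counterPolicy_c, if_pos hi])
  · exact greedy_d_zero_of_c_zero h (by rw [counterPolicy_c, if_neg hi])

omit hg in
theorem setting_eq_counterPolicy (hP : P.Admissible) (h1 : 1 ≤ j)
    (hj : ∀ i ∉ insert l B, j < f i) :
    π' = counterPolicy P (insert l B) (increment B l) (insert l B) B (j + 1) :=
  eq_counterPolicy (setting_w h hP.gaps hl h1 fun i hi => (hj i hi).le)
    (fun _ hi => setting_b_one h hP.gaps hl hi) (absurd hl.zero_mem_insert)
    (fun i hi _ => ⟨hj i hi, setting_b_next h hP.gaps hl hP.gadgetOrder hi h1 (hj i hi)⟩)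
    (fun i => setting_c h hP.gaps hl h1 fun hi => (hj i hi).le)
    fun _ => setting_d h hP.gaps hl.notMem

end Setting

end FullConstruction

namespace FullConstruction

section Carrying

variable {n : ℕ} [NeZero n] {P : Params n} {π' : (mdp P).Policy} {v : State n → ℝ}
  {B : Finset (Fin n)} {i l : Fin n} {j : ℕ}
  (h : (mdp P).GreedyImproves v
    (counterPolicy P (insert l B) (increment B l) (insert l B) B j) π')
include h

theorem carrying_ladder : Ladder P B l.succ (fun k => v (.w k)) (fun k => v (dAt k)) :=
  (evaluates_of_hasTotalValue h.hasTotalValue).ladder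
    (fun k hk => by rw [counterPolicy_w, target_increment_of_succ_le hk])
    (fun i hi _ => ⟨counterPolicy_b_mem (Finset.mem_insert_of_mem hi), by
      rw [counterPolicy_c, if_pos (Finset.mem_insert_of_mem hi)]⟩)
    fun i _ => counterPolicy_d i

theorem carrying_w_eq_entry {k : Fin (n + 1)} (hk : k ≤ l.castSucc) :
    v (.w k) = v (entry l) := by
  rw [h.hasTotalValue.bellman, counterPolicy_w, target_increment_of_le hk, totalAppeal_w_toBit]

theorem carrying_c_eq (hi : i ∈ insert l B) :
    v (.c i) = -P.εc i.castSucc + v (entry i) := by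
  rw [h.hasTotalValue.bellman, counterPolicy_c, if_pos hi, totalAppeal_c_one]

theorem carrying_entry_eq_w (hi : i ∈ B) (hil : l < i) : v (entry i) = v (.w i.castSucc) :=
  (evaluates_of_hasTotalValue h.hasTotalValue).entry_eq_w (carrying_ladder h)
    (counterPolicy_b_mem (Finset.mem_insert_of_mem hi)) hi (Fin.succ_le_castSucc_iff.2 hil)

variable (hg : P.Gaps)
include hg

theorem carrying_w_succ_lt_entry :
    P.rewardBelow l.castSucc + P.δmax + P.εmax + v (.w l.succ) < v (entry l) :=
  (evaluates_of_hasTotalValue h.hasTotalValue).w_succ_lt_entry (carrying_ladder h) hg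
    (counterPolicy_b_mem (Finset.mem_insert_self l B)) le_rfl

theorem carrying_entry_le_w_add (hil : l < i) :
    v (entry l) ≤ v (.w i.castSucc) + P.rewardBelow i.castSucc := by
  have hL := carrying_ladder h
  have hmono := hL.w_add_rewardBelow_mono hg le_rfl (Fin.succ_le_castSucc_iff.2 hil)
  rw [P.rewardBelow_succ] at hmono
  rw [(evaluates_of_hasTotalValue h.hasTotalValue).entry_one
    (counterPolicy_b_mem (Finset.mem_insert_self l B))]
  linarith [hL.d_le_w le_rfl, hg.c_nonneg l, hg.rewardBelow_nonneg l.castSucc]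

theorem carrying_entry_pos : 0 < v (entry l) := by
  linarith [(carrying_ladder h).w_nonneg hg le_rfl, carrying_w_succ_lt_entry h hg,
    hg.rewardBelow_nonneg l.castSucc, hg.δmax_nonneg, P.εmax_pos]

theorem carrying_d_of_lt (hil : l < i) : π'.1 (.d i) = if i ∈ B then .one else .zero := by
  split_ifs with hi
  · have hmem : i ∈ insert l B := Finset.mem_insert_of_mem hi
    exact greedy_d_one_of_c_one (carrying_ladder h) hg h (Params.not_stuck_of_ne hil.ne)
      (Fin.succ_le_succ_iff.2 hil.le) (counterPolicy_b_mem hmem)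
      (by rw [counterPolicy_c, if_pos hmem])
  · exact greedy_d_zero_of_c_zero h (by rw [counterPolicy_c, if_neg (by simp [hi, hil.ne'])])

theorem carrying_d_self (hs : ¬ P.Stuck) : π'.1 (.d l) = .one :=
  greedy_d_one_of_c_one (carrying_ladder h) hg h hs le_rfl
    (counterPolicy_b_mem (Finset.mem_insert_self l B))
    (by rw [counterPolicy_c, if_pos (Finset.mem_insert_self l B)])

omit hg in
theorem carrying_d_self_of_stuck (hs : P.Stuck) (hl : l ∉ B) : π'.1 (.d l) = .zero := by
  obtain ⟨hn, hr⟩ := hs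
  obtain rfl : l = 0 := Fin.ext (by simp; lia)
  have hL := carrying_ladder h
  have hw := hL.w_last
  have hd := hL.d_last
  rw [← succ_eq_last_of_eq_one hn 0] at hw hd hr
  refine greedy_d_keep_zero h (by rw [counterPolicy_d, if_neg hl]) ?_
  rw [carrying_c_eq h (Finset.mem_insert_self 0 B),
    (evaluates_of_hasTotalValue h.hasTotalValue).entry_one
      (counterPolicy_b_mem (Finset.mem_insert_self 0 B)), P.c_first]
  linarith

section Below

variable (hl : IsLeastUnset B l)
include hl

theorem carrying_d_bounds {k : Fin (n + 1)} (hk : k ≤ l.castSucc) :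
    v (.w l.succ) ≤ v (dAt k) ∧
      v (dAt k) + P.rewardBelow k ≤ v (.w l.succ) + P.rewardBelow l.castSucc := by
  induction k using Fin.reverseInduction with
  | last => exact absurd hk (not_le.2 l.castSucc_lt_last)
  | cast i ih =>
    have hd := h.hasTotalValue.bellman (.d i)
    rcases (Fin.castSucc_le_castSucc_iff.1 hk).eq_or_lt with rfl | hil
    · rw [counterPolicy_d, if_neg hl.notMem, totalAppeal_d_zero] at hd
      rw [dAt_castSucc, hd]
      exact ⟨le_rfl, le_rfl⟩
    · have hi := hl.mem_of_lt i hil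
      have hmem : i ∈ insert l B := Finset.mem_insert_of_mem hi
      obtain ⟨hle, hsum⟩ := ih (Fin.succ_le_castSucc_iff.2 hil)
      rw [counterPolicy_d, if_pos hi, totalAppeal_d_one, carrying_c_eq h hmem,
        (evaluates_of_hasTotalValue h.hasTotalValue).entry_one (counterPolicy_b_mem hmem)] at hd
      rw [P.rewardBelow_succ] at hsum
      rw [dAt_castSucc, hd]
      constructor
      · linarith [hg.lt_sub i, P.εmax_le_mul, P.εd_le i.castSucc, P.εc_le i.castSucc,
          hg.rewardBelow_nonneg i.castSucc, hg.δmax_nonneg]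
      · linarith [P.εd_pos i.castSucc, P.εc_pos i.castSucc, hg.c_nonneg i]

theorem carrying_b_bounds (hil : i < l) :
    v (.w l.succ) ≤ v (.b i) ∧ v (.b i) + P.δmax < v (entry l) := by
  obtain ⟨hle, hsum⟩ := carrying_d_bounds h hg hl (Fin.succ_le_castSucc_iff.2 hil)
  rw [P.rewardBelow_succ] at hsum
  rw [(evaluates_of_hasTotalValue h.hasTotalValue).b_one
    (counterPolicy_b_mem (Finset.mem_insert_of_mem (hl.mem_of_lt i hil)))]
  constructor
  · linarith [hg.r_pos i]
  · linarith [hg.rewardBelow_nonneg i.castSucc, carrying_w_succ_lt_entry h hg, P.εmax_pos]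

theorem carrying_b_first_bounds :
    v (.w l.succ) ≤ v (.b 0) ∧ v (.b 0) ≤ v (entry l) := by
  rcases eq_or_ne l 0 with rfl | h0
  · have hentry := (evaluates_of_hasTotalValue h.hasTotalValue).entry 0
    rw [P.c_first] at hentry
    constructor <;> linarith [carrying_w_succ_lt_entry h hg, P.εmax_pos, hg.δmax_nonneg,
      hg.rewardBelow_nonneg (Fin.castSucc 0)]
  · obtain ⟨hle, hlt⟩ := carrying_b_bounds h hg hl (Fin.pos_iff_ne_zero.2 h0)
    exact ⟨hle, by linarith [hg.δmax_nonneg]⟩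

theorem carrying_entry_lt_of_lt (hil : i < l) : v (entry i) < v (entry l) := by
  rw [(evaluates_of_hasTotalValue h.hasTotalValue).entry]
  linarith [(carrying_b_bounds h hg hl hil).2, hg.c_nonneg i, hg.δmax_nonneg]

theorem carrying_d_zero_of_lt (hil : i < l) : π'.1 (.d i) = .zero := by
  refine greedy_d_zero h ?_
  rw [carrying_c_eq h (Finset.mem_insert_of_mem (hl.mem_of_lt i hil)),
    carrying_w_eq_entry h (Fin.succ_le_castSucc_iff.2 hil)]
  linarith [carrying_entry_lt_of_lt h hg hl hil, P.εc_pos i.castSucc, P.εd_pos i.castSucc]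

theorem carrying_b_one (hi : i ∈ increment B l) : π'.1 (.b i) = .one := by
  have hL := carrying_ladder h
  rcases eq_or_ne i 0 with rfl | h0
  · obtain rfl : (0 : Fin n) = l :=
      (mem_increment.1 hi).resolve_right fun hmem => Fin.not_lt_zero _ hmem.2
    exact greedy_b_first_one h (w_succ_lt_b_first hL hg le_rfl)
  · have hle : v (entry l) ≤ v (entry i) + P.rewardBelow i.castSucc := by
      rcases mem_increment.1 hi with rfl | ⟨hmem, hil⟩
      · linarith [hg.rewardBelow_nonneg i.castSucc]
      · rw [carrying_entry_eq_w h hmem hil]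
        exact carrying_entry_le_w_add h hg hil
    exact greedy_b_keep_one_of_le hg h h0 (counterPolicy_b_mem (increment_subset B l hi))
      ((carrying_w_eq_entry h (Fin.zero_le _)).trans_le hle)
      ((carrying_b_first_bounds h hg hl).2.trans hle)

theorem carrying_b_first_zero (h0 : l ≠ 0) : π'.1 (.b 0) = .zero := by
  have hpos := Fin.pos_iff_ne_zero.2 h0
  refine greedy_b_first_zero h ?_
  rw [← (evaluates_of_hasTotalValue h.hasTotalValue).b_one
      (counterPolicy_b_mem (Finset.mem_insert_of_mem (hl.mem_of_lt 0 hpos))),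
    carrying_w_eq_entry h (Fin.succ_le_castSucc_iff.2 hpos)]
  linarith [(carrying_b_bounds h hg hl hpos).2, hg.δmax_nonneg]

theorem carrying_b_reset_of_lt (h0 : i ≠ 0) (hil : i < l) : π'.1 (.b i) = .delay 0 := by
  have hfirst := (carrying_b_bounds h hg hl ((Fin.pos_iff_ne_zero.2 h0).trans hil)).2
  have hlt : v (.b i) < v (entry l) := by
    linarith [(carrying_b_bounds h hg hl hil).2, hg.δmax_nonneg]
  have hone : (counterPolicy P (insert l B) (increment B l) (insert l B) B j).1 (.b i) = .one :=
    counterPolicy_b_mem (Finset.mem_insert_of_mem (hl.mem_of_lt i hil))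
  rw [← carrying_w_eq_entry h (Fin.zero_le _)] at hfirst hlt
  refine greedy_b_reset h h0 hlt hfirst ?_
  rwa [← hone, ← h.hasTotalValue.bellman]

end Below

section Above

variable (hl : IsLeastUnset B l) (h1 : 1 ≤ j)
include hl h1

theorem carrying_entry_lt (hi : i ∉ B) (hil : l < i) (hj : j ≤ f i) :
    v (entry i) < v (.w i.castSucc) := by
  have hE := evaluates_of_hasTotalValue h.hasTotalValue
  have h0 : i ≠ 0 := ne_zero_of_gt hil
  exact hE.entry_lt hg h0
    (hE.b_le hg h0 hj (.inl h1) (counterPolicy_b_notMem (by simp [hi, hil.ne']) h0 hj))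
    ((carrying_b_first_bounds h hg hl).2.trans (carrying_entry_le_w_add h hg hil))

theorem carrying_entry_le (hil : l < i) (hj : i ∉ B → j ≤ f i) :
    v (entry i) ≤ v (.w i.castSucc) := by
  by_cases hi : i ∈ B
  · exact (carrying_entry_eq_w h hi hil).le
  · exact (carrying_entry_lt h hg hl h1 hi hil (hj hi)).le

theorem carrying_w (hj : ∀ i ∉ B, l < i → j ≤ f i) (k : Fin (n + 1)) :
    π'.1 (.w k) = target (increment B l) k := by
  have hL := carrying_ladder h
  rw [← counterPolicy_w (P := P) (A := insert l B) (C := insert l B) (D := B) (j := j)]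
  have hle : ∀ m, l < m → v (entry m) ≤ v (.w m.castSucc) := fun m hm =>
    carrying_entry_le h hg hl h1 hm fun hmem => hj m hmem hm
  by_cases hk : k ≤ l.castSucc
  · have hw := carrying_w_eq_entry h hk
    refine greedy_w_keep h (hw ▸ (carrying_entry_pos h hg).le) fun m _ => ?_
    rw [hw]
    rcases lt_trichotomy m l with hml | rfl | hml
    · exact (carrying_entry_lt_of_lt h hg hl hml).le
    · exact le_rfl
    · linarith [hle m hml, hL.w_antitone hg le_rfl (Fin.succ_le_castSucc_iff.2 hml),
        carrying_w_succ_lt_entry h hg, hg.rewardBelow_nonneg l.castSucc, hg.δmax_nonneg,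
        P.εmax_pos]
  · have hlk := succ_le_of_not_le_castSucc hk
    exact greedy_w_keep_of_entry_le hL hg h hlk fun m hm =>
      hle m (Fin.succ_le_castSucc_iff.1 (hlk.trans hm))

theorem carrying_c (hj : i ∉ B → l < i → j ≤ f i) :
    π'.1 (.c i) = if i ∈ increment B l then .one else .zero := by
  have hL := carrying_ladder h
  rcases lt_trichotomy i l with hil | rfl | hil
  · rw [if_neg (notMem_increment_of_lt hil)]
    refine greedy_c_zero h ?_
    rw [carrying_w_eq_entry h (Fin.succ_le_castSucc_iff.2 hil)]
    linarith [carrying_entry_lt_of_lt h hg hl hil, P.εc_pos i.castSucc]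
  · rw [if_pos (mem_increment.2 (.inl rfl))]
    refine greedy_c_one h ?_
    linarith [carrying_w_succ_lt_entry h hg, hg.rewardBelow_nonneg i.castSucc,
      hg.δmax_nonneg, P.εc_le i.castSucc]
  · have hlo := Fin.succ_le_castSucc_iff.2 hil
    simp only [mem_increment_iff_of_lt hil]
    split_ifs with hi
    · exact greedy_c_one_of_mem hL hg h hi hlo
        (counterPolicy_b_mem (Finset.mem_insert_of_mem hi))
    · exact greedy_c_zero_of_notMem hL h hi hlo
        (carrying_entry_lt h hg hl h1 hi hil (hj hi hil)).le

omit h1 in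
theorem carrying_d_le (hil : l < i) : v (dAt i.succ) ≤ v (.b 0) + topCost P i := by
  have hL := carrying_ladder h
  have hlo := Fin.succ_le_succ_iff.2 hil.le
  linarith [hL.d_succ_le hlo, hL.w_antitone hg le_rfl hlo, (carrying_b_first_bounds h hg hl).1]

variable (hG : P.GadgetOrder) (hi : i ∉ B) (hil : l < i) (hj : j < f i)
include hG hi hil hj

theorem carrying_b_next (h0 : l = 0) : π'.1 (.b i) = .delay (j + 1) := by
  have hi0 : i ≠ 0 := ne_zero_of_gt hil
  refine greedy_b_next h hG hi0 h1 hj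
    (counterPolicy_b_notMem (by simp [hi, hil.ne']) hi0 hj.le) ?_ (carrying_d_le h hg hl hil)
  rw [carrying_w_eq_entry h (Fin.zero_le _), h0,
    (evaluates_of_hasTotalValue h.hasTotalValue).entry, P.c_first]
  linarith

theorem carrying_b_reset (h0 : l ≠ 0) : π'.1 (.b i) = .delay 0 := by
  have hE := evaluates_of_hasTotalValue h.hasTotalValue
  have hi0 : i ≠ 0 := ne_zero_of_gt hil
  have hfirst := (carrying_b_bounds h hg hl (Fin.pos_iff_ne_zero.2 h0)).2
  have hdelay : (counterPolicy P (insert l B) (increment B l) (insert l B) B j).1 (.b i) =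
      .delay j := counterPolicy_b_notMem (by simp [hi, hil.ne']) hi0 hj.le
  have hb := hE.b_delay h1 hdelay
  rw [← carrying_w_eq_entry h (Fin.zero_le _)] at hfirst
  have hgain : P.p i (j + 1) * (P.δ i (j + 1) - P.δ i j) ≤ P.δ i (j + 1) - P.δ i j :=
    mul_le_of_le_one_left (sub_nonneg.2 (hG.δ_lt_succ hi0 h1 hj).le) (P.p_le_one i (j + 1))
  have hδ := P.δ_le hi0 (by lia : 1 ≤ j + 1) hj
  refine greedy_b_reset h hi0 (by linarith [P.δ_le hi0 h1 hj.le]) hfirst ?_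
  exact (hE.totalAppeal_b_one_lt hG hi0 h1 hj hdelay (carrying_d_le h hg hl hil)).trans_le
    (by linarith)

end Above

omit hg in
theorem carrying_eq_counterPolicy (hP : P.Admissible) (hs : ¬ P.Stuck) (hl : IsLeastUnset B l)
    (h1 : 1 ≤ j) (hj : ∀ i ∉ insert l B, j < f i) :
    π' = counterPolicy P (increment B l) (increment B l) (increment B l) (increment B l)
      (if l = 0 then j + 1 else 0) := by
  have hg := hP.gaps
  have hjf : ∀ i ∉ B, l < i → j < f i := fun i hi hil => hj i (by simp [hi, hil.ne'])
  refine eq_counterPolicy (carrying_w h hg hl h1 fun i hi hil => (hjf i hi hil).le)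
    (fun i hi => carrying_b_one h hg hl hi) (fun hmem => ?_) (fun i hi h0 => ?_)
    (fun i => carrying_c h hg hl h1 fun hi hil => (hjf i hi hil).le) fun i => ?_
  · exact carrying_b_first_zero h hg hl fun h0 => hmem (mem_increment.2 (.inl h0.symm))
  · rcases lt_trichotomy i l with hil | rfl | hil
    · rw [if_neg (ne_zero_of_gt hil)]
      exact ⟨Nat.zero_le _, carrying_b_reset_of_lt h hg hl h0 hil⟩
    · exact absurd (mem_increment.2 (.inl rfl)) hi
    · rw [mem_increment_iff_of_lt hil] at hi
      have hjf := hjf i hi hil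
      split_ifs with hl0
      · exact ⟨hjf, carrying_b_next h hg hl h1 hP.gadgetOrder hi hil hjf hl0⟩
      · exact ⟨Nat.zero_le _, carrying_b_reset h hg hl h1 hP.gadgetOrder hi hil hjf hl0⟩
  · rcases lt_trichotomy i l with hil | rfl | hil
    · rw [if_neg (notMem_increment_of_lt hil), carrying_d_zero_of_lt h hg hl hil]
    · rw [if_pos (mem_increment.2 (.inl rfl)), carrying_d_self h hg hs]
    · simpa only [mem_increment_iff_of_lt hil] using carrying_d_of_lt h hg hil

omit hg in
theorem carrying_eq_self_of_stuck (hP : P.Admissible) (hs : P.Stuck) (hl : IsLeastUnset B l)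
    (h1 : 1 ≤ j) :
    π' = counterPolicy P (insert l B) (increment B l) (insert l B) B j := by
  have hg := hP.gaps
  have heq : ∀ i, i = l := fun i => by
    by_contra hne
    exact Params.not_stuck_of_ne hne hs
  have hmem : ∀ i, i ∈ increment B l := fun i => mem_increment.2 (.inl (heq i))
  have hmem' : ∀ i, i ∈ insert l B := fun i => increment_subset B l (hmem i)
  have hlt : ∀ i, ¬ l < i := fun i hli => hli.ne' (heq i)
  refine eq_counterPolicy (carrying_w h hg hl h1 fun i _ hi => absurd hi (hlt i))
    (fun i _ => carrying_b_one h hg hl (hmem i)) (absurd (hmem' 0))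
    (fun i hi => absurd (hmem' i) hi) (fun i => ?_) fun i => ?_
  · rw [carrying_c h hg hl h1 fun _ hi => absurd hi (hlt i), if_pos (hmem i), if_pos (hmem' i)]
  · rw [heq i, carrying_d_self_of_stuck h hs hl.notMem, if_neg hl.notMem]

end Carrying

end FullConstruction

/-! ### The situations of a run -/

namespace FullConstruction

section LeastUnset

variable {n : ℕ} {B : Finset (Fin n)} {i l : Fin n} {j : ℕ}

theorem f_add_le (h : l < i) : f l + 6 ≤ f i := by
  have := Fin.lt_def.1 h
  unfold f
  lia

theorem exists_isLeastUnset (h : ¬ ∀ i, i ∈ B) : ∃ l, IsLeastUnset B l := by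
  have hne : Bᶜ.Nonempty := by
    push Not at h
    simpa [Finset.Nonempty] using h
  refine ⟨Bᶜ.min' hne, by simpa using Finset.min'_mem _ hne, fun i hi => ?_⟩
  by_contra hmem
  exact (Finset.min'_le _ i (by simpa using hmem)).not_gt hi

theorem IsLeastUnset.add_six_le_f (hl : IsLeastUnset B l) (hj : ∀ i ∉ B, j ≤ f i)
    (hi : i ∉ insert l B) : j + 6 ≤ f i := by
  rw [Finset.mem_insert, not_or] at hi
  exact (Nat.add_le_add_right (hj l hl.notMem) 6).trans (f_add_le (hl.lt_of_notMem hi.2 hi.1))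

theorem IsLeastUnset.add_one_le_f (hl : IsLeastUnset B l) (hj : ∀ i ∉ B, j ≤ f i) (hjl : j ≠ f l)
    (hi : i ∉ B) : j + 1 ≤ f i := by
  rcases eq_or_ne i l with rfl | hil
  · exact lt_of_le_of_ne (hj i hi) hjl
  · have := hl.add_six_le_f hj (i := i) (by simp [hil, hi])
    lia

end LeastUnset

theorem counterPolicy_univ_congr {n : ℕ} [NeZero n] (P : Params n) {A W C D : Finset (Fin n)}
    (hA : ∀ i, i ∈ A) (j j' : ℕ) : counterPolicy P A W C D j = counterPolicy P A W C D j' := by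
  refine Subtype.ext (funext fun s => ?_)
  cases s with
  | b i => rw [counterPolicy_b_mem (hA i), counterPolicy_b_mem (hA i)]
  | _ => rfl

/-- The situations that occur in a run. `steady B j` satisfies the weak invariant with the set
bits `B`, all other bits but the first choosing their delay action `j`; `setting B l j` is the
policy right after the bit `l` has been set, and `carrying B l j` the one after that, in which the
new bit has been noticed by the states `w_i` and `c_i` but not yet by `d_i`. -/
inductive Config (n : ℕ) : Type
  | steady (B : Finset (Fin n)) (j : ℕ)
  | setting (B : Finset (Fin n)) (l : Fin n) (j : ℕ)
  | carrying (B : Finset (Fin n)) (l : Fin n) (j : ℕ)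

namespace Config

variable {n : ℕ} [NeZero n] {P : Params n} {B : Finset (Fin n)} {i l : Fin n} {j : ℕ}
  {C : Config n} {π' : (mdp P).Policy}

/-- The policy of a situation. -/
def policy (P : Params n) : Config n → (mdp P).Policy
  | steady B j => counterPolicy P B B B B j
  | setting B l j => counterPolicy P (insert l B) B B B j
  | carrying B l j => counterPolicy P (insert l B) (increment B l) (insert l B) B j

open Classical in
/-- The situation that follows when Greedy PI makes one iteration; the situations at which it
stops are fixed points. -/
def step (P : Params n) : Config n → Config n
  | steady B j =>
    if h : Bᶜ.Nonempty then
      if Bᶜ.min' h = 0 ∨ j = f (Bᶜ.min' h) then setting B (Bᶜ.min' h) (j + 1)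
      else steady B (j + 1)
    else steady B j
  | setting B l j => carrying B l (j + 1)
  | carrying B l j =>
    if P.Stuck then carrying B l j else steady (increment B l) (if l = 0 then j + 1 else 0)

/-- The conditions that the situations occurring in a run satisfy. -/
def Valid (P : Params n) : Config n → Prop
  | steady B j => (P.Stuck → B = ∅) ∧ ((0 : Fin n) ∉ B → j = 0) ∧ ∀ i ∉ B, j ≤ f i
  | setting B l j => IsLeastUnset B l ∧ 1 ≤ j ∧ ∀ i ∉ insert l B, j + 2 ≤ f i
  | carrying B l j => IsLeastUnset B l ∧ 1 ≤ j ∧ ∀ i ∉ insert l B, j + 1 ≤ f i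

/-- The situations in which policy iteration stops. -/
def Final (P : Params n) : Config n → Prop
  | steady B _ => ∀ i, i ∈ B
  | setting _ _ _ => False
  | carrying _ _ _ => P.Stuck

theorem step_steady (hl : IsLeastUnset B l) :
    step P (steady B j) =
      if l = 0 ∨ j = f l then setting B l (j + 1) else steady B (j + 1) := by
  have hne : Bᶜ.Nonempty := ⟨l, by simpa using hl.notMem⟩
  have hmin : Bᶜ.min' hne = l := by
    refine le_antisymm (Finset.min'_le _ _ (by simpa using hl.notMem)) (not_lt.1 fun hlt => ?_)
    simpa [hl.mem_of_lt _ hlt] using Finset.min'_mem _ hne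
  simp only [step, dif_pos hne, hmin]

theorem step_steady_of_forall_mem (h : ∀ i, i ∈ B) : step P (steady B j) = steady B j :=
  dif_neg fun ⟨i, hi⟩ => Finset.mem_compl.1 hi (h i)

theorem Valid.step_steady (h : (steady B j).Valid P) : ((steady B j).step P).Valid P := by
  have ⟨hs, _, hj⟩ := h
  by_cases hB : ∀ i, i ∈ B
  · rwa [step_steady_of_forall_mem hB]
  obtain ⟨l, hl⟩ := exists_isLeastUnset hB
  rw [Config.step_steady hl]
  split_ifs with hset
  · exact ⟨hl, Nat.le_add_left _ _, fun i hi => by have := hl.add_six_le_f hj hi; lia⟩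
  · rw [not_or] at hset
    exact ⟨hs, fun h => absurd (hl.mem_of_lt 0 (Fin.pos_iff_ne_zero.2 hset.1)) h,
      fun i hi => hl.add_one_le_f hj hset.2 hi⟩

theorem Valid.step_carrying (h : (carrying B l j).Valid P) :
    ((carrying B l j).step P).Valid P := by
  have ⟨hl, _, hj⟩ := h
  by_cases hs : P.Stuck
  · rwa [step, if_pos hs]
  rw [step, if_neg hs]
  refine ⟨fun h => absurd h hs, fun h => if_neg ?_, fun i hi => ?_⟩
  · rintro rfl
    exact h (mem_increment.2 (.inl rfl))
  · split_ifs with h0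
    · subst h0
      refine hj i fun hmem => hi (mem_increment.2 ((Finset.mem_insert.1 hmem).imp_right ?_))
      exact fun hB => ⟨hB, Fin.pos_iff_ne_zero.2 fun h => hi (mem_increment.2 (.inl h))⟩
    · exact Nat.zero_le _

theorem Valid.step (h : C.Valid P) : (C.step P).Valid P := by
  cases C with
  | steady B j => exact h.step_steady
  | setting B l j =>
    exact ⟨h.1, Nat.le_add_left _ _, fun i hi => by have := h.2.2 i hi; lia⟩
  | carrying B l j => exact h.step_carrying

theorem exists_hasTotalValue (P : Params n) (C : Config n) :
    ∃ v, (mdp P).HasTotalValue (C.policy P) v := by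
  cases C with
  | steady B j => exact exists_hasTotalValue_counterPolicy subset_rfl subset_rfl
  | setting B l j =>
    exact exists_hasTotalValue_counterPolicy (Finset.subset_insert _ _) (Finset.subset_insert _ _)
  | carrying B l j => exact exists_hasTotalValue_counterPolicy (increment_subset _ _) subset_rfl

theorem policy_step_of_greedyImproves_steady (hP : P.Admissible) (hC : (steady B j).Valid P)
    {v : State n → ℝ} (h : (mdp P).GreedyImproves v (counterPolicy P B B B B j) π') :
    π' = ((steady B j).step P).policy P := by
  obtain ⟨hs, -, hj⟩ := hC
  by_cases hB : ∀ i, i ∈ B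
  · rw [step_steady_of_forall_mem hB, steady_eq_counterPolicy h hP hs subset_rfl (hB 0)
      (fun i hi hiB => absurd hi hiB) fun i hi => absurd (hB i) hi]
    exact counterPolicy_univ_congr P hB _ _
  obtain ⟨l, hl⟩ := exists_isLeastUnset hB
  rw [step_steady hl]
  split_ifs with hset
  · refine steady_eq_counterPolicy h hP hs (Finset.subset_insert _ _) hl.zero_mem_insert
      (fun i hi hiB => ?_) fun i hi => by have := hl.add_six_le_f hj hi; lia
    rwa [(Finset.mem_insert.1 hi).resolve_right hiB]
  · rw [not_or] at hset
    exact steady_eq_counterPolicy h hP hs subset_rfl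
      (hl.mem_of_lt 0 (Fin.pos_iff_ne_zero.2 hset.1)) (fun i hi hiB => absurd hi hiB)
      fun i hi => hl.add_one_le_f hj hset.2 hi

theorem policy_step_of_greedyStep (hP : P.Admissible) (hC : C.Valid P)
    (h : (mdp P).GreedyStep (mdp P).totalReward (C.policy P) π') :
    π' = (C.step P).policy P := by
  obtain ⟨v, hv⟩ := exists_hasTotalValue P C
  have hv' := hv.greedyImproves h
  cases C with
  | steady B j => exact policy_step_of_greedyImproves_steady hP hC hv'
  | setting B l j =>
    exact setting_eq_counterPolicy hv' hC.1 hP hC.2.1 fun i hi => by have := hC.2.2 i hi; lia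
  | carrying B l j =>
    by_cases hs : P.Stuck
    · rw [step, if_pos hs]
      exact carrying_eq_self_of_stuck hv' hP hs hC.1 hC.2.1
    · rw [step, if_neg hs]
      exact carrying_eq_counterPolicy hv' hP hs hC.1 hC.2.1 hC.2.2

theorem greedyStep_totalReward_iff (hP : P.Admissible) (hC : C.Valid P) :
    (mdp P).GreedyStep (mdp P).totalReward (C.policy P) π' ↔ π' = (C.step P).policy P := by
  refine ⟨policy_step_of_greedyStep hP hC, ?_⟩
  rintro rfl
  obtain ⟨v, hv⟩ := exists_hasTotalValue P C
  obtain ⟨π'', h⟩ := MDP.exists_greedyStep (M := mdp P) hv.totalReward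
  rwa [← policy_step_of_greedyStep hP hC h]

theorem greedyStep_averageReward_iff (hP : P.Admissible) (hC : C.Valid P) :
    (mdp P).GreedyStep (mdp P).averageReward (C.policy P) π' ↔ π' = (C.step P).policy P := by
  obtain ⟨v, hv⟩ := exists_hasTotalValue P C
  rw [hv.greedyStep_averageReward_iff, greedyStep_totalReward_iff hP hC]

theorem Final.step_eq (h : C.Final P) : C.step P = C := by
  cases C with
  | steady B j => exact step_steady_of_forall_mem (P := P) h
  | setting B l j => exact h.elim
  | carrying B l j => exact if_pos h

theorem Final.mem_setBits (h : C.Final P) (i : Fin n) : i ∈ setBits (C.policy P) := by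
  cases C with
  | steady B j => rw [policy, setBits_counterPolicy]; exact h i
  | setting B l j => exact h.elim
  | carrying B l j =>
    have hil : i = l := by
      by_contra hne
      exact Params.not_stuck_of_ne hne h
    rw [policy, setBits_counterPolicy, hil]
    exact Finset.mem_insert_self _ _

theorem Valid.policy_step_steady_ne (hC : (steady B j).Valid P) (h : ¬ ∀ i, i ∈ B) :
    ((steady B j).step P).policy P ≠ (steady B j).policy P := by
  obtain ⟨l, hl⟩ := exists_isLeastUnset h
  rw [Config.step_steady hl]
  intro heq
  split_ifs at heq with hset
  · have hbits := congrArg setBits heq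
    rw [policy, policy, setBits_counterPolicy, setBits_counterPolicy, Finset.insert_eq_self]
      at hbits
    exact hl.notMem hbits
  · rw [not_or] at hset
    have hj := lt_of_le_of_ne (hC.2.2 l hl.notMem) hset.2
    have hb := congrArg (fun π => π.1 (.b l)) heq
    simp only [policy] at hb
    rw [counterPolicy_b_notMem hl.notMem hset.1 hj,
      counterPolicy_b_notMem hl.notMem hset.1 hj.le] at hb
    simp at hb

theorem Valid.policy_step_ne (hC : C.Valid P) (h : ¬ C.Final P) :
    (C.step P).policy P ≠ C.policy P := by
  cases C with
  | steady B j => exact hC.policy_step_steady_ne h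
  | setting B l j =>
    intro heq
    have hc := congrArg (fun π => π.1 (.c l)) heq
    simp [policy, Config.step, counterPolicy_c, hC.1.notMem] at hc
  | carrying B l j =>
    intro heq
    have hs : ¬ P.Stuck := h
    have hd := congrArg (fun π => π.1 (.d l)) heq
    simp [policy, Config.step, counterPolicy_d, hC.1.notMem, hs, mem_increment] at hd

end Config

end FullConstruction

/-! ### Optimality of the last policy -/

namespace FullConstruction

/-- A potential for `MDP.Compensates` that makes up for the negative values of `c_{n+1}` and
`d_{n+1}`, the only states whose value can be negative under an optimal policy. -/
def topPotential {n : ℕ} [NeZero n] (P : Params n) : State n → ℝ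
  | .sink => 0
  | .dTop => P.εd (Fin.last n)
  | _ => P.εc (Fin.last n) + 2 * P.εd (Fin.last n)

section Optimality

variable {n : ℕ} [NeZero n] {P : Params n} {π : (mdp P).Policy} {v : State n → ℝ}

theorem topPotential_nonneg_and_le (P : Params n) (s : State n) :
    0 ≤ topPotential P s ∧ topPotential P s ≤ P.εc (Fin.last n) + 2 * P.εd (Fin.last n) := by
  have hc := P.εc_pos (Fin.last n)
  have hd := P.εd_pos (Fin.last n)
  unfold topPotential
  split <;> constructor <;> linarith

theorem expectation_topPotential_le {s : State n} {a : Action n} (ha : a ∈ avail s) :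
    (mdp P).expectation (topPotential P) s a ≤ P.εc (Fin.last n) + 2 * P.εd (Fin.last n) := by
  refine ((mdp P).expectation_le ha fun s' => (topPotential_nonneg_and_le P s').2).trans_eq ?_
  rw [MDP.expectation, ← Finset.sum_mul, (mdp P).p_sum s a ha, one_mul]

theorem Evaluates.w_nonneg (hE : Evaluates P π v) (hv : (mdp P).BellmanSuperharmonic v)
    (k : Fin (n + 1)) : 0 ≤ v (.w k) := by
  simpa only [totalAppeal_w_toSink, hE.sink] using hv (.w k) .toSink (avail_w.2 (.inl rfl))

theorem Evaluates.c_nonneg (hE : Evaluates P π v) (hv : (mdp P).BellmanSuperharmonic v)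
    (i : Fin n) : 0 ≤ v (.c i) :=
  (hE.w_nonneg hv _).trans
    (totalAppeal_c_zero P v i ▸ hv (.c i) .zero ((avail_c i).2 (.inl rfl)))

theorem Evaluates.d_nonneg (hE : Evaluates P π v) (hv : (mdp P).BellmanSuperharmonic v)
    (i : Fin n) : 0 ≤ v (.d i) :=
  (hE.w_nonneg hv _).trans
    (totalAppeal_d_zero P v i ▸ hv (.d i) .zero ((avail_d i).2 (.inl rfl)))

theorem Evaluates.b_nonneg (hE : Evaluates P π v) (hv : (mdp P).BellmanSuperharmonic v)
    (i : Fin n) : 0 ≤ v (.b i) := by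
  rcases eq_or_ne i 0 with rfl | hi
  · exact (hE.w_nonneg hv _).trans
      (totalAppeal_b_zero P v 0 ▸ hv (.b 0) .zero (avail_b_first.2 (.inl rfl)))
  · exact (hE.w_nonneg hv _).trans
      (totalAppeal_b_delay_zero P v i ▸
        hv (.b i) (.delay 0) ((avail_b hi).2 (.inr ⟨0, Nat.zero_le _, rfl⟩)))

theorem Evaluates.neg_εmax_le_dAt (hE : Evaluates P π v) (hv : (mdp P).BellmanSuperharmonic v)
    (k : Fin (n + 1)) : -P.εmax ≤ v (dAt k) := by
  cases k using Fin.lastCases with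
  | last =>
    rw [dAt_last, hE.dTop]
    exact neg_le_neg (P.εd_le _)
  | cast i =>
    rw [dAt_castSucc]
    exact (neg_nonpos.2 P.εmax_pos.le).trans (hE.d_nonneg hv i)

theorem Evaluates.c_le_bPlus (hE : Evaluates P π v) (hg : P.Gaps)
    (hv : (mdp P).BellmanSuperharmonic v) (i : {i : Fin n // i ≠ 0}) :
    P.c i ≤ v (.bPlus i) := by
  rw [hE.bPlus]
  linarith [hg.lt_sub i.1, hE.neg_εmax_le_dAt hv i.1.succ, hg.rewardBelow_nonneg i.1.castSucc,
    hg.δmax_nonneg, P.εmax_le_mul, P.εmax_pos]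

theorem bPlus_le_b (hv : (mdp P).BellmanSuperharmonic v) (i : {i : Fin n // i ≠ 0}) :
    v (.bPlus i) ≤ v (.b i) := by
  have hone := hv (.b i) .one ((avail_b i.2).2 (.inl rfl))
  rw [totalAppeal_b_one P v i.1 i.2] at hone
  refine le_of_mul_le_mul_left ?_ (P.α_pos i)
  linarith

theorem Evaluates.nonneg (hE : Evaluates P π v) (hg : P.Gaps)
    (hv : (mdp P).BellmanSuperharmonic v) {s : State n} (hc : s ≠ .cTop) (hd : s ≠ .dTop) :
    0 ≤ v s := by
  cases s with
  | sink => exact hE.sink.ge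
  | w k => exact hE.w_nonneg hv k
  | b i => exact hE.b_nonneg hv i
  | c i => exact hE.c_nonneg hv i
  | d i => exact hE.d_nonneg hv i
  | cTop => exact absurd rfl hc
  | dTop => exact absurd rfl hd
  | bPlus i => exact (hg.c_nonneg i).trans (hE.c_le_bPlus hg hv i)
  | bMinus i =>
    rw [hE.bellman, eq_only rfl, totalAppeal_bMinus]
    linarith [hE.c_le_bPlus hg hv i, bPlus_le_b hv i]

theorem Evaluates.compensates_topPotential (hE : Evaluates P π v) (hg : P.Gaps)
    (hv : (mdp P).BellmanSuperharmonic v) : (mdp P).Compensates (topPotential P) v where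
  nonneg s := (topPotential_nonneg_and_le P s).1
  expectation_le s a ha := by
    have hεc := P.εc_pos (Fin.last n)
    have hεd := P.εd_pos (Fin.last n)
    have hgoto : ∀ t, trans P s a = goto t →
        (mdp P).expectation (topPotential P) s a = topPotential P t := fun t ht => by
      rw [MDP.expectation, ← sum_goto t (topPotential P)]
      exact Finset.sum_congr rfl fun s' _ => congrArg (· s' * topPotential P s') ht
    cases s with
    | sink => simp [hgoto .sink rfl, hE.sink]
    | dTop =>
      obtain rfl : a = .only := Finset.mem_singleton.1 ha
      rw [hgoto .sink rfl, hE.dTop, min_eq_left (by linarith)]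
      simp [topPotential]
    | cTop =>
      obtain rfl : a = .only := Finset.mem_singleton.1 ha
      rw [hgoto .dTop rfl, hE.cTop, min_eq_left (by linarith)]
      simp only [topPotential]
      linarith
    | _ =>
      rw [min_eq_right (hE.nonneg hg hv (by simp) (by simp)), add_zero]
      exact expectation_topPotential_le ha

end Optimality

namespace Config

variable {n : ℕ} [NeZero n] {P : Params n} {C : Config n}

theorem Final.exists_bellmanSuperharmonic (h : C.Final P) (hP : P.Admissible)
    (hC : C.Valid P) : ∃ v, (mdp P).HasTotalValue (C.policy P) v ∧
      (mdp P).BellmanSuperharmonic v := by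
  obtain ⟨v, hv⟩ := exists_hasTotalValue P C
  have hself := (greedyStep_totalReward_iff hP hC).2 (congrArg (policy P) h.step_eq.symm)
  refine ⟨v, hv, fun s => MDP.not_switchable_iff.1 fun hs => ?_⟩
  have hmax := (hv.greedyStep_totalReward_iff.1 hself s).1 hs
  obtain ⟨a, ha, hlt⟩ := hs
  exact (hmax a ha).not_gt (hv.bellman s ▸ hlt)

theorem Final.isTerminalOptimal_totalReward (h : C.Final P) (hP : P.Admissible)
    (hC : C.Valid P) : (mdp P).IsTerminalOptimal (mdp P).totalReward (C.policy P) := by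
  obtain ⟨v, hv, hsup⟩ := h.exists_bellmanSuperharmonic hP hC
  exact hv.isTerminalOptimal_totalReward hsup
    ((evaluates_of_hasTotalValue hv).compensates_topPotential hP.gaps hsup)

theorem Final.isTerminalOptimal_averageReward (h : C.Final P) (hP : P.Admissible)
    (hC : C.Valid P) : (mdp P).IsTerminalOptimal (mdp P).averageReward (C.policy P) := by
  obtain ⟨v, hv, hsup⟩ := h.exists_bellmanSuperharmonic hP hC
  exact hv.isTerminalOptimal_averageReward hsup
    ((evaluates_of_hasTotalValue hv).compensates_topPotential hP.gaps hsup)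

end Config

end FullConstruction

/-! ### Counting in binary -/

namespace FullConstruction

theorem testBit_succ_iff {l k : ℕ} (hlow : ∀ i < l, k.testBit i = true)
    (hk : k.testBit l = false) (i : ℕ) :
    (k + 1).testBit i = true ↔ i = l ∨ k.testBit i = true ∧ l < i := by
  induction l generalizing k i with
  | zero =>
    have hk' : k % 2 = 0 := by simpa [Nat.testBit_zero] using hk
    cases i with
    | zero => simp [Nat.testBit_zero, Nat.succ_mod_two_eq_one_iff.2 hk']
    | succ i => simp [Nat.testBit_add_one, show (k + 1) / 2 = k / 2 by lia]
  | succ l ih =>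
    have h0 : k % 2 = 1 := by simpa [Nat.testBit_zero] using hlow 0 l.succ_pos
    cases i with
    | zero => simp [Nat.testBit_zero, Nat.succ_mod_two_eq_zero_iff.2 h0]
    | succ i =>
      rw [Nat.testBit_add_one] at hk
      rw [Nat.testBit_add_one, Nat.testBit_add_one, show (k + 1) / 2 = k / 2 + 1 by lia,
        ih (fun i hi => Nat.testBit_add_one k i ▸ hlow _ (Nat.succ_lt_succ hi)) hk]
      simp

/-- The bits of `k`. -/
def bits (n k : ℕ) : Finset (Fin n) := Finset.univ.filter fun i => k.testBit i.val = true

section Bits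

variable {n k : ℕ}

theorem mem_bits {i : Fin n} : i ∈ bits n k ↔ k.testBit i.val = true := by
  simp [bits]

theorem bits_zero : bits n 0 = ∅ := by
  simp [bits]

theorem mem_bits_last (i : Fin n) : i ∈ bits n (2 ^ n - 1) := by
  simp [mem_bits, Nat.testBit_two_pow_sub_one]

theorem zero_mem_bits [NeZero n] : (0 : Fin n) ∈ bits n k ↔ k % 2 = 1 := by
  simp [mem_bits, Nat.testBit_zero]

theorem bits_succ {l : Fin n} (hl : IsLeastUnset (bits n k) l) :
    bits n (k + 1) = increment (bits n k) l := by
  have hlow : ∀ m < l.val, k.testBit m = true := fun m hm =>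
    mem_bits.1 (hl.mem_of_lt ⟨m, hm.trans l.2⟩ hm)
  have hbit : k.testBit l.val = false := by simpa [mem_bits] using hl.notMem
  ext i
  rw [mem_bits, testBit_succ_iff hlow hbit, mem_increment, mem_bits, Fin.ext_iff, Fin.lt_def]

theorem exists_isLeastUnset_bits (hk : k + 1 < 2 ^ n) : ∃ l, IsLeastUnset (bits n k) l := by
  refine exists_isLeastUnset fun hall => ?_
  have hmax : k = 2 ^ n - 1 := by
    refine Nat.eq_of_testBit_eq fun i => ?_
    rw [Nat.testBit_two_pow_sub_one]
    by_cases hi : i < n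
    · simpa [hi] using mem_bits.1 (hall ⟨i, hi⟩)
    · rw [decide_eq_false hi]
      exact Nat.testBit_lt_two_pow ((Nat.lt_of_succ_lt hk).trans_le
        (Nat.pow_le_pow_right two_pos (not_lt.1 hi)))
  lia

end Bits

theorem exists_times_of_iterate_eq {α : Type*} {step : α → α} {x : ℕ → α} {p : α → Prop} {N : ℕ}
    (h : ∀ k < N, ∃ t, step^[t + 3] (x k) = x (k + 1) ∧ p (step^[t + 2] (x k))) :
    ∃ τ : ℕ → ℕ, StrictMono τ ∧ τ 0 = 0 ∧ (∀ k, 3 * k ≤ τ k) ∧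
      (∀ k ≤ N, step^[τ k] (x 0) = x k) ∧ ∀ k < N, p (step^[τ (k + 1) - 1] (x 0)) := by
  choose! t hx hp using h
  have hsucc : ∀ k, ∑ i ∈ Finset.range (k + 1), (t i + 3) =
      ∑ i ∈ Finset.range k, (t i + 3) + (t k + 3) := fun k => Finset.sum_range_succ _ _
  have hreach : ∀ k ≤ N, step^[∑ i ∈ Finset.range k, (t i + 3)] (x 0) = x k := by
    intro k hk
    induction k with
    | zero => rfl
    | succ k ih =>
      rw [hsucc, add_comm, Function.iterate_add_apply, ih (Nat.le_of_succ_le hk), hx k hk]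
  refine ⟨fun k => ∑ i ∈ Finset.range k, (t i + 3),
    strictMono_nat_of_lt_succ fun k => by rw [hsucc]; lia, rfl, fun k => ?_, hreach,
    fun k hk => ?_⟩
  · induction k with
    | zero => exact Nat.zero_le _
    | succ k ih => dsimp only at ih ⊢; rw [hsucc]; lia
  · have hpred : ∑ i ∈ Finset.range (k + 1), (t i + 3) - 1 =
        t k + 2 + ∑ i ∈ Finset.range k, (t i + 3) := by rw [hsucc]; lia
    rw [hpred, Function.iterate_add_apply, hreach k hk.le]
    exact hp k hk

namespace Config

variable {n : ℕ} [NeZero n] {P : Params n} {B : Finset (Fin n)} {l : Fin n} {j k : ℕ}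
  {C : Config n}

theorem Valid.iterate (h : C.Valid P) (t : ℕ) : ((Config.step P)^[t] C).Valid P := by
  induction t with
  | zero => exact h
  | succ t ih => rw [Function.iterate_succ_apply']; exact ih.step

theorem not_final_iterate_of_le {s t : ℕ} (h : ¬ ((step P)^[s] C).Final P) (hts : t ≤ s) :
    ¬ ((step P)^[t] C).Final P := fun hF => by
  rw [← Nat.sub_add_cancel hts, Function.iterate_add_apply,
    Function.iterate_fixed hF.step_eq] at h
  exact h hF

theorem iterate_step_steady (hl : IsLeastUnset B l) (h0 : l ≠ 0) {t : ℕ} (hj : j + t ≤ f l) :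
    (step P)^[t] (steady B j) = steady B (j + t) := by
  induction t with
  | zero => rfl
  | succ t ih =>
    rw [Function.iterate_succ_apply', ih (by lia), step_steady hl, if_neg (by lia), add_assoc]

theorem exists_iterate_eq_carrying (hl : IsLeastUnset B l) (hj : j ≤ f l) :
    ∃ t, (step P)^[t + 2] (steady B j) = carrying B l (if l = 0 then j + 2 else f l + 2) := by
  by_cases h0 : l = 0
  · refine ⟨0, ?_⟩
    rw [Function.iterate_succ_apply', Function.iterate_one, step_steady hl,
      if_pos (.inl h0), if_pos h0]
    rfl
  · refine ⟨f l - j, ?_⟩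
    rw [Function.iterate_succ_apply', Function.iterate_succ_apply',
      iterate_step_steady hl h0 (by lia), step_steady hl, if_pos (.inr (by lia)), if_neg h0,
      Nat.add_sub_cancel' hj]
    rfl

/-- The situation in which the counter shows `k` and all `w_i`, `c_i`, `d_i` have adapted. If `k` is
even, the increment has just reset all delay actions; if `k` is odd, the three iterations that set
the first bit have advanced them from `0` to `3`. -/
def count (n k : ℕ) : Config n := steady (bits n k) (if k % 2 = 0 then 0 else 3)

theorem valid_count_zero : (count n 0).Valid P :=
  ⟨fun _ => bits_zero, fun _ => rfl, fun _ _ => Nat.zero_le _⟩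

theorem policy_count_zero : (count n 0).policy P = zeroPolicy P := by
  have hB : ∀ i : Fin n, i ∉ bits n 0 := by simp [bits_zero]
  refine (eq_counterPolicy (fun k => ?_) (fun i hi => absurd hi (hB i)) (fun _ => ?_)
    (fun i _ h0 => ⟨Nat.zero_le _, ?_⟩) (fun i => ?_) fun i => ?_).symm
  · exact (target_eq_toSink_iff.2 fun m hm => absurd hm (hB m)).symm
  · simp [zeroPolicy, zeroAction]
  · simp [zeroPolicy, zeroAction, h0]
  · exact (if_neg (hB i)).symm
  · exact (if_neg (hB i)).symm

theorem mem_setBits_count {i : Fin n} :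
    i ∈ setBits ((count n k).policy P) ↔ k.testBit i.val = true := by
  rw [count, policy, setBits_counterPolicy, mem_bits]

theorem final_count_last : (count n (2 ^ n - 1)).Final P := mem_bits_last

theorem exists_iterate_count (hs : ¬ P.Stuck) (hk : k + 1 < 2 ^ n) :
    ∃ t, (step P)^[t + 3] (count n k) = count n (k + 1) ∧
      ¬ ((step P)^[t + 2] (count n k)).Final P := by
  obtain ⟨l, hl⟩ := exists_isLeastUnset_bits hk
  have hzero : l = 0 ↔ k % 2 = 0 := by
    have hmem : l = 0 ↔ (0 : Fin n) ∉ bits n k :=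
      ⟨fun h => h ▸ hl.notMem, fun h => by
        by_contra h0
        exact h (hl.mem_of_lt 0 (Fin.pos_iff_ne_zero.2 h0))⟩
    rw [hmem, zero_mem_bits, Nat.mod_two_not_eq_one]
  have hj : (if k % 2 = 0 then 0 else 3) ≤ f l := by
    unfold f
    split_ifs <;> lia
  obtain ⟨t, ht⟩ := exists_iterate_eq_carrying (P := P) hl hj
  refine ⟨t, ?_, by rw [count, ht]; exact hs⟩
  rw [Function.iterate_succ_apply', count, ht, step, if_neg hs, count, bits_succ hl]
  congr 1
  simp only [hzero]
  split_ifs <;> lia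

/-- `τ k` is a time at which the counter shows `k`, for a run that starts at `count n 0` and
stops at the time `τ (2 ^ n - 1)`. -/
structure CountingTimes (P : Params n) (τ : ℕ → ℕ) : Prop where
  strictMonoOn : StrictMonoOn τ (Set.Iio (2 ^ n))
  zero : τ 0 = 0
  le_last : 2 ^ n ≤ τ (2 ^ n - 1)
  final : ((step P)^[τ (2 ^ n - 1)] (count n 0)).Final P
  not_final : ∀ t < τ (2 ^ n - 1), ¬ ((step P)^[t] (count n 0)).Final P
  mem_setBits : ∀ k < 2 ^ n, ∀ i : Fin n,
    i ∈ setBits (((step P)^[τ k] (count n 0)).policy P) ↔ k.testBit i.val = true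

theorem countingTimes_of_stuck (hs : P.Stuck) : CountingTimes P (2 * ·) := by
  have hpow : 2 ^ n = 2 := by rw [hs.1, pow_one]
  have hl : IsLeastUnset (bits n 0) 0 :=
    ⟨by simp [bits_zero], fun i hi => absurd hi (Fin.not_lt_zero i)⟩
  have hone : (step P)^[1] (count n 0) = setting (bits n 0) 0 1 := by
    rw [Function.iterate_one, count, step_steady hl, if_pos (.inl rfl)]
    rfl
  have htwo : (step P)^[2] (count n 0) = carrying (bits n 0) 0 2 := by
    rw [Function.iterate_succ_apply', hone]
    rfl
  refine ⟨fun a _ b _ hab => by lia, rfl, by lia, ?_, fun t ht => ?_, ?_⟩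
  · rw [hpow, htwo]
    exact hs
  · refine not_final_iterate_of_le (s := 1) ?_ (by lia)
    rw [hone]
    exact id
  · intro k hk i
    rcases (by lia : k = 0 ∨ k = 1) with rfl | rfl
    · exact mem_setBits_count
    · have hi : i.val = 0 := by have := hs.1; lia
      have hF : ((step P)^[2] (count n 0)).Final P := by rw [htwo]; exact hs
      exact iff_of_true (hF.mem_setBits i) (by rw [hi]; rfl)

theorem exists_countingTimes (P : Params n) : ∃ τ, CountingTimes P τ := by
  by_cases hs : P.Stuck
  · exact ⟨_, countingTimes_of_stuck hs⟩
  have hpow : 2 ≤ 2 ^ n := Nat.le_self_pow (NeZero.ne n) 2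
  obtain ⟨τ, hmono, hzero, hle, hcount, hbefore⟩ := exists_times_of_iterate_eq
    (x := count n) (p := fun C : Config n => ¬ C.Final P) (N := 2 ^ n - 1)
    fun k hk => exists_iterate_count hs (by lia)
  refine ⟨τ, hmono.strictMonoOn _, hzero, ?_, ?_, fun t ht => ?_, fun k hk i => ?_⟩
  · have := hle (2 ^ n - 1)
    lia
  · rw [hcount _ le_rfl]
    exact final_count_last
  · have hlast := hbefore (2 ^ n - 2) (by lia)
    rw [show 2 ^ n - 2 + 1 = 2 ^ n - 1 by lia] at hlast
    exact not_final_iterate_of_le hlast (by lia)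
  · rw [hcount k (by lia)]
    exact mem_setBits_count

section CountsInBinary

variable {L : Type} [LinearOrder L] {crit : (mdp P).Criterion L}
  (hstep : ∀ C : Config n, C.Valid P → ∀ π',
    (mdp P).GreedyStep crit (C.policy P) π' ↔ π' = (C.step P).policy P)
include hstep

theorem Valid.not_isTerminal (hC : C.Valid P) (h : ¬ C.Final P) :
    ¬ (mdp P).IsTerminal crit (C.policy P) := by
  rintro ⟨val, appeal, hcrit, hs⟩
  exact hC.policy_step_ne h
    ((hstep C hC _).1 (MDP.GreedyStep.of_not_switchable hcrit hs)).symm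

theorem isGreedyRun_iff {ρ : ℕ → (mdp P).Policy} :
    (mdp P).IsGreedyRun crit (zeroPolicy P) ρ ↔
      ρ = fun t => ((step P)^[t] (count n 0)).policy P := by
  constructor
  · rintro ⟨hzero, hsucc⟩
    funext t
    induction t with
    | zero => rw [hzero, ← policy_count_zero]; rfl
    | succ t ih =>
      rw [Function.iterate_succ_apply', ← hstep _ (Valid.iterate valid_count_zero t), ← ih]
      exact hsucc t
  · rintro rfl
    refine ⟨policy_count_zero, fun t => (hstep _ (Valid.iterate valid_count_zero t) _).2 ?_⟩
    exact congrArg (policy P) (Function.iterate_succ_apply' _ _ _)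

theorem countsInBinary (hd : MDP.AppealDetermined crit)
    (hopt : ∀ C : Config n, C.Valid P → C.Final P →
      (mdp P).IsTerminalOptimal crit (C.policy P)) :
    CountsInBinary P crit := by
  refine ⟨⟨_, (isGreedyRun_iff hstep).2 rfl⟩, fun ρ hρ => ?_⟩
  obtain rfl := (isGreedyRun_iff hstep).1 hρ
  obtain ⟨τ, hτ⟩ := exists_countingTimes P
  have hvalid : ∀ t, ((step P)^[t] (count n 0)).Valid P := Valid.iterate valid_count_zero
  have hlast := hopt _ (hvalid _) hτ.final
  have hearlier : ∀ t < τ (2 ^ n - 1), ¬ (mdp P).IsTerminal crit _ := fun t ht =>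
    (hvalid t).not_isTerminal hstep (hτ.not_final t ht)
  have ⟨val, appeal, hcrit, hswitch, hdom⟩ := hlast
  exact ⟨τ (2 ^ n - 1), hτ.le_last, ⟨val, appeal, hcrit, hdom⟩, ⟨val, appeal, hcrit, hswitch⟩,
    fun t ht => ⟨fun ho => hearlier t ht (hlast.isTerminal_of_isOptimal hd ho), hearlier t ht⟩,
    τ, hτ.strictMonoOn, hτ.zero, rfl, hτ.mem_setBits⟩

end CountsInBinary

end Config

section CountsInBinary

variable {n : ℕ} [NeZero n] {P : Params n}

theorem countsInBinary_totalReward (hP : P.Admissible) :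
    CountsInBinary P (mdp P).totalReward :=
  Config.countsInBinary (fun _ hC _ => Config.greedyStep_totalReward_iff hP hC)
    MDP.appealDetermined_totalReward fun _ hC hF => hF.isTerminalOptimal_totalReward hP hC

theorem countsInBinary_averageReward (hP : P.Admissible) :
    CountsInBinary P (mdp P).averageReward :=
  Config.countsInBinary (fun _ hC _ => Config.greedyStep_averageReward_iff hP hC)
    MDP.appealDetermined_averageReward fun _ hC hF => hF.isTerminalOptimal_averageReward hP hC

end CountsInBinary

end FullConstruction

/-! ### The standard parameters -/

namespace FullConstruction

section Profit

variable {n : ℕ} [NeZero n] {P : Params n} {B : Finset (Fin n)} {i : Fin n}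

/-- The profit of passing through the bits of `B` from level `k` on, apart from the small costs. -/
def Params.profitFrom (P : Params n) (B : Finset (Fin n)) (k : Fin (n + 1)) : ℝ :=
  ∑ i ∈ B with k ≤ i.castSucc, (P.r i - P.c i)

theorem profitFrom_last : P.profitFrom B (Fin.last n) = 0 :=
  Finset.sum_eq_zero fun i hi => absurd (Finset.mem_filter.1 hi).2 i.castSucc_lt_last.not_ge

theorem profitFrom_succ : P.profitFrom B i.succ = ∑ m ∈ B with i < m, (P.r m - P.c m) := by
  simp only [Params.profitFrom, Fin.succ_le_castSucc_iff]

theorem profitFrom_castSucc_of_mem (hi : i ∈ B) :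
    P.profitFrom B i.castSucc = P.r i - P.c i + P.profitFrom B i.succ := by
  have hfilter : (B.filter fun m => i ≤ m) = insert i (B.filter fun m => i < m) := by
    ext m
    simp only [Finset.mem_filter, Finset.mem_insert, le_iff_eq_or_lt]
    grind
  simp only [Params.profitFrom, Fin.castSucc_le_castSucc_iff, Fin.succ_le_castSucc_iff]
  rw [hfilter, Finset.sum_insert (by simp)]

theorem profitFrom_castSucc_of_notMem (hi : i ∉ B) :
    P.profitFrom B i.castSucc = P.profitFrom B i.succ := by
  simp only [Params.profitFrom, Fin.castSucc_le_castSucc_iff, Fin.succ_le_castSucc_iff]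
  exact congrArg (Finset.sum · _) (Finset.filter_congr fun m hm =>
    ⟨fun h => h.lt_of_ne fun him => hi (him ▸ hm), le_of_lt⟩)

end Profit

variable {n : ℕ} [NeZero n] {P : Params n} {π : (mdp P).Policy} {v : State n → ℝ} {i : Fin n}
  {j : ℕ}

namespace Ladder

variable {B : Finset (Fin n)} {w d : Fin (n + 1) → ℝ}

theorem w_le_profitFrom (h : Ladder P B 0 w d) (k : Fin (n + 1)) : w k ≤ P.profitFrom B k := by
  induction k using Fin.reverseInduction with
  | last => rw [h.w_last, profitFrom_last]
  | cast i ih =>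
    by_cases hi : i ∈ B
    · rw [h.w_mem i hi (Fin.zero_le _), profitFrom_castSucc_of_mem hi]
      linarith [h.d_le_w (Fin.zero_le i.succ)]
    · rwa [h.w_notMem i hi (Fin.zero_le _), profitFrom_castSucc_of_notMem hi]

theorem profitFrom_sub_le_w (h : Ladder P B 0 w d) (k : Fin (n + 1)) :
    P.profitFrom B k - 2 * ((n : ℝ) - k.val) * P.εmax ≤ w k := by
  induction k using Fin.reverseInduction with
  | last => simp [h.w_last, profitFrom_last]
  | cast i ih =>
    rw [Fin.val_succ, Nat.cast_succ] at ih
    rw [Fin.val_castSucc]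
    by_cases hi : i ∈ B
    · rw [h.w_mem i hi (Fin.zero_le _), profitFrom_castSucc_of_mem hi]
      linarith [h.w_le_d (Fin.zero_le i.succ)]
    · rw [h.w_notMem i hi (Fin.zero_le _), profitFrom_castSucc_of_notMem hi]
      linarith [P.εmax_pos]

end Ladder

theorem Params.Gaps.firstBitBound (hg : P.Gaps) : P.FirstBitBound := by
  intro π v hπ hv
  have hE := evaluates_of_hasTotalValue hv
  have hL := hE.ladder_of_weakInvariant hπ
  have hw := hL.w_le_profitFrom (Fin.succ 0)
  simp only [profitFrom_succ, Fin.pos_iff_ne_zero] at hw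
  by_cases h0 : π.1 (.b 0) = .one
  · rw [hE.b_one h0]
    linarith [hL.d_le_w (Fin.zero_le (Fin.succ 0))]
  · rw [hE.b_zero (policy_b_first_eq_zero h0)]
    linarith [hg.r_pos 0]

theorem Params.setBitBounds (P : Params n) : P.SetBitBounds := by
  intro π v hπ hv i hi
  have hE := evaluates_of_hasTotalValue hv
  have hL := hE.ladder_of_weakInvariant hπ
  have hlower := hL.profitFrom_sub_le_w i.succ
  have hupper := hL.w_le_profitFrom i.succ
  rw [profitFrom_succ] at hlower hupper
  rw [Fin.val_succ, Nat.cast_succ] at hlower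
  rw [hE.b_one (mem_setBits.1 hi)]
  exact ⟨by linarith [hL.w_le_d (Fin.zero_le i.succ)],
    by linarith [hL.d_le_w (Fin.zero_le i.succ)]⟩

theorem Evaluates.d_le_b_first (hE : Evaluates P π v) (hπ : WeakInvariant π) (hg : P.Gaps)
    (i : Fin n) : v (dAt i.succ) ≤ v (.b 0) := by
  have hL := hE.ladder_of_weakInvariant hπ
  rw [hE.b_first_of_weakInvariant hπ]
  exact (hL.d_le_w (Fin.zero_le _)).trans (hL.w_antitone hg le_rfl (Fin.zero_le _))

theorem le_f_of_delay (hi : i ≠ 0) (hj : π.1 (.b i) = .delay j) : j ≤ f i := by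
  have hmem : Action.delay j ∈ avail (State.b i) := hj ▸ π.2 (.b i)
  simpa [avail_b hi] using hmem

theorem Evaluates.b_lt_of_delay (hE : Evaluates P π v) (hπ : WeakInvariant π) (hg : P.Gaps)
    (hi : i ≠ 0) (hj : π.1 (.b i) = .delay j) : v (.b i) < P.r i + v (dAt i.succ) := by
  have hL := hE.ladder_of_weakInvariant hπ
  have hfirst := hE.b_first_of_weakInvariant hπ
  have hunset : i ∉ setBits π := by simp [mem_setBits, hj]
  have hmono := hL.w_add_rewardBelow_mono hg le_rfl (Fin.zero_le i.castSucc)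
  linarith [hE.b_le hg hi (le_f_of_delay hi hj) (.inr hfirst.symm) hj,
    hL.w_notMem i hunset (Fin.zero_le _), hL.w_succ_lt_enter hg (Fin.zero_le i.succ),
    hg.rewardBelow_nonneg 0, hg.c_nonneg i, P.εmax_pos]

theorem Evaluates.b_lt_totalAppeal_b_one (hE : Evaluates P π v) (hπ : WeakInvariant π)
    (hg : P.Gaps) (hi : i ≠ 0) (hj : π.1 (.b i) = .delay j) :
    v (.b i) < (mdp P).totalAppeal v (.b i) .one := by
  rw [totalAppeal_b_one P v i hi, hE.bPlus]
  linarith [mul_lt_mul_of_pos_left (hE.b_lt_of_delay hπ hg hi hj) (P.α_pos i)]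

namespace Params

omit [NeZero n] in
theorem f_le_mul (i : Fin n) : f i ≤ 9 * n := by
  unfold f
  lia

theorem mul_half_pow_le : (n : ℝ) * (1 / 2) ^ (100 * n) ≤ (1 / 2) ^ 99 := by
  have hn : (n : ℝ) ≤ 2 ^ n := by exact_mod_cast Nat.lt_two_pow_self.le
  calc (n : ℝ) * (1 / 2) ^ (100 * n)
      ≤ 2 ^ n * (1 / 2) ^ (100 * n) := by gcongr
    _ = (1 / 2) ^ (99 * n) := by
      rw [show 100 * n = n + 99 * n by ring, pow_add, ← mul_assoc, ← mul_pow]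
      norm_num
    _ ≤ (1 / 2) ^ 99 :=
      pow_le_pow_of_le_one (by norm_num) (by norm_num)
        (Nat.le_mul_of_pos_right _ (Nat.pos_of_neZero n))

theorem standard_εmax_le : (standard n).εmax ≤ (1 / 2) ^ (100 * n) :=
  Finset.sup'_le _ _ fun _ _ => max_le le_rfl le_rfl

theorem standard_δmax_nonneg : 0 ≤ (standard n).δmax :=
  Real.sSup_nonneg fun _ ⟨_, _, _, _, _, hx⟩ => hx ▸ by simp only [standard]; positivity

theorem standard_δmax_le : (standard n).δmax ≤ 27 * (n * (1 / 2) ^ (100 * n)) := by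
  refine Real.sSup_le ?_ (by positivity)
  rintro x ⟨i, -, j, -, hj, rfl⟩
  have hjn : (j : ℝ) ≤ 9 * n := by exact_mod_cast hj.trans (f_le_mul i)
  calc 3 * (j : ℝ) * (1 / 2) ^ (100 * n) ≤ 3 * (9 * n) * (1 / 2) ^ (100 * n) := by gcongr
    _ = 27 * (n * (1 / 2) ^ (100 * n)) := by ring

theorem standard_smallCosts_lt_one : 2 * n * (standard n).εmax + (standard n).δmax < 1 := by
  have hε := mul_le_mul_of_nonneg_left (standard_εmax_le (n := n))
    (by positivity : (0 : ℝ) ≤ 2 * n)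
  have hpow : 29 * ((1 : ℝ) / 2) ^ 99 < 1 := by norm_num
  linarith [standard_δmax_le (n := n), mul_half_pow_le (n := n), hpow]

theorem standard_r (i : Fin n) : (standard n).r i = 8 * 4 ^ i.val := by
  change (2 : ℝ) ^ (2 * (i.val + 1) + 1) = _
  rw [pow_succ, pow_mul, pow_succ]
  norm_num
  ring

theorem standard_c (hi : i ≠ 0) : (standard n).c i = 4 * 4 ^ i.val := by
  change (if i = 0 then (0 : ℝ) else 2 ^ (2 * (i.val + 1))) = _
  rw [if_neg hi, pow_mul, pow_succ]
  norm_num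
  ring

theorem standard_c_le (i : Fin n) : (standard n).c i ≤ 4 * 4 ^ i.val := by
  by_cases hi : i = 0
  · rw [hi, (standard n).c_first]
    positivity
  · exact (standard_c hi).le

theorem standard_rewardBelow (k : Fin (n + 1)) :
    (standard n).rewardBelow k = 8 / 3 * (4 ^ k.val - 1) := by
  induction k using Fin.induction with
  | zero => simp [rewardBelow]
  | succ i ih =>
    rw [rewardBelow_succ, ih, standard_r, Fin.val_succ, Fin.val_castSucc, pow_succ]
    ring

theorem standard_gaps : (standard n).Gaps := by
  have hsmall := standard_smallCosts_lt_one (n := n)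
  have hpow : ∀ i : Fin n, (1 : ℝ) ≤ 4 ^ i.val := fun _ => one_le_pow₀ (by norm_num)
  refine ⟨fun i => ?_, fun i hi => ?_, standard_δmax_nonneg⟩
  · rw [← rewardBelow_castSucc, standard_rewardBelow, standard_r, Fin.val_castSucc]
    linarith [hpow i, standard_c_le i]
  · rw [← rewardBelow_castSucc, standard_rewardBelow, standard_c hi, Fin.val_castSucc]
    linarith [hpow i]

theorem standard_α_mul_r_lt (hj : j ≤ f i) :
    (standard n).α i * (standard n).r i <
      (1 / 2) ^ (2 * (j + 1)) * (3 * (1 / 2) ^ (100 * n)) := by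
  have hn := Nat.pos_of_neZero n
  have hjn := hj.trans (f_le_mul i)
  calc (standard n).α i * (standard n).r i
      = (1 / 2) ^ (1000 * n) * 2 ^ (2 * (i.val + 1) + 1) := rfl
    _ ≤ (1 / 2) ^ (1000 * n) * 2 ^ (3 * n) := by
      gcongr
      · norm_num
      · lia
    _ = (1 / 2) ^ (997 * n) := by
      rw [show 1000 * n = 997 * n + 3 * n by ring, pow_add, mul_assoc, ← mul_pow]
      norm_num
    _ < (1 / 2) ^ (2 * (j + 1) + 100 * n) :=
      pow_lt_pow_right_of_lt_one₀ (by norm_num) (by norm_num) (by lia)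
    _ = (1 / 2) ^ (2 * (j + 1)) * (1 * (1 / 2) ^ (100 * n)) := by rw [pow_add, one_mul]
    _ ≤ (1 / 2) ^ (2 * (j + 1)) * (3 * (1 / 2) ^ (100 * n)) := by
      gcongr
      norm_num

theorem half_pow_mul_sub_lt {j j' : ℕ} (hne : j' ≠ j + 1) :
    (1 / 2 : ℝ) ^ (2 * j') * (j' - j) < (1 / 2) ^ (2 * (j + 1)) := by
  rcases le_or_gt j' j with hle | hlt
  · have hle' : (j' : ℝ) ≤ j := by exact_mod_cast hle
    exact (mul_nonpos_of_nonneg_of_nonpos (by positivity) (by linarith)).trans_lt (by positivity)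
  · obtain ⟨m, rfl⟩ := Nat.exists_eq_add_of_lt hlt
    have hm : (1 : ℝ) ≤ m := by exact_mod_cast Nat.one_le_iff_ne_zero.2 (by lia : m ≠ 0)
    have hbernoulli : 1 + (m : ℝ) * 3 ≤ (1 + 3) ^ m := one_add_mul_le_pow (by norm_num) m
    calc (1 / 2 : ℝ) ^ (2 * (j + m + 1)) * ((j + m + 1 : ℕ) - j)
        = (1 / 2) ^ (2 * (j + 1)) * ((1 / 2) ^ (2 * m) * (m + 1)) := by
          push_cast
          ring
      _ < (1 / 2) ^ (2 * (j + 1)) * ((1 / 2) ^ (2 * m) * 4 ^ m) := by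
          gcongr
          norm_num at hbernoulli
          linarith
      _ = (1 / 2) ^ (2 * (j + 1)) := by
          rw [pow_mul _ 2 m, ← mul_pow]
          norm_num

section StandardDelay

variable {π : (mdp (standard n)).Policy} (hE : Evaluates (standard n) π v)
  (hπ : WeakInvariant π) (hj : π.1 (.b i) = .delay j)
include hE hπ hj

theorem standard_value_b : v (.b i) = v (.b 0) + 3 * j * (1 / 2) ^ (100 * n) := by
  rcases Nat.eq_zero_or_pos j with rfl | hpos
  · simp [hE.b_delay_zero hj, hE.b_first_of_weakInvariant hπ]
  · exact hE.b_delay hpos hj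

theorem standard_totalAppeal_b_delay (j' : ℕ) :
    (mdp (standard n)).totalAppeal v (.b i) (.delay j') =
      v (.b i) + (1 / 2) ^ (2 * j') * (j' - j) * (3 * (1 / 2) ^ (100 * n)) := by
  rcases Nat.eq_zero_or_pos j' with rfl | hpos
  · rw [totalAppeal_b_delay_zero, ← hE.b_first_of_weakInvariant hπ, standard_value_b hE hπ hj]
    push_cast
    ring
  · rw [totalAppeal_b_delay _ _ _ hpos]
    have hb := standard_value_b hE hπ hj
    rw [show v (.b 0) = v (.b i) - 3 * j * (1 / 2) ^ (100 * n) by linarith]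
    simp only [standard]
    ring

theorem standard_totalAppeal_b_delay_lt {j' : ℕ} (hne : j' ≠ j + 1) :
    (mdp (standard n)).totalAppeal v (.b i) (.delay j') <
      (mdp (standard n)).totalAppeal v (.b i) (.delay (j + 1)) := by
  have hgain := half_pow_mul_sub_lt hne
  rw [standard_totalAppeal_b_delay hE hπ hj, standard_totalAppeal_b_delay hE hπ hj,
    Nat.cast_succ, add_sub_cancel_left, mul_one]
  gcongr

theorem standard_totalAppeal_b_delay_le {j' : ℕ} (hle : j' ≤ j) :
    (mdp (standard n)).totalAppeal v (.b i) (.delay j') ≤ v (.b i) := by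
  have hle' : (j' : ℝ) ≤ j := by exact_mod_cast hle
  rw [standard_totalAppeal_b_delay hE hπ hj, add_le_iff_nonpos_right]
  exact mul_nonpos_of_nonpos_of_nonneg
    (mul_nonpos_of_nonneg_of_nonpos (by positivity) (by linarith)) (by positivity)

theorem standard_lt_totalAppeal_b_delay_succ :
    v (.b i) < (mdp (standard n)).totalAppeal v (.b i) (.delay (j + 1)) := by
  rw [standard_totalAppeal_b_delay hE hπ hj, Nat.cast_succ, add_sub_cancel_left]
  exact lt_add_of_pos_right _ (by positivity)

theorem standard_totalAppeal_b_one_lt (hi : i ≠ 0) :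
    (mdp (standard n)).totalAppeal v (.b i) .one <
      (mdp (standard n)).totalAppeal v (.b i) (.delay (j + 1)) := by
  have hd : v (dAt i.succ) ≤ v (.b i) := by
    refine (hE.d_le_b_first hπ standard_gaps i).trans ?_
    rw [standard_value_b hE hπ hj, le_add_iff_nonneg_right]
    positivity
  rw [standard_totalAppeal_b_delay hE hπ hj, Nat.cast_succ, add_sub_cancel_left, mul_one,
    totalAppeal_b_one _ _ _ hi, hE.bPlus]
  linarith [standard_α_mul_r_lt (le_f_of_delay hi hj),
    mul_le_mul_of_nonneg_left hd ((standard n).α_pos i).le]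

end StandardDelay

theorem standard_gadgetOrder : (standard n).GadgetOrder := by
  rintro π v appeal hπ ⟨hv, happeal⟩ i j hi hj
  obtain rfl : appeal = (mdp (standard n)).totalAppeal v := funext₂ happeal
  have hE := evaluates_of_hasTotalValue hv
  have hjf := le_f_of_delay hi hj
  split_ifs with hlast
  · have hone := hE.b_lt_totalAppeal_b_one hπ standard_gaps hi hj
    refine ⟨⟨.one, (avail_b hi).2 (.inl rfl), hone⟩, fun a ha hne => ?_⟩
    obtain ⟨j', hj', rfl⟩ := ((avail_b hi).1 ha).resolve_left hne
    exact (standard_totalAppeal_b_delay_le hE hπ hj (hj'.trans hlast.ge)).trans_lt hone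
  · refine ⟨⟨.delay (j + 1), (avail_b hi).2 (.inr ⟨j + 1, by lia, rfl⟩),
      standard_lt_totalAppeal_b_delay_succ hE hπ hj⟩, fun a ha hne => ?_⟩
    obtain rfl | ⟨j', -, rfl⟩ := (avail_b hi).1 ha
    · exact standard_totalAppeal_b_one_lt hE hπ hj hi
    · exact standard_totalAppeal_b_delay_lt hE hπ hj fun h => hne (h ▸ rfl)

theorem standard_admissible : (standard n).Admissible where
  rewardGap := standard_gaps.rewardGap
  costGap := standard_gaps.costGap
  firstBitBound := standard_gaps.firstBitBound
  setBitBounds := setBitBounds _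
  gadgetOrder := standard_gadgetOrder

end Params

end FullConstruction

end

theorem mainTheorem4 (n : ℕ) [NeZero n] :
    (∀ P : FullConstruction.Params n, P.Admissible →
      FullConstruction.CountsInBinary P (FullConstruction.mdp P).totalReward ∧
      FullConstruction.CountsInBinary P (FullConstruction.mdp P).averageReward) ∧
    (FullConstruction.Params.standard n).Admissible :=
  ⟨fun _ hP => ⟨FullConstruction.countsInBinary_totalReward hP,
    FullConstruction.countsInBinary_averageReward hP⟩,
    FullConstruction.Params.standard_admissible⟩
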